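/- **Setting.** Let $n\in\{2,3\}$, $k\ge 2$, $T>0$. Let $\Omega_0\subset\mathbb R^n$ be a bounded, connected, non-empty open set with smooth boundary $\Gamma_0$. Let $X:\overline{\Omega_0}\times[0,T]\to\mathbb R^n$ be a flow map that is smooth up to the boundary (the restriction of a $C^2$ map on $\mathbb R^n\times\mathbb R$), with $X(p,0)=p$, $X(\cdot,t)$ injective and $DX(\cdot,t)$ invertible on $\overline{\Omega_0}$; put $\Omega(t)=X(\Omega_0,t)$, $\Gamma(t)=X(\Gamma_0,t)$. Let $v$ be the velocity, $\partial_tX(p,t)=v(X(p,t),t)$, and assume that for all $t\in[0,T]$ $$-\Delta v(\cdot,t)=0\ \text{ in }\Omega(t),\qquad v(\cdot,t)=v^\Gamma(\cdot,t)\ \text{ on }\Gamma(t),$$ where $v^\Gamma$ is a given $C^1$ vector field on a space-time neighbourhood of $\bigcup_{t}\Gamma(t)\times\{t\}$. **Meshes.** Consider exact curved triangulations of $\overline{\Omega_0}$: finitely many curved simplices $\Phi^c_S(\widehat T)$, with $\Phi^c_S$ of class $C^2$ on the closed unit simplex $\widehat T\subset\mathbb R^n$, that cover $\overline{\Omega_0}$,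 meet only in common curved subsimplices with matching parametrizations, and whose boundary faces cover $\Gamma_0$. Let $h$ be the maximal diameter of the straight simplices with the same vertices. The triangulation is quasi-uniform with constants $\rho>0$, $\Lambda$ if each straight simplex contains a ball of radius $\rho h$ and $|D^2\Phi^c_S|\le\Lambda h^2$. The nodes $x^0_1,\dots,x^0_N$ are the images of the Lagrange points of degree $k$ of $\widehat T$ under the maps $\Phi^c_S$; superscripts $\Gamma$ and $\Omega$ denote the nodes on $\Gamma_0$ and the other (interior) nodes. A nodal vector $\mathbf x\in(\mathbb R^n)^N$ defines the isoparametric domain $\Omega_h(\mathbf x)$, the union of the elements $\Phi_S[\mathbf x](\widehat T)$, where $\Phi_S[\mathbf x]$ is the degree-$k$ Lagrange interpolant on $\widehat T$ with the entries of $\mathbf x$ as values, and the isoparametric basis functions $\varphi_j[\mathbf x]$, and the mass and stiffness matrices $$\mathbf M(\mathbf x)_{jl}=\int_{\Omega_h(\mathbf x)}\varphi_j[\mathbf x]\varphi_l[\mathbf x],\qquad \mathbf A(\mathbf x)_{jl}=\int_{\Omega_h(\mathbf x)}\nabla\varphi_j[\mathbf x]\cdot\nabla\varphi_l[\mathbf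 x]$$ (sums over the elements of integrals transformed to $\widehat T$), with blocks $\mathbf A_{21},\mathbf A_{22},\mathbf M_{22}$, where index $1$ stands for boundary and $2$ for interior nodes. Matrices act componentwise on vectors with entries in $\mathbb R^n$. **Semi-discrete velocity law.** Let $\mathbf x,\mathbf v:[0,T]\to(\mathbb R^n)^N$ satisfy $$\mathbf A_{22}(\mathbf x)\mathbf v^\Omega=-\mathbf A_{21}(\mathbf x)\mathbf v^\Gamma,\qquad \dot{\mathbf x}=\mathbf v,\qquad x_j(0)=x_j^0,$$ where $v_j(t)=v^\Gamma(x_j(t),t)$ for the boundary nodes. Let $x_j^*(t)=X(x_j^0,t)$ and $v_j^*(t)=v(x_j^*(t),t)$, and let the defect $\mathbf d_{\mathbf v^\Omega}$ be given by $$\mathbf A_{22}(\mathbf x^*)\mathbf v^{\Omega,*}=-\mathbf A_{21}(\mathbf x^*)\mathbf v^{\Gamma,*}+\mathbf M_{22}(\mathbf x^*)\mathbf d_{\mathbf v^\Omega}.$$ Put $\mathbf e_{\mathbf x^\Omega}=\mathbf x^\Omega-\mathbf x^{\Omega,*}$, $\mathbf e_{\mathbf v^\Omega}=\mathbf v^\Omega-\mathbf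 v^{\Omega,*}$, $\|\mathbf w\|_{\mathbf K}^2=\mathbf w^T\mathbf K\mathbf w$ and $\|\mathbf d\|_{\star,\mathbf x^*}^2=\mathbf d^T\mathbf M_{22}(\mathbf x^*)\mathbf A_{22}(\mathbf x^*)^{-1}\mathbf M_{22}(\mathbf x^*)\mathbf d$. **Lemma (stability of the semi-discrete harmonic velocity law).** Let the exact flow, $k$, $T$, $\rho$, $\Lambda$ be as above, let $\kappa>n/2$ (that is, $\kappa>3/2$ for $n=3$ and $\kappa>1$ for $n=2$) and $C\in\mathbb R$. Then there are $h_0>0$ and $c>0$, depending only on these data, such that for every triangulation that is quasi-uniform with constants $\rho,\Lambda$ and has mesh width $h\le h_0$, and every $\mathbf x,\mathbf v$ and $\mathbf d_{\mathbf v^\Omega}$ as above with $$\|\mathbf d_{\mathbf v^\Omega}(t)\|_{\star,\mathbf x^*(t)}\le C h^\kappa\quad\text{for all }t\in[0,T],$$ the following bounds hold for all $t\in[0,T]$: $$\|\mathbf e_{\mathbf x^\Omega}(t)\|^2_{\mathbf A_{22}(\mathbf x^*(t))}\le c\int_0^t\|\mathbf d_{\mathbf v^\Omega}(s)\|^2_{\star,\mathbf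 x^*(s)}\,ds,$$ $$\|\mathbf e_{\mathbf v^\Omega}(t)\|^2_{\mathbf A_{22}(\mathbf x^*(t))}\le c\,\|\mathbf d_{\mathbf v^\Omega}(t)\|^2_{\star,\mathbf x^*(t)}+c\int_0^t\|\mathbf d_{\mathbf v^\Omega}(s)\|^2_{\star,\mathbf x^*(s)}\,ds.$$ -/

import Mathlib

open Set MeasureTheory
open scoped ContDiff

noncomputable section

namespace EvolvingFEM

/-- Euclidean space `ℝⁿ`. -/
abbrev E (n : ℕ) : Type := EuclideanSpace ℝ (Fin n)

/-! ### The exact domain evolution -/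

/-- `Ω` has a smooth boundary: near each boundary point, `Ω` is the strict sublevel set of a smooth
function with non-vanishing derivative. -/
def HasSmoothBoundary {n : ℕ} (Ω : Set (E n)) : Prop :=
  ∀ p ∈ frontier Ω, ∃ U : Set (E n), IsOpen U ∧ p ∈ U ∧ ∃ φ : E n → ℝ,
    ContDiff ℝ ∞ φ ∧ φ p = 0 ∧ (∀ x ∈ U, fderiv ℝ φ x ≠ 0) ∧ Ω ∩ U = {x ∈ U | φ x < 0}

/-- A smooth solution on `[0,T]` of the harmonic velocity law
`∂ₜX(p,t) = v(X(p,t),t)`, `X(p,0) = p`, `-Δv(·,t) = 0` in `Ω(t)`, `v(·,t) = vΓ(·,t)` on `Γ(t)`,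
where `Ω(t) = X(Ω₀,t)` and `Γ(t) = X(Γ₀,t)`.
Smoothness of the flow map up to the boundary is expressed in the usual way: it is the restriction
to `[0,T] × closure Ω₀` of a map `X` that is smooth on the whole space. -/
structure HarmonicFlow (n : ℕ) (T : ℝ) where
  /-- the initial domain -/
  Ω₀ : Set (E n)
  isOpen : IsOpen Ω₀
  bounded : Bornology.IsBounded Ω₀
  connected : IsConnected Ω₀
  smoothBoundary : HasSmoothBoundary Ω₀
  /-- the flow map, `X t p = X(p,t)` -/
  X : ℝ → E n → E n
  smooth : ContDiff ℝ 2 (fun q : ℝ × E n => X q.1 q.2)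
  initial : ∀ p ∈ closure Ω₀, X 0 p = p
  injOn : ∀ t ∈ Icc (0 : ℝ) T, InjOn (X t) (closure Ω₀)
  nondegenerate : ∀ t ∈ Icc (0 : ℝ) T, ∀ p ∈ closure Ω₀, (fderiv ℝ (X t) p).det ≠ 0
  /-- the velocity field, `v t x = v(x,t)` -/
  v : ℝ → E n → E n
  velocity : ∀ t ∈ Icc (0 : ℝ) T, ∀ p ∈ closure Ω₀, HasDerivAt (fun s => X s p) (v t (X t p)) t
  harmonic : ∀ t ∈ Icc (0 : ℝ) T, InnerProductSpace.HarmonicOnNhd (v t) (X t '' Ω₀)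
  /-- the prescribed boundary velocity, defined and `C¹` on a space-time neighbourhood of the
  moving boundary -/
  vΓ : ℝ → E n → E n
  vΓ_smooth : ∃ U : Set (ℝ × E n), IsOpen U ∧
    (∀ t ∈ Icc (0 : ℝ) T, ∀ p ∈ frontier Ω₀, (t, X t p) ∈ U) ∧
    ContDiffOn ℝ 1 (fun q : ℝ × E n => vΓ q.1 q.2) U
  boundary : ∀ t ∈ Icc (0 : ℝ) T, ∀ p ∈ frontier Ω₀, v t (X t p) = vΓ t (X t p)

/-! ### The Lagrange element of degree `k` on the unit simplex -/

/-- The barycentric coordinates `(1 - ∑ ξᵢ, ξ₁, …, ξₙ)` of `ξ` with respect to the unit simplex. -/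
def bary {n : ℕ} (ξ : E n) : Fin (n + 1) → ℝ :=
  Fin.cons (α := fun _ => ℝ) (1 - ∑ i, ξ i) (fun i => ξ i)

/-- The closed unit simplex in `ℝⁿ`. -/
def refSimplex (n : ℕ) : Set (E n) := {ξ | ∀ i, 0 ≤ bary ξ i}

/-- Multi-indices `(a₀,…,aₙ)` with `a₀ + … + aₙ = k`; they number the local nodes. -/
abbrev LocalNode (n k : ℕ) : Type :=
  {a : Fin (n + 1) → Fin (k + 1) // ∑ i, (a i : ℕ) = k}

/-- The local node at the `i`-th vertex. -/
def vertexNode {n k : ℕ} (i : Fin (n + 1)) : LocalNode n k :=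
  ⟨fun j => if j = i then Fin.last k else 0, by
    have h : ∀ j : Fin (n + 1),
        (((if j = i then Fin.last k else 0 : Fin (k + 1))) : ℕ) = if j = i then k else 0 := by
      intro j
      split_ifs <;> simp
    simp [h]⟩

/-- The Lagrange point with barycentric coordinates `a / k`. -/
def lagrangePoint {n k : ℕ} (a : LocalNode n k) : E n :=
  WithLp.toLp 2 (fun i : Fin n => ((a.1 i.succ : ℕ) : ℝ) / k)

/-- The Lagrange shape function of degree `k`: the polynomial of degree `k` that is `1` at the
Lagrange point `a` and `0` at all others. -/
def shape {n k : ℕ} (a : LocalNode n k) (ξ : E n) : ℝ :=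
  ∏ i, ∏ m ∈ Finset.range (a.1 i : ℕ), ((k : ℝ) * bary ξ i - m) / (((a.1 i : ℕ) : ℝ) - m)

/-! ### Curved triangulations of the initial domain -/

/-- An exact curved triangulation of `closure Ω₀` together with its Lagrange nodes of order `k`.
The boundary nodes are `Sum.inl j`, the interior nodes are `Sum.inr j`. -/
structure CurvedMesh (n k : ℕ) (Ω₀ : Set (E n)) where
  /-- number of boundary nodes -/
  NΓ : ℕ
  /-- number of interior nodes -/
  NΩ : ℕ
  /-- number of elements -/
  Nel : ℕ
  /-- local-to-global numbering of the nodes -/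
  loc : Fin Nel → LocalNode n k → Fin NΓ ⊕ Fin NΩ
  /-- node positions -/
  x₀ : Fin NΓ ⊕ Fin NΩ → E n
  /-- parametrizations of the curved simplices over the unit simplex -/
  Φc : Fin Nel → E n → E n
  Φc_smooth : ∀ S, ContDiffOn ℝ 2 (Φc S) (refSimplex n)
  node : ∀ S a, x₀ (loc S a) = Φc S (lagrangePoint a)
  loc_injective : ∀ S, Function.Injective (loc S)
  loc_surj : ∀ j, ∃ S a, loc S a = j
  x₀_injective : Function.Injective x₀
  boundaryNode : ∀ j, x₀ (Sum.inl j) ∈ frontier Ω₀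
  interiorNode : ∀ j, x₀ (Sum.inr j) ∉ frontier Ω₀
  cover : (⋃ S, Φc S '' refSimplex n) = closure Ω₀
  /-- Two points of curved simplices coincide exactly if they have the same barycentric coordinates
  with respect to the same vertices; so each parametrization is injective, and two curved simplices
  that meet do so in the curved image of a common subsimplex, with matching parametrizations. -/
  glue : ∀ S S' : Fin Nel, ∀ ξ ∈ refSimplex n, ∀ ξ' ∈ refSimplex n,
    Φc S ξ = Φc S' ξ' ↔ ∀ j,
      (∑ i, if loc S (vertexNode i) = j then bary ξ i else 0) =
        ∑ i, if loc S' (vertexNode i) = j then bary ξ' i else 0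
  /-- different elements have different sets of vertices -/
  distinct : ∀ S S' : Fin Nel,
    (∀ i, ∃ i', loc S (vertexNode i) = loc S' (vertexNode i')) → S = S'
  /-- the boundary is covered by curved faces that lie in the boundary -/
  boundaryFaces : ∀ x ∈ frontier Ω₀, ∃ S i, (∃ ξ ∈ refSimplex n, bary ξ i = 0 ∧ Φc S ξ = x) ∧
    ∀ ξ ∈ refSimplex n, bary ξ i = 0 → Φc S ξ ∈ frontier Ω₀

namespace CurvedMesh

variable {n k : ℕ} {Ω₀ : Set (E n)} (M : CurvedMesh n k Ω₀)

/-- The type of the nodes. -/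
abbrev Node : Type := Fin M.NΓ ⊕ Fin M.NΩ

/-- The straight simplex with the same vertices as the curved simplex `S`. -/
def straight (S : Fin M.Nel) : Set (E n) :=
  convexHull ℝ (range fun i : Fin (n + 1) => M.x₀ (M.loc S (vertexNode i)))

/-- The mesh width: the maximal diameter of the straight simplices. -/
def width : ℝ := ⨆ S, Metric.diam (M.straight S)

/-- Quasi-uniform admissible triangulations, with constants `ρ` and `Λ` (to be chosen independently
of the mesh): each straight simplex contains a ball of radius `ρ h`, and the parametrizations of
the curved simplices have second derivatives bounded by `Λ h²`. -/
def QuasiUniform (ρ Λ : ℝ) : Prop :=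
  (∀ S, ∃ z, Metric.closedBall z (ρ * M.width) ⊆ M.straight S) ∧
  ∀ S, ∀ ξ ∈ refSimplex n,
    ‖iteratedFDerivWithin ℝ 2 (M.Φc S) (refSimplex n) ξ‖ ≤ Λ * M.width ^ 2

/-! ### Evolving isoparametric finite elements

A nodal vector `x` defines the discrete domain consisting of the isoparametric elements
`Φ_S[x](refSimplex)`; functions on an element are written in the reference coordinate `ξ`. -/

/-- The isoparametric element map `Φ_S[x]` belonging to the nodal vector `x`. -/
def elementMap (x : M.Node → E n) (S : Fin M.Nel) (ξ : E n) : E n :=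
  ∑ a, shape a ξ • x (M.loc S a)

/-- The Jacobian of the element map. -/
def jacobian (x : M.Node → E n) (S : Fin M.Nel) (ξ : E n) : E n →L[ℝ] E n :=
  fderiv ℝ (M.elementMap x S) ξ

/-- The finite element basis function of node `j` on the element `S`, pulled back to the unit
simplex: `φ_j[x](Φ_S[x](ξ))`. By the transport property it does not depend on `x`. -/
def basis (j : M.Node) (S : Fin M.Nel) (ξ : E n) : ℝ :=
  ∑ a, if M.loc S a = j then shape a ξ else 0

/-- The gradient of the basis function on the discrete domain, `(∇φ_j[x])(Φ_S[x](ξ))`, which by the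
chain rule is the inverse transposed Jacobian applied to the gradient of the pullback. -/
def basisGrad (x : M.Node → E n) (j : M.Node) (S : Fin M.Nel) (ξ : E n) : E n :=
  ContinuousLinearMap.adjoint (M.jacobian x S ξ).inverse (gradient (M.basis j S) ξ)

/-- The mass matrix `M(x)_{jl} = ∫_{Ω_h(x)} φ_j[x] φ_l[x]`, assembled element by element; each
integral over an element is written in the reference coordinate. -/
def massMatrix (x : M.Node → E n) : Matrix M.Node M.Node ℝ := fun j l =>
  ∑ S, ∫ ξ in refSimplex n, M.basis j S ξ * M.basis l S ξ * |(M.jacobian x S ξ).det|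

/-- The stiffness matrix `A(x)_{jl} = ∫_{Ω_h(x)} ∇φ_j[x] · ∇φ_l[x]`, assembled element by element;
each integral over an element is written in the reference coordinate. -/
def stiffnessMatrix (x : M.Node → E n) : Matrix M.Node M.Node ℝ := fun j l =>
  ∑ S, ∫ ξ in refSimplex n,
    inner ℝ (M.basisGrad x j S ξ) (M.basisGrad x l S ξ) * |(M.jacobian x S ξ).det|

/-- The block of the mass matrix belonging to the interior nodes. -/
def M₂₂ (x : M.Node → E n) : Matrix (Fin M.NΩ) (Fin M.NΩ) ℝ := (M.massMatrix x).toBlocks₂₂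

/-- The interior-boundary block of the stiffness matrix. -/
def A₂₁ (x : M.Node → E n) : Matrix (Fin M.NΩ) (Fin M.NΓ) ℝ := (M.stiffnessMatrix x).toBlocks₂₁

/-- The block of the stiffness matrix belonging to the interior nodes. -/
def A₂₂ (x : M.Node → E n) : Matrix (Fin M.NΩ) (Fin M.NΩ) ℝ := (M.stiffnessMatrix x).toBlocks₂₂

end CurvedMesh

/-! ### Kronecker products and norms -/

/-- `(Iₙ ⊗ B) w` for a vector `w` with entries in `ℝⁿ`. -/
def kron {n p q : ℕ} (B : Matrix (Fin p) (Fin q) ℝ) (w : Fin q → E n) : Fin p → E n :=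
  fun j => ∑ l, B j l • w l

/-- The (semi-)norm `‖w‖_B = (wᵀ (Iₙ ⊗ B) w)^{1/2}`. -/
def energyNorm {n p : ℕ} (B : Matrix (Fin p) (Fin p) ℝ) (w : Fin p → E n) : ℝ :=
  √(∑ j, inner ℝ (w j) (kron B w j))

/-- The dual norm `‖d‖_{⋆,x} = (dᵀ M₂₂(x) A₂₂(x)⁻¹ M₂₂(x) d)^{1/2}`. -/
def starNorm {n k : ℕ} {Ω₀ : Set (E n)} (M : CurvedMesh n k Ω₀) (x : M.Node → E n)
    (d : Fin M.NΩ → E n) : ℝ :=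
  energyNorm (M.A₂₂ x)⁻¹ (kron (M.M₂₂ x) d)

/-! ### The semi-discrete harmonic velocity law, its defect and its errors -/

section
variable {n k : ℕ} {T : ℝ} (F : HarmonicFlow n T) (M : CurvedMesh n k F.Ω₀)

/-- The vector `x*(t)` of the exact positions `X(x_j⁰,t)` of the nodes. -/
def xStar (t : ℝ) : M.Node → E n := fun j => F.X t (M.x₀ j)

/-- The vector `v*(t)` of the values of the exact velocity in the nodes `x*(t)`. -/
def vStar (t : ℝ) : M.Node → E n := fun j => F.v t (F.X t (M.x₀ j))

/-- `(x, v)` solves the semi-discrete velocity law on `[0,T]`: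
`(I ⊗ A₂₂(x)) v^Ω = -(I ⊗ A₂₁(x)) v^Γ`, `ẋ = v`, where the boundary nodes have the prescribed
velocity, and `x(0) = x⁰`. -/
structure IsSemidiscreteSolution (x v : ℝ → M.Node → E n) : Prop where
  initial : x 0 = M.x₀
  ode : ∀ t ∈ Icc (0 : ℝ) T, ∀ j, HasDerivWithinAt (fun s => x s j) (v t j) (Icc 0 T) t
  boundary : ∀ t ∈ Icc (0 : ℝ) T, ∀ j, v t (Sum.inl j) = F.vΓ t (x t (Sum.inl j))
  interior : ∀ t ∈ Icc (0 : ℝ) T,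
    kron (M.A₂₂ (x t)) (fun j => v t (Sum.inr j)) =
      -kron (M.A₂₁ (x t)) (fun j => v t (Sum.inl j))

/-- `d` is the defect of the exact nodal vectors:
`(I ⊗ A₂₂(x*)) v^{Ω,*} = -(I ⊗ A₂₁(x*)) v^{Γ,*} + M₂₂(x*) d` on `[0,T]`. -/
def IsVelocityDefect (d : ℝ → Fin M.NΩ → E n) : Prop :=
  ∀ t ∈ Icc (0 : ℝ) T,
    kron (M.A₂₂ (xStar F M t)) (fun j => vStar F M t (Sum.inr j)) =
      -kron (M.A₂₁ (xStar F M t)) (fun j => vStar F M t (Sum.inl j)) +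
        kron (M.M₂₂ (xStar F M t)) (d t)

/-- The position error `e_{x^Ω} = x^Ω - x^{Ω,*}` in the interior nodes. -/
def positionError (x : ℝ → M.Node → E n) (t : ℝ) : Fin M.NΩ → E n :=
  fun j => x t (Sum.inr j) - xStar F M t (Sum.inr j)

/-- The velocity error `e_{v^Ω} = v^Ω - v^{Ω,*}` in the interior nodes. -/
def velocityError (v : ℝ → M.Node → E n) (t : ℝ) : Fin M.NΩ → E n :=
  fun j => v t (Sum.inr j) - vStar F M t (Sum.inr j)

end

end EvolvingFEM

end

noncomputable section

namespace EvolvingFEM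

/-! ### Generalized binomial coefficients and the Vandermonde identity -/

theorem prod_range_div_eq_choose (r : ℝ) (a : ℕ) :
    ∏ m ∈ Finset.range a, (r - m) / ((a : ℝ) - m) = Ring.choose r a := by
  have h1 : ∏ m ∈ Finset.range a, ((a : ℝ) - m) = a.factorial := by
    rw [← Nat.descFactorial_self, Nat.descFactorial_eq_prod_range]
    push_cast
    refine Finset.prod_congr rfl fun m hm => ?_
    rw [Nat.cast_sub (Finset.mem_range.1 hm).le]
  have h2 : ∏ m ∈ Finset.range a, (r - m) = a.factorial * Ring.choose r a := by
    have := Ring.descPochhammer_eq_factorial_smul_choose r a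
    rw [nsmul_eq_mul] at this
    rw [← this, ← Polynomial.aeval_eq_smeval, ← Polynomial.eval_map_algebraMap]
    rw [descPochhammer_map, descPochhammer_eval_eq_prod_range]
  rw [Finset.prod_div_distrib, h1, h2]
  field_simp

theorem natCast_mul_choose (r : ℝ) (a : ℕ) :
    (a : ℝ) * Ring.choose r a = if a = 0 then 0 else r * Ring.choose (r - 1) (a - 1) := by
  rcases a with _ | a
  · simp
  · have h := Ring.choose_succ_succ (r - 1) a
    rw [sub_add_cancel] at h
    simp only [Nat.cast_add, Nat.cast_one, Nat.add_eq_zero_iff, one_ne_zero, and_false, if_false,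
      Nat.add_sub_cancel]
    rw [← prod_range_div_eq_choose, ← prod_range_div_eq_choose, Finset.prod_div_distrib,
      Finset.prod_div_distrib, Finset.prod_range_succ', Finset.prod_range_succ' (fun m : ℕ =>
      (((a + 1 : ℕ) : ℝ) - m))]
    have e1 : ∀ m : ℕ, (r - ((m + 1 : ℕ) : ℝ)) = r - 1 - m := by intro m; push_cast; ring
    have e2 : ∀ m : ℕ, (((a + 1 : ℕ) : ℝ) - ((m + 1 : ℕ) : ℝ)) = a - m := by
      intro m; push_cast; ring
    simp only [e1, e2]
    have h3 : ∏ m ∈ Finset.range a, ((a : ℝ) - m) ≠ 0 := by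
      refine Finset.prod_ne_zero_iff.2 fun m hm => ?_
      have := Finset.mem_range.1 hm
      have : (m : ℝ) < a := by exact_mod_cast this
      linarith [this]
    have h4 : (a : ℝ) + 1 ≠ 0 := by positivity
    push_cast
    field_simp
    ring

theorem sum_localNode_prod {n k : ℕ} (f : Fin (n + 1) → ℕ → ℝ) :
    ∑ a : LocalNode n k, ∏ i, f i (a.1 i : ℕ) =
      PowerSeries.coeff k (∏ i, PowerSeries.mk (f i)) := by
  classical
  rw [PowerSeries.coeff_prod]
  simp only [PowerSeries.coeff_mk]
  refine Finset.sum_bij (fun a _ => Finsupp.equivFunOnFinite.symm fun i => (a.1 i : ℕ))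
    ?_ ?_ ?_ ?_
  · intro a _
    simp [Finset.mem_finsuppAntidiag, a.2]
  · intro a _ b _ hab
    apply Subtype.ext
    funext i
    have := DFunLike.congr_fun hab i
    exact Fin.ext (by simpa using this)
  · intro l hl
    rw [Finset.mem_finsuppAntidiag] at hl
    have hle : ∀ i, l i < k + 1 := fun i => by
      rw [← hl.1]
      exact Nat.lt_succ_of_le (Finset.single_le_sum (f := fun i => l i) (fun _ _ => Nat.zero_le _)
        (Finset.mem_univ i))
    refine ⟨⟨fun i => ⟨l i, hle i⟩, ?_⟩, Finset.mem_univ _, ?_⟩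
    · simpa using hl.1
    · ext i; simp
  · intro a _
    simp

theorem prod_binomialSeries {ι : Type*} (s : Finset ι) (r : ι → ℝ) :
    ∏ i ∈ s, PowerSeries.binomialSeries ℝ (r i) = PowerSeries.binomialSeries ℝ (∑ i ∈ s, r i) := by
  classical
  induction s using Finset.induction_on with
  | empty => simp
  | insert i s hi ih =>
    rw [Finset.prod_insert hi, Finset.sum_insert hi, PowerSeries.binomialSeries_add, ih]

theorem mk_choose (r : ℝ) :
    PowerSeries.mk (fun a => Ring.choose r a) = PowerSeries.binomialSeries ℝ r := by
  ext a
  simp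

theorem mk_natCast_mul_choose (r : ℝ) :
    PowerSeries.mk (fun a => (a : ℝ) * Ring.choose r a) =
      PowerSeries.X * (PowerSeries.C r * PowerSeries.binomialSeries ℝ (r - 1)) := by
  ext a
  rw [PowerSeries.coeff_mk, natCast_mul_choose]
  rcases a with _ | a
  · simp
  · rw [mul_comm PowerSeries.X, PowerSeries.coeff_succ_mul_X]
    simp

theorem sum_prod_choose {n k : ℕ} (r : Fin (n + 1) → ℝ) (hr : ∑ i, r i = k) :
    ∑ a : LocalNode n k, ∏ i, Ring.choose (r i) (a.1 i : ℕ) = 1 := by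
  rw [sum_localNode_prod (fun i m => Ring.choose (r i) m)]
  simp only [mk_choose]
  rw [prod_binomialSeries, hr, PowerSeries.binomialSeries_coeff, Ring.choose_natCast]
  simp

theorem sum_prod_choose_mul {n k : ℕ} (hk : 1 ≤ k) (r : Fin (n + 1) → ℝ) (hr : ∑ i, r i = k)
    (i₀ : Fin (n + 1)) :
    ∑ a : LocalNode n k, ((a.1 i₀ : ℕ) : ℝ) * ∏ i, Ring.choose (r i) (a.1 i : ℕ) = r i₀ := by
  classical
  have h : ∀ a : LocalNode n k, ((a.1 i₀ : ℕ) : ℝ) * ∏ i, Ring.choose (r i) (a.1 i : ℕ) =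
      ∏ i, (fun m : ℕ => if i = i₀ then (m : ℝ) * Ring.choose (r i) m else Ring.choose (r i) m)
        (a.1 i : ℕ) := by
    intro a
    rw [← Finset.mul_prod_erase _ _ (Finset.mem_univ i₀),
      ← Finset.mul_prod_erase _ _ (Finset.mem_univ i₀), ← mul_assoc]
    simp only [if_true]
    congr 1
    refine Finset.prod_congr rfl fun i hi => ?_
    simp [Finset.ne_of_mem_erase hi]
  simp only [h]
  rw [sum_localNode_prod (fun i m =>
    if i = i₀ then (m : ℝ) * Ring.choose (r i) m else Ring.choose (r i) m)]
  rw [← Finset.mul_prod_erase _ _ (Finset.mem_univ i₀)]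
  have h2 : ∏ x ∈ Finset.univ.erase i₀, PowerSeries.mk (fun m : ℕ =>
      if x = i₀ then (m : ℝ) * Ring.choose (r x) m else Ring.choose (r x) m) =
      PowerSeries.binomialSeries ℝ (∑ i ∈ Finset.univ.erase i₀, r i) := by
    rw [← prod_binomialSeries]
    refine Finset.prod_congr rfl fun i hi => ?_
    simp [Finset.ne_of_mem_erase hi, mk_choose]
  rw [h2]
  simp only [if_true]
  rw [mk_natCast_mul_choose, mul_assoc, mul_assoc, ← PowerSeries.binomialSeries_add]
  have h3 : r i₀ - 1 + ∑ i ∈ Finset.univ.erase i₀, r i = ((k - 1 : ℕ) : ℝ) := by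
    rw [Nat.cast_sub hk, ← hr, ← Finset.add_sum_erase _ _ (Finset.mem_univ i₀)]
    push_cast; ring
  rw [h3]
  obtain ⟨k, rfl⟩ : ∃ k', k = k' + 1 := ⟨k - 1, by omega⟩
  rw [mul_comm PowerSeries.X, PowerSeries.coeff_succ_mul_X, PowerSeries.coeff_C_mul,
    PowerSeries.binomialSeries_coeff, Nat.add_sub_cancel, Ring.choose_natCast]
  simp

/-! ### The unit simplex -/

theorem bary_zero {n : ℕ} (ξ : E n) : bary ξ 0 = 1 - ∑ i, ξ i := rfl

theorem bary_succ {n : ℕ} (ξ : E n) (i : Fin n) : bary ξ i.succ = ξ i := rfl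

theorem sum_bary {n : ℕ} (ξ : E n) : ∑ i, bary ξ i = 1 := by
  rw [Fin.sum_univ_succ, bary_zero]
  simp [bary_succ]

theorem ext_of_bary {n : ℕ} {ξ η : E n} (h : ∀ i, bary ξ i = bary η i) : ξ = η := by
  ext i
  simpa [bary_succ] using h i.succ

theorem contDiff_bary {n : ℕ} (i : Fin (n + 1)) {m : WithTop ℕ∞} :
    ContDiff ℝ m (fun ξ : E n => bary ξ i) := by
  refine Fin.cases ?_ (fun i => ?_) i
  · simp only [bary_zero]
    fun_prop
  · simp only [bary_succ]
    fun_prop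

theorem bary_le_one {n : ℕ} {ξ : E n} (hξ : ξ ∈ refSimplex n) (i : Fin (n + 1)) :
    bary ξ i ≤ 1 := by
  rw [← sum_bary ξ]
  exact Finset.single_le_sum (f := fun i => bary ξ i) (fun j _ => hξ j) (Finset.mem_univ i)

theorem norm_le_one_of_mem_refSimplex {n : ℕ} {ξ : E n} (hξ : ξ ∈ refSimplex n) : ‖ξ‖ ≤ 1 := by
  have h : ‖ξ‖ ^ 2 ≤ 1 := by
    rw [EuclideanSpace.norm_sq_eq]
    have h1 : ∀ i : Fin n, ‖ξ i‖ ^ 2 ≤ ξ i := fun i => by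
      have a := hξ i.succ
      have b := bary_le_one hξ i.succ
      rw [bary_succ] at a b
      rw [Real.norm_eq_abs, sq_abs]
      nlinarith
    refine (Finset.sum_le_sum fun i _ => h1 i).trans ?_
    have := hξ 0
    rw [bary_zero] at this
    linarith
  nlinarith [norm_nonneg ξ]

theorem isCompact_refSimplex (n : ℕ) : IsCompact (refSimplex n) := by
  refine Metric.isCompact_of_isClosed_isBounded ?_ ?_
  · have : refSimplex n = ⋂ i, {ξ | 0 ≤ bary ξ i} := by ext; simp [refSimplex]
    rw [this]
    exact isClosed_iInter fun i => isClosed_le continuous_const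
      (contDiff_bary (m := 0) i).continuous
  · exact Metric.isBounded_closedBall (x := (0 : E n)) (r := 1) |>.subset fun ξ hξ => by
      simpa using norm_le_one_of_mem_refSimplex hξ

theorem bary_combination {n : ℕ} (ξ η : E n) (a b : ℝ) (hab : a + b = 1) (i : Fin (n + 1)) :
    bary (a • ξ + b • η) i = a * bary ξ i + b * bary η i := by
  refine Fin.cases ?_ (fun i => ?_) i
  · simp only [bary_zero, PiLp.add_apply, PiLp.smul_apply, smul_eq_mul, Finset.sum_add_distrib,
      ← Finset.mul_sum]
    linear_combination -hab
  · simp [bary_succ]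

theorem convex_refSimplex (n : ℕ) : Convex ℝ (refSimplex n) := by
  intro ξ hξ η hη a b ha hb hab i
  rw [bary_combination ξ η a b hab]
  exact add_nonneg (mul_nonneg ha (hξ i)) (mul_nonneg hb (hη i))

/-- The open simplex. -/
def openRefSimplex (n : ℕ) : Set (E n) := {ξ | ∀ i, 0 < bary ξ i}

theorem isOpen_openRefSimplex (n : ℕ) : IsOpen (openRefSimplex n) := by
  have : openRefSimplex n = ⋂ i, {ξ | 0 < bary ξ i} := by ext; simp [openRefSimplex]
  rw [this]
  exact isOpen_iInter_of_finite fun i => isOpen_lt continuous_const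
    (contDiff_bary (m := 0) i).continuous

theorem openRefSimplex_subset (n : ℕ) : openRefSimplex n ⊆ refSimplex n := fun _ h i => (h i).le

/-- The barycentre of the unit simplex. -/
def barycenter (n : ℕ) : E n := WithLp.toLp 2 fun _ => 1 / ((n : ℝ) + 1)

theorem barycenter_mem (n : ℕ) : barycenter n ∈ openRefSimplex n := by
  have hn : (0 : ℝ) < n + 1 := by positivity
  intro i
  refine Fin.cases ?_ (fun i => ?_) i
  · simp only [bary_zero, barycenter]
    simp only [Finset.sum_const, Finset.card_univ, Fintype.card_fin, nsmul_eq_mul]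
    rw [sub_pos, mul_one_div, div_lt_one hn]
    linarith
  · simp only [bary_succ, barycenter]
    positivity

theorem refSimplex_subset_closure (n : ℕ) : refSimplex n ⊆ closure (openRefSimplex n) := by
  intro ξ hξ
  have hc : Filter.Tendsto (fun s : ℝ => (1 - s) • ξ + s • barycenter n) (nhdsWithin 0 (Ioi 0))
      (nhds ξ) := by
    have : Continuous (fun s : ℝ => (1 - s) • ξ + s • barycenter n) := by fun_prop
    have h0 := this.tendsto 0
    simp only [sub_zero, one_smul, zero_smul, add_zero] at h0
    exact h0.mono_left nhdsWithin_le_nhds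
  refine mem_closure_of_tendsto hc ?_
  have h1 : Ioo (0 : ℝ) 1 ∈ nhdsWithin (0 : ℝ) (Ioi 0) := Ioo_mem_nhdsGT one_pos
  filter_upwards [h1] with s hs i
  rw [bary_combination _ _ _ _ (by ring)]
  have := barycenter_mem n i
  exact add_pos_of_nonneg_of_pos (mul_nonneg (by linarith [hs.2]) (hξ i)) (mul_pos hs.1 this)

theorem interior_refSimplex_nonempty (n : ℕ) : (interior (refSimplex n)).Nonempty :=
  ⟨barycenter n, interior_maximal (openRefSimplex_subset n) (isOpen_openRefSimplex n)
    (barycenter_mem n)⟩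

theorem uniqueDiffOn_refSimplex (n : ℕ) : UniqueDiffOn ℝ (refSimplex n) :=
  uniqueDiffOn_convex (convex_refSimplex n) (interior_refSimplex_nonempty n)

/-! ### The Lagrange shape functions -/

variable {n k : ℕ}

theorem bary_lagrangePoint (hk : 1 ≤ k) (a : LocalNode n k) (i : Fin (n + 1)) :
    bary (lagrangePoint a) i = ((a.1 i : ℕ) : ℝ) / k := by
  have hk' : (k : ℝ) ≠ 0 := by positivity
  refine Fin.cases ?_ (fun i => ?_) i
  · have h := a.2
    rw [Fin.sum_univ_succ] at h
    have h' : ((a.1 0 : ℕ) : ℝ) + ∑ i : Fin n, ((a.1 i.succ : ℕ) : ℝ) = k := by exact_mod_cast h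
    rw [bary_zero]
    simp only [lagrangePoint]
    rw [← Finset.sum_div, eq_div_iff hk', sub_mul, div_mul_cancel₀ _ hk']
    linarith
  · rfl

theorem lagrangePoint_mem (hk : 1 ≤ k) (a : LocalNode n k) : lagrangePoint a ∈ refSimplex n :=
  fun i => by rw [bary_lagrangePoint hk]; positivity

theorem bary_vertex (hk : 1 ≤ k) (i j : Fin (n + 1)) :
    bary (lagrangePoint (vertexNode (k := k) i)) j = if j = i then 1 else 0 := by
  have hk' : (k : ℝ) ≠ 0 := by positivity
  rw [bary_lagrangePoint hk, vertexNode]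
  split_ifs with h <;> simp [hk', h]

theorem shape_eq_prod_choose (a : LocalNode n k) (ξ : E n) :
    shape a ξ = ∏ i, Ring.choose ((k : ℝ) * bary ξ i) (a.1 i : ℕ) := by
  simp only [shape, prod_range_div_eq_choose]

theorem contDiff_shape (a : LocalNode n k) {m : WithTop ℕ∞} : ContDiff ℝ m (shape a) := by
  unfold shape
  refine contDiff_prod fun i _ => contDiff_prod fun j _ => ?_
  exact ((contDiff_const.mul (contDiff_bary i)).sub contDiff_const).div_const _

theorem sum_shape (ξ : E n) : ∑ a : LocalNode n k, shape a ξ = 1 := by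
  simp only [shape_eq_prod_choose]
  exact sum_prod_choose _ (by rw [← Finset.mul_sum, sum_bary, mul_one])

theorem sum_shape_smul_lagrangePoint (hk : 1 ≤ k) (ξ : E n) :
    ∑ a : LocalNode n k, shape a ξ • lagrangePoint a = ξ := by
  have hk' : (k : ℝ) ≠ 0 := by positivity
  ext i
  have h := sum_prod_choose_mul hk (fun i => (k : ℝ) * bary ξ i)
    (by rw [← Finset.mul_sum, sum_bary, mul_one]) i.succ
  have e : (∑ a : LocalNode n k, shape a ξ • lagrangePoint a) i =
      (∑ a : LocalNode n k, ((a.1 i.succ : ℕ) : ℝ) * shape a ξ) / k := by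
    rw [Finset.sum_div, WithLp.ofLp_sum, Finset.sum_apply]
    refine Finset.sum_congr rfl fun a _ => ?_
    simp only [lagrangePoint, PiLp.smul_apply, smul_eq_mul]
    ring
  rw [e]
  simp only [shape_eq_prod_choose]
  rw [h, bary_succ]
  field_simp

theorem shape_lagrangePoint (hk : 1 ≤ k) (a b : LocalNode n k) :
    shape a (lagrangePoint b) = if a = b then 1 else 0 := by
  have hk' : (k : ℝ) ≠ 0 := by positivity
  have e : shape a (lagrangePoint b) = ∏ i, ((Nat.choose (b.1 i : ℕ) (a.1 i : ℕ) : ℕ) : ℝ) := by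
    rw [shape_eq_prod_choose]
    refine Finset.prod_congr rfl fun i _ => ?_
    rw [bary_lagrangePoint hk, mul_div_cancel₀ _ hk', Ring.choose_natCast]
  rw [e]
  split_ifs with h
  · subst h
    simp
  · have : ∃ i, (b.1 i : ℕ) < (a.1 i : ℕ) := by
      by_contra! hle
      apply h
      have hs : ∀ i ∈ Finset.univ, (a.1 i : ℕ) = (b.1 i : ℕ) :=
        (Finset.sum_eq_sum_iff_of_le fun i _ => hle i).1 (by rw [a.2, b.2])
      exact Subtype.ext (funext fun i => Fin.ext (hs i (Finset.mem_univ i)))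
    obtain ⟨i, hi⟩ := this
    refine Finset.prod_eq_zero (Finset.mem_univ i) ?_
    rw [Nat.choose_eq_zero_of_lt hi, Nat.cast_zero]

theorem differentiable_shape (a : LocalNode n k) : Differentiable ℝ (shape a) :=
  (contDiff_shape a (m := 1)).differentiable one_ne_zero

theorem continuous_fderiv_shape (a : LocalNode n k) : Continuous (fderiv ℝ (shape a)) :=
  (contDiff_shape a (m := 1)).continuous_fderiv one_ne_zero

theorem sum_fderiv_shape (ξ : E n) : ∑ a : LocalNode n k, fderiv ℝ (shape a) ξ = 0 := by
  rw [← fderiv_fun_sum (fun a _ => differentiable_shape a ξ)]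
  simp only [sum_shape]
  simp

theorem sum_fderiv_shape_smul_lagrangePoint (hk : 1 ≤ k) (ξ v : E n) :
    ∑ a : LocalNode n k, fderiv ℝ (shape a) ξ v • lagrangePoint a = v := by
  have h : HasFDerivAt (fun ξ => ∑ a : LocalNode n k, shape a ξ • lagrangePoint a)
      (∑ a : LocalNode n k, (fderiv ℝ (shape a) ξ).smulRight (lagrangePoint a)) ξ :=
    HasFDerivAt.fun_sum fun a _ =>
      (differentiable_shape a ξ).hasFDerivAt.smul_const (lagrangePoint a)
  simp only [sum_shape_smul_lagrangePoint hk] at h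
  have := congrArg (fun L : E n →L[ℝ] E n => L v) (h.unique (hasFDerivAt_id ξ))
  simpa using this

/-! ### Operators that are bounded below -/

theorem exists_equiv_of_bound {J : E n →L[ℝ] E n} {m : ℝ} (hm : 0 < m)
    (h : ∀ w, m * ‖w‖ ≤ ‖J w‖) : ∃ e : E n ≃L[ℝ] E n, (e : E n →L[ℝ] E n) = J := by
  have hinj : Function.Injective (J : E n →ₗ[ℝ] E n) := by
    rw [← LinearMap.ker_eq_bot, LinearMap.ker_eq_bot']
    intro w hw
    have h1 := h w
    have h2 : J w = 0 := hw
    rw [h2, norm_zero] at h1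
    exact norm_le_zero_iff.1 (nonpos_of_mul_nonpos_right h1 hm)
  refine ⟨(LinearEquiv.ofInjectiveEndo (J : E n →ₗ[ℝ] E n) hinj).toContinuousLinearEquiv, ?_⟩
  ext w
  rfl

theorem inverse_comp_of_bound {J : E n →L[ℝ] E n} {m : ℝ} (hm : 0 < m)
    (h : ∀ w, m * ‖w‖ ≤ ‖J w‖) (w : E n) : J.inverse (J w) = w := by
  obtain ⟨e, rfl⟩ := exists_equiv_of_bound hm h
  simp

theorem comp_inverse_of_bound {J : E n →L[ℝ] E n} {m : ℝ} (hm : 0 < m)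
    (h : ∀ w, m * ‖w‖ ≤ ‖J w‖) (w : E n) : J (J.inverse w) = w := by
  obtain ⟨e, rfl⟩ := exists_equiv_of_bound hm h
  simp

theorem norm_inverse_le_of_bound {J : E n →L[ℝ] E n} {m : ℝ} (hm : 0 < m)
    (h : ∀ w, m * ‖w‖ ≤ ‖J w‖) : ‖J.inverse‖ ≤ m⁻¹ := by
  refine ContinuousLinearMap.opNorm_le_bound _ (by positivity) fun w => ?_
  have := h (J.inverse w)
  rw [comp_inverse_of_bound hm h] at this
  rw [inv_mul_eq_div, le_div_iff₀ hm, mul_comm]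
  exact this

theorem bound_of_norm_sub_le {J J' : E n →L[ℝ] E n} {m ε : ℝ}
    (h : ∀ w, m * ‖w‖ ≤ ‖J w‖) (h' : ‖J' - J‖ ≤ ε) (w : E n) : (m - ε) * ‖w‖ ≤ ‖J' w‖ := by
  have h1 : ‖(J' - J) w‖ ≤ ε * ‖w‖ := (J' - J).le_of_opNorm_le h' w
  have h2 : J w = J' w - (J' - J) w := by simp
  have h3 := norm_sub_le (J' w) ((J' - J) w)
  rw [← h2] at h3
  have := h w
  linarith

theorem norm_inverse_sub_le_of_bound {J J' : E n →L[ℝ] E n} {m m' : ℝ} (hm : 0 < m) (hm' : 0 < m')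
    (h : ∀ w, m * ‖w‖ ≤ ‖J w‖) (h' : ∀ w, m' * ‖w‖ ≤ ‖J' w‖) :
    ‖J'.inverse - J.inverse‖ ≤ m'⁻¹ * m⁻¹ * ‖J' - J‖ := by
  have e : J'.inverse - J.inverse = -(J'.inverse ∘L ((J' - J) ∘L J.inverse)) := by
    ext1 w
    simp only [sub_apply, neg_apply,
      ContinuousLinearMap.comp_apply, map_sub]
    rw [inverse_comp_of_bound hm' h', comp_inverse_of_bound hm h]
    abel
  rw [e, norm_neg]
  refine (ContinuousLinearMap.opNorm_comp_le _ _).trans ?_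
  have h1 := norm_inverse_le_of_bound hm h
  have h2 := norm_inverse_le_of_bound hm' h'
  have h3 := ContinuousLinearMap.opNorm_comp_le (J' - J) J.inverse
  calc ‖J'.inverse‖ * ‖(J' - J) ∘L J.inverse‖ ≤ m'⁻¹ * (‖J' - J‖ * m⁻¹) := by
        refine mul_le_mul h2 (h3.trans ?_) (norm_nonneg _) (by positivity)
        exact mul_le_mul_of_nonneg_left h1 (norm_nonneg _)
    _ = _ := by ring

/-! ### Determinants -/

theorem contDiff_det {m : WithTop ℕ∞} : ContDiff ℝ m (fun A : E n →L[ℝ] E n => A.det) := by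
  have e : (fun A : E n →L[ℝ] E n => A.det) = fun A : E n →L[ℝ] E n =>
      ∑ σ : Equiv.Perm (Fin n), (Equiv.Perm.sign σ : ℝ) *
        ∏ i, A (EuclideanSpace.basisFun (Fin n) ℝ i) (σ i) := by
    funext A
    rw [ContinuousLinearMap.det, ← LinearMap.det_toMatrix (EuclideanSpace.basisFun (Fin n) ℝ).toBasis,
      Matrix.det_apply']
    refine Finset.sum_congr rfl fun σ _ => ?_
    simp [LinearMap.toMatrix_apply]
  rw [e]
  refine ContDiff.sum fun σ _ => contDiff_const.mul (contDiff_prod fun i _ => ?_)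
  have : ContDiff ℝ m fun A : E n →L[ℝ] E n => A (EuclideanSpace.basisFun (Fin n) ℝ i) :=
    contDiff_id.clm_apply contDiff_const
  exact (EuclideanSpace.proj (𝕜 := ℝ) (σ i)).contDiff.comp this

theorem exists_lipschitz_det (n : ℕ) (R : ℝ) : ∃ K > 0, ∀ A B : E n →L[ℝ] E n, ‖A‖ ≤ R → ‖B‖ ≤ R →
    |A.det - B.det| ≤ K * ‖A - B‖ := by
  obtain ⟨K, hK⟩ := ((contDiff_det (n := n) (m := 1)).contDiffOn
    (s := Metric.closedBall 0 R)).exists_lipschitzOnWith one_ne_zero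
    (convex_closedBall (0 : E n →L[ℝ] E n) R) (isCompact_closedBall _ _)
  refine ⟨K + 1, by positivity, fun A B hA hB => ?_⟩
  have := hK.norm_sub_le (by simpa using hA : A ∈ _) (by simpa using hB : B ∈ _)
  rw [Real.norm_eq_abs] at this
  nlinarith [norm_nonneg (A - B)]

theorem exists_bound_det (n : ℕ) (R : ℝ) : ∃ D > 0, ∀ A : E n →L[ℝ] E n, ‖A‖ ≤ R → |A.det| ≤ D := by
  obtain ⟨D, hD⟩ := (isCompact_closedBall (0 : E n →L[ℝ] E n) R).exists_bound_of_continuousOn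
    (contDiff_det (m := 0)).continuous.continuousOn
  exact ⟨max D 1, by positivity, fun A hA => (hD A (by simpa using hA)).trans (le_max_left _ _)⟩

theorem det_smul' (h : ℝ) (A : E n →L[ℝ] E n) : (h • A).det = h ^ n * A.det := by
  simp [ContinuousLinearMap.det]

/-! ### The integrand of the stiffness matrix -/

/-- The integrand of the stiffness matrix on an element with Jacobian `J`. -/
def dirichletDensity (J : E n →L[ℝ] E n) (p q : E n) : ℝ :=
  inner ℝ (ContinuousLinearMap.adjoint J.inverse p) (ContinuousLinearMap.adjoint J.inverse q) *
    |J.det|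

theorem dirichletDensity_smul {h : ℝ} (hh : 0 < h) {J : E n →L[ℝ] E n} {m : ℝ} (hm : 0 < m)
    (hJ : ∀ w, m * ‖w‖ ≤ ‖J w‖) (p q : E n) :
    dirichletDensity (h • J) p q = h ^ n / h ^ 2 * dirichletDensity J p q := by
  have hJ' : ∀ w, h * m * ‖w‖ ≤ ‖(h • J) w‖ := fun w => by
    rw [smul_apply, norm_smul, Real.norm_of_nonneg hh.le, mul_assoc]
    exact mul_le_mul_of_nonneg_left (hJ w) hh.le
  have hi : (h • J).inverse = h⁻¹ • J.inverse := by
    ext1 w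
    have h1 := inverse_comp_of_bound (by positivity) hJ' (h⁻¹ • J.inverse w)
    rw [smul_apply, (J : E n →L[ℝ] E n).map_smul, comp_inverse_of_bound hm hJ,
      smul_inv_smul₀ hh.ne'] at h1
    exact h1
  unfold dirichletDensity
  rw [hi, det_smul', abs_mul, abs_of_pos (pow_pos hh n), map_smulₛₗ]
  simp only [smul_apply, inner_smul_left, inner_smul_right, conj_trivial]
  field_simp

theorem exists_density_bounds_one (n : ℕ) {m C : ℝ} (hm : 0 < m) (hC : 0 < C) :
    ∃ c₁ > 0, ∃ c₂ > 0, ∃ c₃ > 0, ∀ J J' : E n →L[ℝ] E n,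
      (∀ w, m * ‖w‖ ≤ ‖J w‖) → ‖J‖ ≤ C → ‖J' - J‖ ≤ m / 2 → ∀ p q : E n,
      c₁ * ‖p‖ ^ 2 ≤ dirichletDensity J p p ∧
      |dirichletDensity J p q| ≤ c₂ * (‖p‖ * ‖q‖) ∧
      |dirichletDensity J' p q - dirichletDensity J p q| ≤ c₃ * ‖J' - J‖ * (‖p‖ * ‖q‖) := by
  obtain ⟨K, hK0, hK⟩ := exists_lipschitz_det n (C + m / 2)
  obtain ⟨D, hD0, hD⟩ := exists_bound_det n (C + m / 2)
  obtain ⟨D', hD0', hD'⟩ := exists_bound_det n m⁻¹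
  refine ⟨C⁻¹ ^ 2 * D'⁻¹, by positivity, m⁻¹ ^ 2 * D, by positivity,
    (m / 2)⁻¹ ^ 2 * m⁻¹ * D + m⁻¹ ^ 2 * (m / 2)⁻¹ * D + m⁻¹ ^ 2 * K, by positivity, ?_⟩
  intro J J' hJ hJC hJJ p q
  have hJ' : ∀ w, m / 2 * ‖w‖ ≤ ‖J' w‖ := fun w => by
    have := bound_of_norm_sub_le hJ hJJ w
    linarith
  have hm2 : 0 < m / 2 := by positivity
  have hi := norm_inverse_le_of_bound hm hJ
  have hi' := norm_inverse_le_of_bound hm2 hJ'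
  have hd : |J.det| ≤ D := hD J (by linarith)
  have hJC' : ‖J'‖ ≤ C + m / 2 := by
    have := norm_add_le (J' - J) J
    rw [sub_add_cancel] at this
    linarith
  have hd' : |J'.det| ≤ D := hD J' hJC'
  have hdd : |(|J'.det| - |J.det|)| ≤ K * ‖J' - J‖ :=
    (abs_abs_sub_abs_le _ _).trans (hK J' J hJC' (by linarith))
  have hdi := norm_inverse_sub_le_of_bound hm hm2 hJ hJ'
  have hA : ∀ (L : E n →L[ℝ] E n) (b : ℝ), ‖L‖ ≤ b → ∀ p,
      ‖ContinuousLinearMap.adjoint L p‖ ≤ b * ‖p‖ := fun L b hL p =>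
    (ContinuousLinearMap.adjoint L).le_of_opNorm_le
      (by rw [LinearIsometryEquiv.norm_map]; exact hL) p
  have a1 := hA _ _ hi p
  have a2 := hA _ _ hi q
  have a2' := hA _ _ hi' q
  have a3 := hA _ _ hdi p
  have a4 := hA _ _ hdi q
  rw [map_sub, sub_apply] at a3 a4
  have a1' := hA _ _ hi' p
  unfold dirichletDensity
  set P := ContinuousLinearMap.adjoint J.inverse p
  set Q := ContinuousLinearMap.adjoint J.inverse q
  set P' := ContinuousLinearMap.adjoint J'.inverse p
  set Q' := ContinuousLinearMap.adjoint J'.inverse q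
  have hin : |inner ℝ P Q| ≤ m⁻¹ ^ 2 * (‖p‖ * ‖q‖) := by
    refine (abs_real_inner_le_norm P Q).trans ?_
    calc ‖P‖ * ‖Q‖ ≤ (m⁻¹ * ‖p‖) * (m⁻¹ * ‖q‖) := mul_le_mul a1 a2 (norm_nonneg _) (by positivity)
      _ = _ := by ring
  refine ⟨?_, ?_, ?_⟩
  · have e : ContinuousLinearMap.adjoint J P = p := by
      refine ext_inner_right ℝ fun w => ?_
      rw [ContinuousLinearMap.adjoint_inner_left, ContinuousLinearMap.adjoint_inner_left,
        inverse_comp_of_bound hm hJ]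
    have hp : ‖p‖ ≤ C * ‖P‖ := by
      have := hA J C hJC P
      rwa [e] at this
    have hdet : D'⁻¹ ≤ |J.det| := by
      have h1 : J.inverse.det * J.det = 1 := by
        have : J.inverse ∘L J = ContinuousLinearMap.id ℝ (E n) := by
          ext1 w
          exact inverse_comp_of_bound hm hJ w
        have h2 := congrArg ContinuousLinearMap.det this
        simpa [ContinuousLinearMap.det] using h2
      have h2 := hD' _ hi
      have h3 : |J.inverse.det| * |J.det| = 1 := by rw [← abs_mul, h1, abs_one]
      have h4 : 1 ≤ D' * |J.det| := by
        rw [← h3]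
        exact mul_le_mul_of_nonneg_right h2 (abs_nonneg _)
      rwa [inv_le_iff_one_le_mul₀' hD0']
    rw [real_inner_self_eq_norm_sq]
    have h5 : C⁻¹ * ‖p‖ ≤ ‖P‖ := by rwa [inv_mul_le_iff₀ hC]
    have h6 : (C⁻¹ * ‖p‖) ^ 2 ≤ ‖P‖ ^ 2 := pow_le_pow_left₀ (by positivity) h5 2
    calc C⁻¹ ^ 2 * D'⁻¹ * ‖p‖ ^ 2 = (C⁻¹ * ‖p‖) ^ 2 * D'⁻¹ := by ring
      _ ≤ _ := mul_le_mul h6 hdet (by positivity) (by positivity)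
  · rw [abs_mul, abs_abs]
    calc |inner ℝ P Q| * |J.det| ≤ m⁻¹ ^ 2 * (‖p‖ * ‖q‖) * D :=
          mul_le_mul hin hd (abs_nonneg _) (by positivity)
      _ = _ := by ring
  · have e : inner ℝ P' Q' * |J'.det| - inner ℝ P Q * |J.det| =
        inner ℝ (P' - P) Q' * |J'.det| + inner ℝ P (Q' - Q) * |J'.det| +
          inner ℝ P Q * (|J'.det| - |J.det|) := by
      rw [inner_sub_left, inner_sub_right]
      ring
    rw [e]
    refine (abs_add_three _ _ _).trans ?_
    rw [abs_mul, abs_mul, abs_mul, abs_abs]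
    have b1 : |inner ℝ (P' - P) Q'| * |J'.det| ≤
        ((m / 2)⁻¹ * m⁻¹ * ‖J' - J‖ * ‖p‖) * ((m / 2)⁻¹ * ‖q‖) * D :=
      mul_le_mul ((abs_real_inner_le_norm _ _).trans
        (mul_le_mul a3 a2' (norm_nonneg _) (by positivity))) hd' (abs_nonneg _) (by positivity)
    have b2 : |inner ℝ P (Q' - Q)| * |J'.det| ≤
        (m⁻¹ * ‖p‖) * ((m / 2)⁻¹ * m⁻¹ * ‖J' - J‖ * ‖q‖) * D :=
      mul_le_mul ((abs_real_inner_le_norm _ _).trans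
        (mul_le_mul a1 a4 (norm_nonneg _) (by positivity))) hd' (abs_nonneg _) (by positivity)
    have b3 : |inner ℝ P Q| * |(|J'.det| - |J.det|)| ≤ m⁻¹ ^ 2 * (‖p‖ * ‖q‖) * (K * ‖J' - J‖) :=
      mul_le_mul hin hdd (abs_nonneg _) (by positivity)
    refine (add_le_add (add_le_add b1 b2) b3).trans (le_of_eq ?_)
    ring

/-- Two-sided bounds for the integrand of the stiffness matrix and its Lipschitz dependence on the
Jacobian, for Jacobians of size `h`. -/
theorem exists_density_bounds (n : ℕ) {m C : ℝ} (hm : 0 < m) (hC : 0 < C) :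
    ∃ c₁ > 0, ∃ c₂ > 0, ∃ c₃ > 0, ∀ h > 0, ∀ J J' : E n →L[ℝ] E n,
      (∀ w, m * h * ‖w‖ ≤ ‖J w‖) → ‖J‖ ≤ C * h → ‖J' - J‖ ≤ m / 2 * h → ∀ p q : E n,
      c₁ * (h ^ n / h ^ 2) * ‖p‖ ^ 2 ≤ dirichletDensity J p p ∧
      |dirichletDensity J p q| ≤ c₂ * (h ^ n / h ^ 2) * (‖p‖ * ‖q‖) ∧
      |dirichletDensity J' p q - dirichletDensity J p q| ≤
        c₃ * (h ^ n / h ^ 2) * (‖J' - J‖ / h) * (‖p‖ * ‖q‖) := by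
  obtain ⟨c₁, h₁, c₂, h₂, c₃, h₃, H⟩ := exists_density_bounds_one n hm hC
  refine ⟨c₁, h₁, c₂, h₂, c₃, h₃, fun h hh J J' hJ hJC hJJ p q => ?_⟩
  have eJ : J = h • (h⁻¹ • J) := by rw [smul_inv_smul₀ hh.ne']
  have eJ' : J' = h • (h⁻¹ • J') := by rw [smul_inv_smul₀ hh.ne']
  have hn : ∀ L : E n →L[ℝ] E n, ‖h⁻¹ • L‖ = ‖L‖ / h := fun L => by
    rw [norm_smul, norm_inv, Real.norm_of_nonneg hh.le, inv_mul_eq_div]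
  have g1 : ∀ w, m * ‖w‖ ≤ ‖(h⁻¹ • J) w‖ := fun w => by
    rw [smul_apply, norm_smul, norm_inv, Real.norm_of_nonneg hh.le,
      inv_mul_eq_div, le_div_iff₀ hh]
    linarith [hJ w]
  have g2 : ‖h⁻¹ • J‖ ≤ C := by rw [hn, div_le_iff₀ hh]; exact hJC
  have es : h⁻¹ • J' - h⁻¹ • J = h⁻¹ • (J' - J) := by rw [smul_sub]
  have g3 : ‖h⁻¹ • J' - h⁻¹ • J‖ ≤ m / 2 := by rw [es, hn, div_le_iff₀ hh]; exact hJJ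
  have g4 : ∀ w, m / 2 * ‖w‖ ≤ ‖(h⁻¹ • J') w‖ := fun w => by
    have := bound_of_norm_sub_le g1 g3 w
    linarith
  obtain ⟨k1, k2, k3⟩ := H _ _ g1 g2 g3 p q
  have hs : 0 < h ^ n / h ^ 2 := by positivity
  have d1 : ∀ p q, dirichletDensity J p q = h ^ n / h ^ 2 * dirichletDensity (h⁻¹ • J) p q :=
    fun p q => by
      conv_lhs => rw [eJ]
      exact dirichletDensity_smul hh hm g1 p q
  have d2 : ∀ p q, dirichletDensity J' p q = h ^ n / h ^ 2 * dirichletDensity (h⁻¹ • J') p q :=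
    fun p q => by
      conv_lhs => rw [eJ']
      exact dirichletDensity_smul hh (by positivity : 0 < m / 2) g4 p q
  rw [es, hn] at k3
  rw [d1, d1, d2]
  refine ⟨?_, ?_, ?_⟩
  · calc _ = h ^ n / h ^ 2 * (c₁ * ‖p‖ ^ 2) := by ring
      _ ≤ _ := mul_le_mul_of_nonneg_left k1 hs.le
  · rw [abs_mul, abs_of_pos hs]
    calc _ ≤ h ^ n / h ^ 2 * (c₂ * (‖p‖ * ‖q‖)) := mul_le_mul_of_nonneg_left k2 hs.le
      _ = _ := by ring
  · rw [← mul_sub, abs_mul, abs_of_pos hs]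
    calc _ ≤ h ^ n / h ^ 2 * (c₃ * (‖J' - J‖ / h) * (‖p‖ * ‖q‖)) :=
          mul_le_mul_of_nonneg_left k3 hs.le
      _ = _ := by ring

theorem continuousAt_inverse_of_bound {J : E n →L[ℝ] E n} {m : ℝ} (hm : 0 < m)
    (h : ∀ w, m * ‖w‖ ≤ ‖J w‖) :
    ContinuousAt (fun A : E n →L[ℝ] E n => A.inverse) J := by
  obtain ⟨e, rfl⟩ := exists_equiv_of_bound hm h
  exact (contDiffAt_map_inverse (𝕜 := ℝ) (n := 1) e).continuousAt

theorem continuousAt_dirichletDensity {J : E n →L[ℝ] E n} {m : ℝ} (hm : 0 < m)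
    (h : ∀ w, m * ‖w‖ ≤ ‖J w‖) (p q : E n) :
    ContinuousAt (fun z : (E n →L[ℝ] E n) × E n × E n => dirichletDensity z.1 z.2.1 z.2.2)
      (J, p, q) := by
  have h1 : ContinuousAt (fun z : (E n →L[ℝ] E n) × E n × E n => z.1.inverse) (J, p, q) :=
    ContinuousAt.comp (g := fun A : E n →L[ℝ] E n => A.inverse)
      (continuousAt_inverse_of_bound hm h) continuousAt_fst
  have h2 : ContinuousAt (fun z : (E n →L[ℝ] E n) × E n × E n =>
      ContinuousLinearMap.adjoint z.1.inverse) (J, p, q) :=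
    ContinuousAt.comp (g := fun A : E n →L[ℝ] E n => ContinuousLinearMap.adjoint A)
      (ContinuousLinearMap.adjoint (𝕜 := ℝ)).continuous.continuousAt h1
  unfold dirichletDensity
  refine ContinuousAt.mul (ContinuousAt.inner (h2.clm_apply ?_) (h2.clm_apply ?_)) ?_
  · fun_prop
  · fun_prop
  · exact (ContinuousAt.comp (g := fun A : E n →L[ℝ] E n => A.det)
      (contDiff_det (m := 0)).continuous.continuousAt continuousAt_fst).abs

theorem dirichletDensity_comm (J : E n →L[ℝ] E n) (p q : E n) :
    dirichletDensity J p q = dirichletDensity J q p := by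
  unfold dirichletDensity
  rw [real_inner_comm]

/-! ### Gradients of finite element functions on the unit simplex -/

/-- The gradient on the unit simplex of the finite element function with local values `w`. -/
def localGrad (w : LocalNode n k → ℝ) (ξ : E n) : E n := ∑ a, w a • gradient (shape a) ξ

theorem inner_gradient {f : E n → ℝ} (ξ v : E n) : inner ℝ (gradient f ξ) v = fderiv ℝ f ξ v := by
  simp [gradient]

theorem continuous_gradient_shape (a : LocalNode n k) : Continuous (gradient (shape a)) := by
  unfold gradient
  exact (InnerProductSpace.toDual ℝ (E n)).symm.continuous.comp (continuous_fderiv_shape a)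

theorem continuous_localGrad (w : LocalNode n k → ℝ) : Continuous (localGrad w) :=
  continuous_finsetSum _ fun a _ => (continuous_gradient_shape a).const_smul (w a)

theorem inner_localGrad (w : LocalNode n k → ℝ) (ξ v : E n) :
    inner ℝ (localGrad w ξ) v = ∑ a, w a * fderiv ℝ (shape a) ξ v := by
  simp only [localGrad, sum_inner, inner_smul_left, inner_gradient, conj_trivial]

theorem localGrad_sub (w z : LocalNode n k → ℝ) (ξ : E n) :
    localGrad (w - z) ξ = localGrad w ξ - localGrad z ξ := by
  simp only [localGrad, ← Finset.sum_sub_distrib, Pi.sub_apply, sub_smul]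

theorem localGrad_smul (c : ℝ) (w : LocalNode n k → ℝ) (ξ : E n) :
    localGrad (c • w) ξ = c • localGrad w ξ := by
  simp only [localGrad, Finset.smul_sum, Pi.smul_apply, smul_eq_mul, mul_smul]

theorem localGrad_const (c : ℝ) (ξ : E n) : localGrad (fun _ : LocalNode n k => c) ξ = 0 := by
  refine ext_inner_right ℝ fun v => ?_
  rw [inner_localGrad, ← Finset.mul_sum, inner_zero_left]
  have := congrArg (fun L : E n →L[ℝ] ℝ => L v) (sum_fderiv_shape (k := k) ξ)
  simp only [sum_apply, zero_apply] at this
  rw [this, mul_zero]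

theorem localGrad_sub_const (w : LocalNode n k → ℝ) (c : ℝ) (ξ : E n) :
    localGrad (fun a => w a - c) ξ = localGrad w ξ := by
  have := localGrad_sub w (fun _ => c) ξ
  rw [localGrad_const, sub_zero] at this
  exact this

theorem exists_bound_localGrad (n k : ℕ) : ∃ C > 0, ∀ (w : LocalNode n k → ℝ) (μ : ℝ),
    (∀ a, |w a| ≤ μ) → ∀ ξ ∈ refSimplex n, ‖localGrad w ξ‖ ≤ C * μ := by
  have h : ∀ a : LocalNode n k, ∃ C, ∀ ξ ∈ refSimplex n, ‖gradient (shape a) ξ‖ ≤ C := fun a =>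
    (isCompact_refSimplex n).exists_bound_of_continuousOn (continuous_gradient_shape a).continuousOn
  choose C hC using h
  refine ⟨∑ a, |C a| + 1, by positivity, fun w μ hw ξ hξ => ?_⟩
  have hμ : 0 ≤ μ := (abs_nonneg _).trans (hw (vertexNode 0))
  calc ‖localGrad w ξ‖ ≤ ∑ a, ‖w a • gradient (shape a) ξ‖ := norm_sum_le _ _
    _ ≤ ∑ a, |C a| * μ := by
        refine Finset.sum_le_sum fun a _ => ?_
        rw [norm_smul, mul_comm]
        exact mul_le_mul ((hC a ξ hξ).trans (le_abs_self _)) (hw a) (norm_nonneg _) (abs_nonneg _)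
    _ ≤ _ := by
        rw [← Finset.sum_mul]
        nlinarith

theorem exists_bound_localGrad_of_osc (n k : ℕ) : ∃ C > 0, ∀ (w : LocalNode n k → ℝ) (μ : ℝ),
    (∀ a b, |w a - w b| ≤ μ) → ∀ ξ ∈ refSimplex n, ‖localGrad w ξ‖ ≤ C * μ := by
  obtain ⟨C, hC0, hC⟩ := exists_bound_localGrad n k
  refine ⟨C, hC0, fun w μ hw ξ hξ => ?_⟩
  rw [← localGrad_sub_const w (w (vertexNode 0)) ξ]
  exact hC _ μ (fun a => hw a _) ξ hξ

theorem integrableOn_inner_localGrad (w z : LocalNode n k → ℝ) :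
    IntegrableOn (fun ξ => inner ℝ (localGrad w ξ) (localGrad z ξ)) (refSimplex n) :=
  ((continuous_localGrad w).inner (continuous_localGrad z)).continuousOn.integrableOn_compact
    (isCompact_refSimplex n)

theorem eq_of_localGrad_eq_zero (hk : 1 ≤ k) {w : LocalNode n k → ℝ}
    (h : ∀ ξ ∈ refSimplex n, localGrad w ξ = 0) (a b : LocalNode n k) : w a = w b := by
  have hd : ∀ ξ ∈ refSimplex n, HasFDerivWithinAt (fun ξ => ∑ a, w a * shape a ξ)
      (0 : E n →L[ℝ] ℝ) (refSimplex n) ξ := by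
    intro ξ hξ
    have h1 : HasFDerivAt (fun ξ => ∑ a, w a * shape a ξ)
        (∑ a, w a • fderiv ℝ (shape a) ξ) ξ :=
      HasFDerivAt.fun_sum fun a _ => (differentiable_shape a ξ).hasFDerivAt.const_mul (w a)
    have h2 : ∑ a, w a • fderiv ℝ (shape a) ξ = 0 := by
      ext v
      have := inner_localGrad w ξ v
      rw [h ξ hξ, inner_zero_left] at this
      simp [← this]
    rw [h2] at h1
    exact h1.hasFDerivWithinAt
  have hv : ∀ b : LocalNode n k, ∑ a, w a * shape a (lagrangePoint b) = w b := by
    intro b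
    simp [shape_lagrangePoint hk]
  have := (convex_refSimplex n).norm_image_sub_le_of_norm_hasFDerivWithin_le hd (C := 0)
    (fun _ _ => by simp) (lagrangePoint_mem hk b) (lagrangePoint_mem hk a)
  rw [zero_mul, hv, hv] at this
  exact sub_eq_zero.1 (norm_le_zero_iff.1 this)

theorem localGrad_eq_zero_of_integral_eq_zero {w : LocalNode n k → ℝ}
    (h : ∫ ξ in refSimplex n, ‖localGrad w ξ‖ ^ 2 = 0) : ∀ ξ ∈ refSimplex n, localGrad w ξ = 0 := by
  have hc : Continuous fun ξ => ‖localGrad w ξ‖ ^ 2 := (continuous_localGrad w).norm.pow 2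
  have hi : IntegrableOn (fun ξ => ‖localGrad w ξ‖ ^ 2) (refSimplex n) :=
    hc.continuousOn.integrableOn_compact (isCompact_refSimplex n)
  have h1 := (setIntegral_eq_zero_iff_of_nonneg_ae
    (Filter.Eventually.of_forall fun ξ => by positivity) hi).1 h
  have h2 := Measure.eqOn_of_ae_eq h1 hc.continuousOn continuousOn_const (by
    refine (refSimplex_subset_closure n).trans (closure_mono ?_)
    exact interior_maximal (openRefSimplex_subset n) (isOpen_openRefSimplex n))
  intro ξ hξ
  have := h2 hξ
  simpa using this

/-- The inverse inequality on the unit simplex. -/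
theorem exists_inverse_inequality (n : ℕ) {k : ℕ} (hk : 1 ≤ k) :
    ∃ C > 0, ∀ w : LocalNode n k → ℝ, ∀ ξ ∈ refSimplex n,
      ‖localGrad w ξ‖ ^ 2 ≤ C * ∫ η in refSimplex n, ‖localGrad w η‖ ^ 2 := by
  set q : (LocalNode n k → ℝ) → ℝ := fun w => ∫ η in refSimplex n, ‖localGrad w η‖ ^ 2 with hq
  have hqc : Continuous q := by
    have e : q = fun w => ∑ a, ∑ b, w a * w b *
        ∫ η in refSimplex n, inner ℝ (gradient (shape a) η) (gradient (shape b) η) := by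
      funext w
      have hp : ∀ η, ‖localGrad w η‖ ^ 2 = ∑ a, ∑ b, w a * w b *
          inner ℝ (gradient (shape a) η) (gradient (shape b) η) := fun η => by
        rw [← real_inner_self_eq_norm_sq]
        simp only [localGrad, sum_inner, inner_sum, inner_smul_left, inner_smul_right,
          conj_trivial, mul_assoc]
        refine Finset.sum_congr rfl fun a _ => ?_
        rw [Finset.mul_sum]
        refine Finset.sum_congr rfl fun b _ => ?_
        rw [real_inner_comm]
      have hint : ∀ a b, IntegrableOn (fun η => w a * w b *
          inner ℝ (gradient (shape a) η) (gradient (shape b) η)) (refSimplex n) := fun a b =>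
        (continuous_const.mul ((continuous_gradient_shape a).inner
          (continuous_gradient_shape b))).continuousOn.integrableOn_compact (isCompact_refSimplex n)
      simp only [hq, hp]
      rw [integral_finsetSum _ fun a _ => integrable_finsetSum _ fun b _ => hint a b]
      refine Finset.sum_congr rfl fun a _ => ?_
      rw [integral_finsetSum _ fun b _ => hint a b]
      simp only [integral_const_mul]
    rw [e]
    fun_prop
  have hq0 : ∀ w, 0 ≤ q w := fun w => integral_nonneg fun _ => by positivity
  set a₀ : LocalNode n k := vertexNode 0
  have hK : IsCompact (Metric.sphere (0 : LocalNode n k → ℝ) 1 ∩ {w | w a₀ = 0}) :=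
    (isCompact_sphere _ _).inter_right (isClosed_eq (continuous_apply a₀) continuous_const)
  obtain ⟨μ, hμ0, hμ⟩ : ∃ μ > 0, ∀ w ∈ Metric.sphere (0 : LocalNode n k → ℝ) 1 ∩ {w | w a₀ = 0},
      μ ≤ q w := by
    rcases (Metric.sphere (0 : LocalNode n k → ℝ) 1 ∩ {w | w a₀ = 0}).eq_empty_or_nonempty
      with he | hne
    · exact ⟨1, one_pos, by simp [he]⟩
    · obtain ⟨w₀, hw₀, hmin⟩ := hK.exists_isMinOn hne hqc.continuousOn
      refine ⟨q w₀, ?_, fun w hw => hmin hw⟩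
      refine lt_of_le_of_ne (hq0 w₀) fun h0 => ?_
      have h1 := eq_of_localGrad_eq_zero hk (localGrad_eq_zero_of_integral_eq_zero h0.symm)
      have h2 : w₀ = 0 := by
        funext a
        rw [h1 a a₀, hw₀.2, Pi.zero_apply]
      have := hw₀.1
      rw [h2] at this
      simp at this
  obtain ⟨C, hC0, hC⟩ := exists_bound_localGrad n k
  refine ⟨C ^ 2 / μ, by positivity, fun w ξ hξ => ?_⟩
  change _ ≤ C ^ 2 / μ * q w
  set z : LocalNode n k → ℝ := fun a => w a - w a₀ with hz
  have hgz : ∀ ξ, localGrad z ξ = localGrad w ξ := fun ξ => localGrad_sub_const w _ ξ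
  have hqz : q z = q w := by simp only [hq, hgz]
  rw [← hqz, ← hgz ξ]
  have h1 : ‖localGrad z ξ‖ ≤ C * ‖z‖ := hC z _ (fun a => norm_le_pi_norm z a) ξ hξ
  have h2 : μ * ‖z‖ ^ 2 ≤ q z := by
    rcases eq_or_ne z 0 with h0 | h0
    · rw [h0]; simpa using hq0 0
    · have hz0 : 0 < ‖z‖ := norm_pos_iff.2 h0
      have := hμ (‖z‖⁻¹ • z) ⟨by simp [norm_smul, hz0.ne'], by simp [hz]⟩
      have e : q (‖z‖⁻¹ • z) = ‖z‖⁻¹ ^ 2 * q z := by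
        simp only [hq, localGrad_smul, norm_smul, norm_inv, norm_norm, mul_pow,
          integral_const_mul]
      rw [e, inv_pow, inv_mul_eq_div, le_div_iff₀ (by positivity)] at this
      exact this
  calc ‖localGrad z ξ‖ ^ 2 ≤ (C * ‖z‖) ^ 2 := pow_le_pow_left₀ (norm_nonneg _) h1 2
    _ = C ^ 2 / μ * (μ * ‖z‖ ^ 2) := by field_simp
    _ ≤ _ := mul_le_mul_of_nonneg_left h2 (by positivity)

/-! ### Bilinear forms of nodal vectors -/

/-- The bilinear form `∑ B_{jl} u_j · w_l` of vectors with entries in `ℝⁿ`. -/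
def kronForm {ι : Type*} [Fintype ι] (B : Matrix ι ι ℝ) (u w : ι → E n) : ℝ :=
  ∑ j, ∑ l, B j l * inner ℝ (u j) (w l)

/-- The vector of the components with index `c`. -/
def component {ι : Type*} (c : Fin n) (w : ι → E n) : ι → ℝ := fun j => w j c

theorem kronForm_eq_sum_component {ι : Type*} [Fintype ι] (B : Matrix ι ι ℝ) (u w : ι → E n) :
    kronForm B u w = ∑ c, ∑ j, ∑ l, B j l * (component c u j * component c w l) := by
  unfold kronForm component
  rw [Finset.sum_comm]
  conv_rhs => rw [Finset.sum_comm]; enter [2, j]; rw [Finset.sum_comm]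
  rw [Finset.sum_comm]
  refine Finset.sum_congr rfl fun j _ => Finset.sum_congr rfl fun l _ => ?_
  rw [← Finset.mul_sum]
  congr 1
  simp [PiLp.inner_apply, mul_comm]

theorem kronForm_add_left {ι : Type*} [Fintype ι] (B : Matrix ι ι ℝ) (u u' w : ι → E n) :
    kronForm B (u + u') w = kronForm B u w + kronForm B u' w := by
  simp only [kronForm, Pi.add_apply, inner_add_left, mul_add, Finset.sum_add_distrib]

theorem kronForm_add_right {ι : Type*} [Fintype ι] (B : Matrix ι ι ℝ) (u w w' : ι → E n) :
    kronForm B u (w + w') = kronForm B u w + kronForm B u w' := by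
  simp only [kronForm, Pi.add_apply, inner_add_right, mul_add, Finset.sum_add_distrib]

theorem kronForm_smul_left {ι : Type*} [Fintype ι] (B : Matrix ι ι ℝ) (c : ℝ) (u w : ι → E n) :
    kronForm B (c • u) w = c * kronForm B u w := by
  simp only [kronForm, Pi.smul_apply, inner_smul_left, conj_trivial, Finset.mul_sum]
  refine Finset.sum_congr rfl fun j _ => Finset.sum_congr rfl fun l _ => ?_
  ring

theorem kronForm_comm {ι : Type*} [Fintype ι] {B : Matrix ι ι ℝ} (hB : ∀ j l, B j l = B l j)
    (u w : ι → E n) : kronForm B u w = kronForm B w u := by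
  unfold kronForm
  rw [Finset.sum_comm]
  refine Finset.sum_congr rfl fun j _ => Finset.sum_congr rfl fun l _ => ?_
  rw [hB, real_inner_comm]

theorem kronForm_smul_right {ι : Type*} [Fintype ι] (B : Matrix ι ι ℝ) (c : ℝ) (u w : ι → E n) :
    kronForm B u (c • w) = c * kronForm B u w := by
  simp only [kronForm, Pi.smul_apply, inner_smul_right, Finset.mul_sum]
  refine Finset.sum_congr rfl fun j _ => Finset.sum_congr rfl fun l _ => ?_
  ring

theorem two_mul_abs_kronForm_le {ι : Type*} [Fintype ι] {B : Matrix ι ι ℝ}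
    (hB : ∀ j l, B j l = B l j) (hpos : ∀ w : ι → E n, 0 ≤ kronForm B w w) {η : ℝ} (hη : 0 < η)
    (u w : ι → E n) : 2 * |kronForm B u w| ≤ η⁻¹ * kronForm B u u + η * kronForm B w w := by
  have h : ∀ σ : ℝ, kronForm B (u + σ • w) (u + σ • w) =
      kronForm B u u + 2 * σ * kronForm B u w + σ ^ 2 * kronForm B w w := fun σ => by
    simp only [kronForm_add_left, kronForm_add_right, kronForm_smul_left, kronForm_smul_right]
    rw [kronForm_comm hB w u]
    ring
  have h1 := hpos (u + η • w)
  have h2 := hpos (u + (-η) • w)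
  rw [h] at h1 h2
  have e : η⁻¹ * kronForm B u u + η * kronForm B w w =
      (kronForm B u u + η ^ 2 * kronForm B w w) / η := by
    field_simp
  rw [e, le_div_iff₀ hη]
  rcases abs_cases (kronForm B u w) with ⟨h3, _⟩ | ⟨h3, _⟩ <;> rw [h3] <;> nlinarith

/-! ### Nodal gradients and the stiffness form -/

theorem dirichletDensity_sum_left {ι : Type*} (s : Finset ι) (J : E n →L[ℝ] E n) (r : ι → ℝ)
    (p : ι → E n) (q : E n) :
    dirichletDensity J (∑ i ∈ s, r i • p i) q = ∑ i ∈ s, r i * dirichletDensity J (p i) q := by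
  simp only [dirichletDensity, map_sum, map_smul, sum_inner, inner_smul_left, conj_trivial,
    Finset.sum_mul, mul_assoc]

theorem dirichletDensity_sum_right {ι : Type*} (s : Finset ι) (J : E n →L[ℝ] E n) (r : ι → ℝ)
    (p : E n) (q : ι → E n) :
    dirichletDensity J p (∑ i ∈ s, r i • q i) = ∑ i ∈ s, r i * dirichletDensity J p (q i) := by
  rw [dirichletDensity_comm, dirichletDensity_sum_left]
  refine Finset.sum_congr rfl fun i _ => ?_
  rw [dirichletDensity_comm]

namespace CurvedMesh

variable {Ω₀ : Set (E n)} (M : CurvedMesh n k Ω₀)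

/-- The gradient in the reference coordinate of the finite element function with nodal values
`u`. -/
def nodalGrad (u : M.Node → ℝ) (S : Fin M.Nel) (ξ : E n) : E n :=
  localGrad (fun a => u (M.loc S a)) ξ

theorem continuous_nodalGrad (u : M.Node → ℝ) (S : Fin M.Nel) : Continuous (M.nodalGrad u S) :=
  continuous_localGrad _

theorem gradient_basis (j : M.Node) (S : Fin M.Nel) (ξ : E n) :
    gradient (M.basis j S) ξ = M.nodalGrad (Pi.single j 1) S ξ := by
  refine ext_inner_right ℝ fun v => ?_
  rw [inner_gradient, nodalGrad, inner_localGrad]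
  have e : M.basis j S = fun ξ => ∑ a : LocalNode n k,
      (Pi.single j (1 : ℝ) : M.Node → ℝ) (M.loc S a) * shape a ξ := by
    funext ξ
    refine Finset.sum_congr rfl fun a _ => ?_
    simp [Pi.single_apply]
  have h : HasFDerivAt (M.basis j S) (∑ a : LocalNode n k,
      (Pi.single j (1 : ℝ) : M.Node → ℝ) (M.loc S a) • fderiv ℝ (shape a) ξ) ξ := by
    rw [e]
    exact HasFDerivAt.fun_sum fun a _ => (differentiable_shape a ξ).hasFDerivAt.const_mul _
  rw [h.fderiv]
  simp

theorem nodalGrad_eq_sum (u : M.Node → ℝ) (S : Fin M.Nel) (ξ : E n) :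
    M.nodalGrad u S ξ = ∑ j, u j • M.nodalGrad (Pi.single j 1) S ξ := by
  simp only [nodalGrad, localGrad, Finset.smul_sum]
  rw [Finset.sum_comm]
  refine Finset.sum_congr rfl fun a _ => ?_
  simp [Pi.single_apply, Finset.sum_ite_eq]

theorem stiffnessMatrix_apply (x : M.Node → E n) (j l : M.Node) :
    M.stiffnessMatrix x j l = ∑ S, ∫ ξ in refSimplex n,
      dirichletDensity (M.jacobian x S ξ) (M.nodalGrad (Pi.single j 1) S ξ)
        (M.nodalGrad (Pi.single l 1) S ξ) := by
  simp only [stiffnessMatrix, basisGrad, gradient_basis, dirichletDensity]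

theorem stiffnessMatrix_comm (x : M.Node → E n) (j l : M.Node) :
    M.stiffnessMatrix x j l = M.stiffnessMatrix x l j := by
  simp only [stiffnessMatrix_apply, dirichletDensity_comm _ (M.nodalGrad (Pi.single j 1) _ _)]

theorem hasFDerivAt_elementMap (x : M.Node → E n) (S : Fin M.Nel) (ξ : E n) :
    HasFDerivAt (M.elementMap x S)
      (∑ a, (fderiv ℝ (shape a) ξ).smulRight (x (M.loc S a))) ξ :=
  HasFDerivAt.fun_sum fun a _ => (differentiable_shape a ξ).hasFDerivAt.smul_const _

theorem jacobian_apply (x : M.Node → E n) (S : Fin M.Nel) (ξ v : E n) :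
    M.jacobian x S ξ v = ∑ a, fderiv ℝ (shape a) ξ v • x (M.loc S a) := by
  rw [jacobian, (M.hasFDerivAt_elementMap x S ξ).fderiv]
  simp

theorem jacobian_eq (x : M.Node → E n) (S : Fin M.Nel) (ξ : E n) :
    M.jacobian x S ξ = ∑ a, (fderiv ℝ (shape a) ξ).smulRight (x (M.loc S a)) := by
  rw [jacobian, (M.hasFDerivAt_elementMap x S ξ).fderiv]

theorem continuous_jacobian : Continuous fun z : (M.Node → E n) × E n =>
    fun S => M.jacobian z.1 S z.2 := by
  refine continuous_pi fun S => ?_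
  simp only [jacobian_eq]
  refine continuous_finsetSum _ fun a _ => ?_
  have h1 : Continuous fun z : (M.Node → E n) × E n => fderiv ℝ (shape a) z.2 :=
    (continuous_fderiv_shape a).comp continuous_snd
  have h2 : Continuous fun z : (M.Node → E n) × E n => z.1 (M.loc S a) := by fun_prop
  have h3 := (ContinuousLinearMap.smulRightL ℝ (E n) (E n)).isBoundedBilinearMap.continuous.comp
    (h1.prodMk h2)
  exact h3

theorem jacobian_sub (x y : M.Node → E n) (S : Fin M.Nel) (ξ : E n) :
    M.jacobian x S ξ - M.jacobian y S ξ = M.jacobian (x - y) S ξ := by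
  ext1 v
  simp only [sub_apply, jacobian_apply, Pi.sub_apply, smul_sub, Finset.sum_sub_distrib]

theorem jacobian_apply_component (x : M.Node → E n) (S : Fin M.Nel) (ξ v : E n) (c : Fin n) :
    M.jacobian x S ξ v c = inner ℝ (M.nodalGrad (component c x) S ξ) v := by
  rw [jacobian_apply, nodalGrad, inner_localGrad, WithLp.ofLp_sum, Finset.sum_apply]
  refine Finset.sum_congr rfl fun a _ => ?_
  simp [component, mul_comm]

/-- The squared Frobenius norm of the gradient in the reference coordinate. -/
def gradSq (w : M.Node → E n) (S : Fin M.Nel) (ξ : E n) : ℝ :=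
  ∑ c, ‖M.nodalGrad (component c w) S ξ‖ ^ 2

theorem gradSq_nonneg (w : M.Node → E n) (S : Fin M.Nel) (ξ : E n) : 0 ≤ M.gradSq w S ξ :=
  Finset.sum_nonneg fun _ _ => by positivity

theorem continuous_gradSq (w : M.Node → E n) (S : Fin M.Nel) : Continuous (M.gradSq w S) :=
  continuous_finsetSum _ fun _ _ => (M.continuous_nodalGrad _ S).norm.pow 2

theorem integrableOn_gradSq (w : M.Node → E n) (S : Fin M.Nel) :
    IntegrableOn (M.gradSq w S) (refSimplex n) :=
  (M.continuous_gradSq w S).continuousOn.integrableOn_compact (isCompact_refSimplex n)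

theorem norm_jacobian_sq_le (w : M.Node → E n) (S : Fin M.Nel) (ξ : E n) :
    ‖M.jacobian w S ξ‖ ^ 2 ≤ M.gradSq w S ξ := by
  rw [← Real.le_sqrt (norm_nonneg _) (M.gradSq_nonneg w S ξ)]
  refine ContinuousLinearMap.opNorm_le_bound _ (Real.sqrt_nonneg _) fun v => ?_
  rw [EuclideanSpace.norm_eq, ← Real.sqrt_sq (norm_nonneg v), ← Real.sqrt_mul
    (M.gradSq_nonneg w S ξ)]
  refine Real.sqrt_le_sqrt ?_
  rw [gradSq, Finset.sum_mul]
  refine Finset.sum_le_sum fun c _ => ?_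
  rw [jacobian_apply_component, Real.norm_eq_abs, ← mul_pow]
  exact pow_le_pow_left₀ (abs_nonneg _) (abs_real_inner_le_norm _ _) 2

/-- The Dirichlet form in the reference coordinate, a bilinear form that does not depend on the
position of the nodes. -/
def refMatrix : Matrix M.Node M.Node ℝ := fun j l => ∑ S, ∫ ξ in refSimplex n,
  inner ℝ (M.nodalGrad (Pi.single j 1) S ξ) (M.nodalGrad (Pi.single l 1) S ξ)

theorem refMatrix_comm (j l : M.Node) : M.refMatrix j l = M.refMatrix l j := by
  simp only [refMatrix, real_inner_comm (M.nodalGrad (Pi.single j 1) _ _)]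

theorem continuousOn_dirichletDensity {x : M.Node → E n} {S : Fin M.Nel} {m : ℝ} (hm : 0 < m)
    (hx : ∀ ξ ∈ refSimplex n, ∀ v, m * ‖v‖ ≤ ‖M.jacobian x S ξ v‖) (u w : M.Node → ℝ) :
    ContinuousOn (fun ξ => dirichletDensity (M.jacobian x S ξ) (M.nodalGrad u S ξ)
      (M.nodalGrad w S ξ)) (refSimplex n) := by
  intro ξ hξ
  have h1 : Continuous fun ξ => (M.jacobian x S ξ, M.nodalGrad u S ξ, M.nodalGrad w S ξ) := by
    refine Continuous.prodMk ?_ ((M.continuous_nodalGrad u S).prodMk (M.continuous_nodalGrad w S))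
    exact (continuous_pi_iff.1 M.continuous_jacobian S).comp (Continuous.prodMk continuous_const
      continuous_id)
  exact (ContinuousAt.comp (f := fun ξ => (M.jacobian x S ξ, M.nodalGrad u S ξ, M.nodalGrad w S ξ))
    (continuousAt_dirichletDensity hm (hx ξ hξ) _ _)
    h1.continuousAt).continuousWithinAt

theorem integral_sum_component {D : Fin M.Nel → E n → E n → E n → ℝ}
    (hl : ∀ S ξ (r : M.Node → ℝ) (p : M.Node → E n) q,
      D S ξ (∑ i, r i • p i) q = ∑ i, r i * D S ξ (p i) q)
    (hr : ∀ S ξ (r : M.Node → ℝ) p (q : M.Node → E n),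
      D S ξ p (∑ i, r i • q i) = ∑ i, r i * D S ξ p (q i))
    (hint : ∀ S j l, IntegrableOn (fun ξ => D S ξ (M.nodalGrad (Pi.single j 1) S ξ)
      (M.nodalGrad (Pi.single l 1) S ξ)) (refSimplex n)) {B : Matrix M.Node M.Node ℝ}
    (hB : ∀ j l, B j l = ∑ S, ∫ ξ in refSimplex n, D S ξ (M.nodalGrad (Pi.single j 1) S ξ)
      (M.nodalGrad (Pi.single l 1) S ξ)) (u w : M.Node → E n) :
    kronForm B u w = ∑ S, ∫ ξ in refSimplex n, ∑ c,
        D S ξ (M.nodalGrad (component c u) S ξ) (M.nodalGrad (component c w) S ξ) := by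
  rw [kronForm_eq_sum_component]
  have e : ∀ S ξ c, D S ξ (M.nodalGrad (component c u) S ξ) (M.nodalGrad (component c w) S ξ) =
      ∑ j, ∑ l, D S ξ (M.nodalGrad (Pi.single j 1) S ξ) (M.nodalGrad (Pi.single l 1) S ξ) *
        (component c u j * component c w l) := fun S ξ c => by
    rw [nodalGrad_eq_sum M (component c u), hl]
    refine Finset.sum_congr rfl fun j _ => ?_
    rw [nodalGrad_eq_sum M (component c w), hr, Finset.mul_sum]
    refine Finset.sum_congr rfl fun l _ => ?_
    ring
  have h2 : ∀ S, ∫ ξ in refSimplex n, ∑ c, D S ξ (M.nodalGrad (component c u) S ξ)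
      (M.nodalGrad (component c w) S ξ) = ∑ c, ∑ j, ∑ l, (∫ ξ in refSimplex n,
        D S ξ (M.nodalGrad (Pi.single j 1) S ξ) (M.nodalGrad (Pi.single l 1) S ξ)) *
        (component c u j * component c w l) := fun S => by
    simp only [e]
    have hi := fun c j l => (hint S j l).mul_const (component c u j * component c w l)
    rw [integral_finsetSum _ fun c _ => integrable_finsetSum _ fun j _ =>
      integrable_finsetSum _ fun l _ => hi c j l]
    refine Finset.sum_congr rfl fun c _ => ?_
    rw [integral_finsetSum _ fun j _ => integrable_finsetSum _ fun l _ => hi c j l]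
    refine Finset.sum_congr rfl fun j _ => ?_
    rw [integral_finsetSum _ fun l _ => hi c j l]
    refine Finset.sum_congr rfl fun l _ => ?_
    rw [integral_mul_const]
  simp only [h2, hB, Finset.sum_mul]
  conv_rhs =>
    rw [Finset.sum_comm]
    enter [2, c]
    rw [Finset.sum_comm]
    enter [2, j]
    rw [Finset.sum_comm]

theorem kronForm_refMatrix (u w : M.Node → E n) :
    kronForm M.refMatrix u w = ∑ S, ∫ ξ in refSimplex n, ∑ c,
      inner ℝ (M.nodalGrad (component c u) S ξ) (M.nodalGrad (component c w) S ξ) := by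
  refine M.integral_sum_component (D := fun _ _ p q => inner ℝ p q) ?_ ?_ ?_
    (fun _ _ => rfl) u w
  · intro S ξ r p q
    simp only [sum_inner, inner_smul_left, conj_trivial]
  · intro S ξ r p q
    simp only [inner_sum, inner_smul_right]
  · intro S j l
    exact integrableOn_inner_localGrad _ _

theorem kronForm_refMatrix_self (w : M.Node → E n) :
    kronForm M.refMatrix w w = ∑ S, ∫ ξ in refSimplex n, M.gradSq w S ξ := by
  rw [kronForm_refMatrix]
  simp only [real_inner_self_eq_norm_sq, gradSq]

theorem kronForm_refMatrix_nonneg (w : M.Node → E n) : 0 ≤ kronForm M.refMatrix w w := by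
  rw [kronForm_refMatrix_self]
  exact Finset.sum_nonneg fun S _ => integral_nonneg fun ξ => M.gradSq_nonneg w S ξ

theorem kronForm_stiffnessMatrix {x : M.Node → E n} {m : ℝ} (hm : 0 < m)
    (hx : ∀ S, ∀ ξ ∈ refSimplex n, ∀ v, m * ‖v‖ ≤ ‖M.jacobian x S ξ v‖) (u w : M.Node → E n) :
    kronForm (M.stiffnessMatrix x) u w = ∑ S, ∫ ξ in refSimplex n, ∑ c,
      dirichletDensity (M.jacobian x S ξ) (M.nodalGrad (component c u) S ξ)
        (M.nodalGrad (component c w) S ξ) := by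
  refine M.integral_sum_component (D := fun S ξ p q => dirichletDensity (M.jacobian x S ξ) p q)
    ?_ ?_ ?_ (M.stiffnessMatrix_apply x) u w
  · intro S ξ r p q
    exact dirichletDensity_sum_left _ _ _ _ _
  · intro S ξ r p q
    exact dirichletDensity_sum_right _ _ _ _ _
  · intro S j l
    exact (M.continuousOn_dirichletDensity hm (hx S) _ _).integrableOn_compact
      (isCompact_refSimplex n)

end CurvedMesh

namespace CurvedMesh

variable {Ω₀ : Set (E n)} (M : CurvedMesh n k Ω₀)

theorem abs_sum_integral_le {f g : Fin M.Nel → E n → ℝ}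
    (hg : ∀ S, IntegrableOn (g S) (refSimplex n))
    (hfg : ∀ S, ∀ ξ ∈ refSimplex n, |f S ξ| ≤ g S ξ) :
    |∑ S, ∫ ξ in refSimplex n, f S ξ| ≤ ∑ S, ∫ ξ in refSimplex n, g S ξ := by
  refine (Finset.abs_sum_le_sum_abs _ _).trans (Finset.sum_le_sum fun S _ => ?_)
  rw [← Real.norm_eq_abs]
  refine norm_integral_le_of_norm_le (hg S) ?_
  exact (ae_restrict_mem (isCompact_refSimplex n).measurableSet).mono fun ξ hξ => hfg S ξ hξ

theorem integrableOn_sum_density {x : M.Node → E n} {m : ℝ} (hm : 0 < m)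
    (hx : ∀ S, ∀ ξ ∈ refSimplex n, ∀ v, m * ‖v‖ ≤ ‖M.jacobian x S ξ v‖) (u w : M.Node → E n)
    (S : Fin M.Nel) :
    IntegrableOn (fun ξ => ∑ c, dirichletDensity (M.jacobian x S ξ)
      (M.nodalGrad (component c u) S ξ) (M.nodalGrad (component c w) S ξ)) (refSimplex n) :=
  integrable_finsetSum _ fun _ _ =>
    (M.continuousOn_dirichletDensity hm (hx S) _ _).integrableOn_compact (isCompact_refSimplex n)

/-- Equivalence of the stiffness form with the reference form, and its Lipschitz dependence on the
nodal vector. -/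
theorem exists_stiffness_bounds (n k : ℕ) {m C G : ℝ} (hm : 0 < m) (hC : 0 < C) (hG : 0 < G) :
    ∃ c₁ > 0, ∃ c₂ > 0, ∃ c₃ > 0, ∀ {Ω₀ : Set (E n)} (M : CurvedMesh n k Ω₀), ∀ h > 0,
      ∀ y : M.Node → E n,
      (∀ S, ∀ ξ ∈ refSimplex n, ∀ v, m * h * ‖v‖ ≤ ‖M.jacobian y S ξ v‖) →
      (∀ S, ∀ ξ ∈ refSimplex n, ‖M.jacobian y S ξ‖ ≤ C * h) →
      (∀ S, ∀ ξ ∈ refSimplex n, ∀ p q, |dirichletDensity (M.jacobian y S ξ) p q| ≤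
        c₂ * (h ^ n / h ^ 2) * (‖p‖ * ‖q‖)) ∧
      (∀ w : M.Node → E n, c₁ * (h ^ n / h ^ 2) * kronForm M.refMatrix w w ≤ kronForm (M.stiffnessMatrix y) w w) ∧
      (∀ w : M.Node → E n, kronForm (M.stiffnessMatrix y) w w ≤
        c₂ * (h ^ n / h ^ 2) * kronForm M.refMatrix w w) ∧
      ∀ ε, ε ≤ m / 2 → ∀ x : M.Node → E n,
        (∀ S, ∀ ξ ∈ refSimplex n, ‖M.jacobian x S ξ - M.jacobian y S ξ‖ ≤ ε * h) →
        ∀ w : M.Node → E n,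
        |kronForm (M.stiffnessMatrix x) w w - kronForm (M.stiffnessMatrix y) w w| ≤
          c₃ * (h ^ n / h ^ 2) * ε * kronForm M.refMatrix w w ∧
        ∀ v : M.Node → E n, (∀ S, ∀ ξ ∈ refSimplex n, ∀ c,
           ‖M.nodalGrad (component c v) S ξ‖ ≤ G * h) →
          ∀ η > 0, |kronForm (M.stiffnessMatrix x) v w - kronForm (M.stiffnessMatrix y) v w| ≤
          c₃ * (h ^ n / h ^ 2) * (η⁻¹ * kronForm M.refMatrix (x - y) (x - y) +
            η * kronForm M.refMatrix w w) := by
  obtain ⟨c₁, h₁, c₂, h₂, c₃, h₃, H⟩ := exists_density_bounds n hm hC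
  refine ⟨c₁, h₁, c₂, h₂, c₃ + c₃ * G * (n + 1), by positivity, ?_⟩
  intro Ω₀ M h hh y hlow hup
  have hs : 0 < h ^ n / h ^ 2 := by positivity
  have hmh : 0 < m * h := by positivity
  refine ⟨?_, ?_, ?_, ?_⟩
  · intro S ξ hξ p q
    exact (H h hh _ _ (hlow S ξ hξ) (hup S ξ hξ) (by rw [sub_self, norm_zero]; positivity) p q).2.1
  · intro w
    rw [kronForm_refMatrix_self, M.kronForm_stiffnessMatrix hmh hlow, Finset.mul_sum]
    refine Finset.sum_le_sum fun S _ => ?_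
    rw [← integral_const_mul]
    refine setIntegral_mono_on ((M.integrableOn_gradSq w S).const_mul _)
      (M.integrableOn_sum_density hmh hlow w w S) (isCompact_refSimplex n).measurableSet
      fun ξ hξ => ?_
    rw [gradSq, Finset.mul_sum]
    refine Finset.sum_le_sum fun c _ => ?_
    exact (H h hh _ _ (hlow S ξ hξ) (hup S ξ hξ) (by rw [sub_self, norm_zero]; positivity) _ 0).1
  · intro w
    rw [kronForm_refMatrix_self, M.kronForm_stiffnessMatrix hmh hlow, Finset.mul_sum]
    refine Finset.sum_le_sum fun S _ => ?_
    rw [← integral_const_mul]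
    refine setIntegral_mono_on (M.integrableOn_sum_density hmh hlow w w S)
      ((M.integrableOn_gradSq w S).const_mul _) (isCompact_refSimplex n).measurableSet
      fun ξ hξ => ?_
    rw [gradSq, Finset.mul_sum]
    refine Finset.sum_le_sum fun c _ => ?_
    rw [sq ‖_‖]
    exact (le_abs_self _).trans (H h hh _ _ (hlow S ξ hξ) (hup S ξ hξ)
      (by rw [sub_self, norm_zero]; positivity) _ _).2.1
  · intro ε hε x hx w
    have hlow' : ∀ S, ∀ ξ ∈ refSimplex n, ∀ v, m / 2 * h * ‖v‖ ≤ ‖M.jacobian x S ξ v‖ := by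
      intro S ξ hξ v
      refine le_trans ?_ (bound_of_norm_sub_le (hlow S ξ hξ) (hx S ξ hξ) v)
      refine mul_le_mul_of_nonneg_right ?_ (norm_nonneg v)
      nlinarith
    have hmh' : 0 < m / 2 * h := by positivity
    have hdiff : ∀ S, ∀ ξ ∈ refSimplex n, ∀ p q,
        |dirichletDensity (M.jacobian x S ξ) p q - dirichletDensity (M.jacobian y S ξ) p q| ≤
          c₃ * (h ^ n / h ^ 2) * (‖M.jacobian x S ξ - M.jacobian y S ξ‖ / h) * (‖p‖ * ‖q‖) :=
      fun S ξ hξ p q => (H h hh _ _ (hlow S ξ hξ) (hup S ξ hξ) ((hx S ξ hξ).trans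
        (mul_le_mul_of_nonneg_right hε hh.le)) p q).2.2
    have hsub : ∀ v w : M.Node → E n, kronForm (M.stiffnessMatrix x) v w - kronForm (M.stiffnessMatrix y) v w =
        ∑ S, ∫ ξ in refSimplex n, ∑ c,
          (dirichletDensity (M.jacobian x S ξ) (M.nodalGrad (component c v) S ξ)
            (M.nodalGrad (component c w) S ξ) -
          dirichletDensity (M.jacobian y S ξ) (M.nodalGrad (component c v) S ξ)
            (M.nodalGrad (component c w) S ξ)) := by
      intro v w
      rw [M.kronForm_stiffnessMatrix hmh hlow, M.kronForm_stiffnessMatrix hmh' hlow',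
        ← Finset.sum_sub_distrib]
      refine Finset.sum_congr rfl fun S _ => ?_
      simp only [Finset.sum_sub_distrib]
      rw [integral_sub (M.integrableOn_sum_density hmh' hlow' v w S)
        (M.integrableOn_sum_density hmh hlow v w S)]
    constructor
    · rw [hsub, kronForm_refMatrix_self, Finset.mul_sum]
      simp only [← integral_const_mul]
      refine M.abs_sum_integral_le (fun S => (M.integrableOn_gradSq w S).const_mul _)
        fun S ξ hξ => ?_
      refine (Finset.abs_sum_le_sum_abs _ _).trans ?_
      rw [gradSq, Finset.mul_sum]
      refine Finset.sum_le_sum fun c _ => (hdiff S ξ hξ _ _).trans ?_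
      rw [← sq]
      refine mul_le_mul_of_nonneg_right ?_ (by positivity)
      have e1 : ‖M.jacobian x S ξ - M.jacobian y S ξ‖ / h ≤ ε := by
        rw [div_le_iff₀ hh]
        exact hx S ξ hξ
      have e0 : 0 ≤ ε := le_trans (by positivity) e1
      calc _ ≤ c₃ * (h ^ n / h ^ 2) * ε := mul_le_mul_of_nonneg_left e1 (by positivity)
        _ ≤ _ := by
          refine mul_le_mul_of_nonneg_right (mul_le_mul_of_nonneg_right ?_ hs.le) e0
          have : 0 ≤ c₃ * G * (n + 1) := by positivity
          linarith
    · intro v hv η hη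
      have hI := fun S => ((M.integrableOn_gradSq (x - y) S).const_mul η⁻¹).add
        ((M.integrableOn_gradSq w S).const_mul η)
      have e : (c₃ + c₃ * G * (n + 1)) * (h ^ n / h ^ 2) *
          (η⁻¹ * kronForm M.refMatrix (x - y) (x - y) + η * kronForm M.refMatrix w w) =
          ∑ S, ∫ ξ in refSimplex n, (c₃ + c₃ * G * (n + 1)) * (h ^ n / h ^ 2) *
            (η⁻¹ * M.gradSq (x - y) S ξ + η * M.gradSq w S ξ) := by
        rw [kronForm_refMatrix_self, kronForm_refMatrix_self, Finset.mul_sum, Finset.mul_sum,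
          ← Finset.sum_add_distrib, Finset.mul_sum]
        refine Finset.sum_congr rfl fun S _ => ?_
        rw [integral_const_mul, integral_add ((M.integrableOn_gradSq (x - y) S).const_mul η⁻¹)
          ((M.integrableOn_gradSq w S).const_mul η), integral_const_mul, integral_const_mul]
      rw [e, hsub]
      refine M.abs_sum_integral_le (fun S => (hI S).const_mul _) fun S ξ hξ => ?_
      refine (Finset.abs_sum_le_sum_abs _ _).trans ?_
      set D := ‖M.jacobian x S ξ - M.jacobian y S ξ‖ with hD
      have hD2 : D ^ 2 ≤ M.gradSq (x - y) S ξ := by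
        rw [hD, jacobian_sub]
        exact M.norm_jacobian_sq_le _ S ξ
      have hc : ∀ c : Fin n, |dirichletDensity (M.jacobian x S ξ) (M.nodalGrad (component c v) S ξ)
            (M.nodalGrad (component c w) S ξ) -
          dirichletDensity (M.jacobian y S ξ) (M.nodalGrad (component c v) S ξ)
            (M.nodalGrad (component c w) S ξ)| ≤ c₃ * (h ^ n / h ^ 2) * G *
          (η⁻¹ * M.gradSq (x - y) S ξ + η * ‖M.nodalGrad (component c w) S ξ‖ ^ 2) := by
        intro c
        refine (hdiff S ξ hξ _ _).trans ?_
        set b := ‖M.nodalGrad (component c w) S ξ‖ with hb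
        have hb0 : 0 ≤ b := norm_nonneg _
        have hD0 : 0 ≤ D := norm_nonneg _
        have hy : D * b ≤ η⁻¹ * M.gradSq (x - y) S ξ + η * b ^ 2 := by
          have h5 : D * b ≤ η⁻¹ * D ^ 2 + η * b ^ 2 := by
            have e6 : η⁻¹ * D ^ 2 + η * b ^ 2 - D * b =
                η⁻¹ * ((D - η * b) ^ 2 + D * (η * b)) := by
              field_simp
              ring
            have : 0 ≤ η⁻¹ * ((D - η * b) ^ 2 + D * (η * b)) := by positivity
            linarith
          have h6 : η⁻¹ * D ^ 2 ≤ η⁻¹ * M.gradSq (x - y) S ξ :=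
            mul_le_mul_of_nonneg_left hD2 (by positivity)
          linarith
        calc c₃ * (h ^ n / h ^ 2) * (D / h) * (‖M.nodalGrad (component c v) S ξ‖ * b)
            ≤ c₃ * (h ^ n / h ^ 2) * (D / h) * (G * h * b) :=
              mul_le_mul_of_nonneg_left (mul_le_mul_of_nonneg_right (hv S ξ hξ c) hb0)
                (by positivity)
          _ = c₃ * (h ^ n / h ^ 2) * G * (D * b) := by field_simp
          _ ≤ _ := mul_le_mul_of_nonneg_left hy (by positivity)
      refine (Finset.sum_le_sum fun c _ => hc c).trans ?_
      rw [← Finset.mul_sum, Finset.sum_add_distrib, Finset.sum_const,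
        Finset.card_univ, Fintype.card_fin, nsmul_eq_mul, ← Finset.mul_sum]
      change c₃ * (h ^ n / h ^ 2) * G * (n * (η⁻¹ * M.gradSq (x - y) S ξ) + η * M.gradSq w S ξ) ≤ _
      have p1 : 0 ≤ η⁻¹ * M.gradSq (x - y) S ξ :=
        mul_nonneg (by positivity) (M.gradSq_nonneg _ _ _)
      have p2 : 0 ≤ η * M.gradSq w S ξ := mul_nonneg hη.le (M.gradSq_nonneg _ _ _)
      have p3 : (0 : ℝ) ≤ n := Nat.cast_nonneg n
      calc _ ≤ c₃ * (h ^ n / h ^ 2) * G * ((n + 1) *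
            (η⁻¹ * M.gradSq (x - y) S ξ + η * M.gradSq w S ξ)) := by
            refine mul_le_mul_of_nonneg_left ?_ (by positivity)
            nlinarith
        _ = (c₃ * G * (n + 1)) * (h ^ n / h ^ 2) *
            (η⁻¹ * M.gradSq (x - y) S ξ + η * M.gradSq w S ξ) := by ring
        _ ≤ _ := by
            refine mul_le_mul_of_nonneg_right (mul_le_mul_of_nonneg_right ?_ hs.le)
              (add_nonneg p1 p2)
            linarith

/-! ### Definiteness -/

theorem frontier_nonempty (hn : 0 < n) (hb : Bornology.IsBounded Ω₀) (hc : Ω₀.Nonempty) :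
    (frontier Ω₀).Nonempty := by
  have : Nonempty (Fin n) := ⟨⟨0, hn⟩⟩
  by_contra h
  rw [not_nonempty_iff_eq_empty, ← isClopen_iff_frontier_eq_empty, isClopen_iff] at h
  rcases h with h | h
  · exact hc.ne_empty h
  · rw [h] at hb
    exact NormedSpace.unbounded_univ ℝ (E n) hb

theorem nonempty_element (hne : Ω₀.Nonempty) : Nonempty (Fin M.Nel) := by
  obtain ⟨p, hp⟩ := hne
  have := subset_closure hp
  rw [← M.cover, mem_iUnion] at this
  exact ⟨this.choose⟩

/-- A nodal vector that vanishes in the boundary nodes and is constant on each element is zero. -/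
theorem eq_zero_of_constant_on_elements (hn : 0 < n) (hk : 1 ≤ k) (hb : Bornology.IsBounded Ω₀)
    (hc : IsConnected Ω₀) {V : Type*} [Zero V] {w : M.Node → V} (hw : ∀ j, w (Sum.inl j) = 0)
    (hconst : ∀ S a b, w (M.loc S a) = w (M.loc S b)) (j : M.Node) : w j = 0 := by
  by_contra hj
  obtain ⟨S₀, a₀, hS₀⟩ := M.loc_surj j
  set P : Set (Fin M.Nel) := {S | w (M.loc S (vertexNode 0)) = w j} with hP
  have hcomp : ∀ S, IsCompact (M.Φc S '' refSimplex n) := fun S =>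
    (isCompact_refSimplex n).image_of_continuousOn (M.Φc_smooth S).continuousOn
  have hclosed : ∀ Q : Set (Fin M.Nel), IsClosed (⋃ S ∈ Q, M.Φc S '' refSimplex n) := fun Q =>
    Q.toFinite.isClosed_biUnion fun S _ => (hcomp S).isClosed
  have hsub : ∀ S, M.Φc S '' refSimplex n ⊆ closure Ω₀ := fun S => by
    rw [← M.cover]
    exact subset_iUnion (fun S => M.Φc S '' refSimplex n) S
  have hcov : closure Ω₀ ⊆ (⋃ S ∈ P, M.Φc S '' refSimplex n) ∪
      ⋃ S ∈ Pᶜ, M.Φc S '' refSimplex n := by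
    rw [← M.cover]
    refine iUnion_subset fun S => ?_
    by_cases hS : S ∈ P
    · exact (subset_biUnion_of_mem (u := fun S => M.Φc S '' refSimplex n) hS).trans
        subset_union_left
    · exact (subset_biUnion_of_mem (u := fun S => M.Φc S '' refSimplex n)
        (mem_compl hS)).trans subset_union_right
  have hne : ∀ Q : Set (Fin M.Nel), ∀ S ∈ Q,
      (closure Ω₀ ∩ ⋃ S ∈ Q, M.Φc S '' refSimplex n).Nonempty := by
    intro Q S hS
    have hm : M.Φc S (barycenter n) ∈ M.Φc S '' refSimplex n :=
      mem_image_of_mem _ (openRefSimplex_subset n (barycenter_mem n))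
    exact ⟨_, hsub S hm, mem_biUnion hS hm⟩
  have hS₀P : S₀ ∈ P := by
    change w _ = w j
    rw [← hS₀]
    exact hconst _ _ _
  obtain ⟨p, hp⟩ := frontier_nonempty hn hb hc.nonempty
  obtain ⟨S₁, i, -, hface⟩ := M.boundaryFaces p hp
  have hS₁P : S₁ ∈ Pᶜ := by
    obtain ⟨i', hi'⟩ : ∃ i' : Fin (n + 1), i' ≠ i := by
      have : Nontrivial (Fin (n + 1)) := Fin.nontrivial_iff_two_le.2 (by omega)
      exact exists_ne i
    have h1 := hface (lagrangePoint (vertexNode (k := k) i')) (lagrangePoint_mem hk _)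
      (by rw [bary_vertex hk, if_neg hi'.symm])
    rw [← M.node] at h1
    intro hmem
    apply hj
    have h2 : w (M.loc S₁ (vertexNode 0)) = w j := hmem
    rw [← h2, hconst S₁ (vertexNode 0) (vertexNode i')]
    rcases hl : M.loc S₁ (vertexNode i') with j' | j'
    · exact hw j'
    · rw [hl] at h1
      exact absurd h1 (M.interiorNode j')
  obtain ⟨q, -, hq1, hq2⟩ := isPreconnected_closed_iff.1 hc.isPreconnected.closure _ _ (hclosed P)
    (hclosed Pᶜ) hcov (hne P S₀ hS₀P) (hne Pᶜ S₁ hS₁P)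
  simp only [mem_iUnion, mem_image, exists_prop] at hq1 hq2
  obtain ⟨S, hS, ξ, hξ, rfl⟩ := hq1
  obtain ⟨S', hS', ξ', hξ', he⟩ := hq2
  have hg := (M.glue S S' ξ hξ ξ' hξ').1 he.symm
  obtain ⟨i, hi⟩ : ∃ i, 0 < bary ξ i := by
    by_contra! h
    have : ∑ i, bary ξ i ≤ 0 := Finset.sum_nonpos fun i _ => h i
    rw [sum_bary] at this
    linarith
  have h1 := hg (M.loc S (vertexNode i))
  have h2 : 0 < ∑ i', if M.loc S (vertexNode i') = M.loc S (vertexNode i) then bary ξ i' else 0 := by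
    refine Finset.sum_pos' (fun i' _ => ?_) ⟨i, Finset.mem_univ i, by simpa using hi⟩
    split_ifs
    · exact hξ i'
    · exact le_rfl
  rw [h1] at h2
  obtain ⟨i', hi'⟩ : ∃ i', M.loc S' (vertexNode i') = M.loc S (vertexNode i) := by
    by_contra! h
    simp [h] at h2
  apply hS'
  have h3 : w (M.loc S (vertexNode 0)) = w j := hS
  change w _ = w j
  rw [← h3, hconst S' (vertexNode 0) (vertexNode i'), hi', hconst S (vertexNode i) (vertexNode 0)]

theorem eq_zero_of_kronForm_refMatrix_eq_zero (hn : 0 < n) (hk : 1 ≤ k)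
    (hb : Bornology.IsBounded Ω₀) (hc : IsConnected Ω₀) {w : M.Node → E n}
    (hw : ∀ j, w (Sum.inl j) = 0) (h : kronForm M.refMatrix w w = 0) (j : M.Node) : w j = 0 := by
  refine M.eq_zero_of_constant_on_elements hn hk hb hc hw (fun S a b => ?_) j
  rw [kronForm_refMatrix_self, Finset.sum_eq_zero_iff_of_nonneg fun S _ =>
    integral_nonneg fun ξ => M.gradSq_nonneg w S ξ] at h
  have h1 := h S (Finset.mem_univ S)
  unfold gradSq at h1
  have hi : ∀ c : Fin n, IntegrableOn (fun ξ => ‖M.nodalGrad (component c w) S ξ‖ ^ 2)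
      (refSimplex n) := fun c =>
    ((M.continuous_nodalGrad _ S).norm.pow 2).continuousOn.integrableOn_compact
      (isCompact_refSimplex n)
  rw [integral_finsetSum _ fun c _ => hi c, Finset.sum_eq_zero_iff_of_nonneg fun c _ =>
    integral_nonneg fun ξ => by positivity] at h1
  ext c
  exact eq_of_localGrad_eq_zero hk
    (localGrad_eq_zero_of_integral_eq_zero (h1 c (Finset.mem_univ c))) a b

end CurvedMesh

/-! ### Energy norms and dual norms -/

theorem sum_inner_kron {p q : ℕ} (B : Matrix (Fin p) (Fin q) ℝ) (u : Fin p → E n)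
    (w : Fin q → E n) : ∑ j, inner ℝ (u j) (kron B w j) = ∑ j, ∑ l, B j l * inner ℝ (u j) (w l) := by
  simp only [kron, inner_sum, inner_smul_right]

theorem energyNorm_sq {p : ℕ} {B : Matrix (Fin p) (Fin p) ℝ} {w : Fin p → E n}
    (h : 0 ≤ kronForm B w w) : energyNorm B w ^ 2 = kronForm B w w := by
  rw [energyNorm, sum_inner_kron]
  exact Real.sq_sqrt h

theorem kronForm_nonneg_of_posDef {ι : Type*} [Fintype ι] {B : Matrix ι ι ℝ} (hB : B.PosDef)
    (w : ι → E n) : 0 ≤ kronForm B w w := by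
  rw [kronForm_eq_sum_component]
  refine Finset.sum_nonneg fun c _ => ?_
  have := hB.posSemidef.dotProduct_mulVec_nonneg (component c w)
  simp only [dotProduct, Matrix.mulVec, Finset.mul_sum, Pi.star_apply, star_trivial] at this
  refine this.trans (le_of_eq ?_)
  refine Finset.sum_congr rfl fun j _ => Finset.sum_congr rfl fun l _ => ?_
  ring

theorem kron_kron {p q r : ℕ} (A : Matrix (Fin p) (Fin q) ℝ) (B : Matrix (Fin q) (Fin r) ℝ)
    (w : Fin r → E n) : kron A (kron B w) = kron (A * B) w := by
  funext j
  simp only [kron, Matrix.mul_apply, Finset.smul_sum, Finset.sum_smul, smul_smul]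
  rw [Finset.sum_comm]

theorem kron_one {p : ℕ} (w : Fin p → E n) : kron (1 : Matrix (Fin p) (Fin p) ℝ) w = w := by
  funext j
  simp [kron, Matrix.one_apply]

/-- The duality between the energy norm of `B` and that of `B⁻¹`, with Young's inequality. -/
theorem two_mul_abs_sum_inner_le {p : ℕ} {B : Matrix (Fin p) (Fin p) ℝ} (hB : B.PosDef)
    (e r : Fin p → E n) :
    2 * |∑ j, inner ℝ (e j) (r j)| ≤ energyNorm B⁻¹ r ^ 2 + kronForm B e e := by
  have hsymm : ∀ j l, B j l = B l j := fun j l => by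
    have := congrFun (congrFun hB.1 l) j
    simpa [Matrix.conjTranspose_apply] using this
  have hr : kron B (kron B⁻¹ r) = r := by
    rw [kron_kron, Matrix.mul_nonsing_inv _ ((Matrix.isUnit_iff_isUnit_det _).1 hB.isUnit),
      kron_one]
  have h1 := two_mul_abs_kronForm_le hsymm (kronForm_nonneg_of_posDef hB) one_pos e (kron B⁻¹ r)
  have h2 : kronForm B e (kron B⁻¹ r) = ∑ j, inner ℝ (e j) (r j) := by
    unfold kronForm
    rw [← sum_inner_kron, hr]
  have h3 : kronForm B (kron B⁻¹ r) (kron B⁻¹ r) = energyNorm B⁻¹ r ^ 2 := by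
    rw [energyNorm_sq (kronForm_nonneg_of_posDef hB.inv r)]
    unfold kronForm
    rw [← sum_inner_kron, ← sum_inner_kron, hr]
    exact Finset.sum_congr rfl fun j _ => real_inner_comm _ _
  rw [h2, h3] at h1
  linarith

namespace CurvedMesh

variable {Ω₀ : Set (E n)} (M : CurvedMesh n k Ω₀)

/-- Extension of a vector of interior nodal values by zero. -/
def extendZero (e : Fin M.NΩ → E n) : M.Node → E n := Sum.elim (fun _ => 0) e

theorem extendZero_of_boundary {w : M.Node → E n} (hw : ∀ j, w (Sum.inl j) = 0) :
    M.extendZero (fun j => w (Sum.inr j)) = w := by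
  funext j
  rcases j with j | j
  · exact (hw j).symm
  · rfl

theorem kronForm_extendZero (y : M.Node → E n) (e : Fin M.NΩ → E n) :
    kronForm (M.stiffnessMatrix y) (M.extendZero e) (M.extendZero e) = kronForm (M.A₂₂ y) e e := by
  simp [kronForm, extendZero, A₂₂, Matrix.toBlocks₂₂]

theorem kronForm_extendZero_left (y : M.Node → E n) (e : Fin M.NΩ → E n) (v : M.Node → E n) :
    kronForm (M.stiffnessMatrix y) (M.extendZero e) v =
      ∑ j, inner ℝ (e j) (kron (M.A₂₁ y) (fun j => v (Sum.inl j)) j +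
        kron (M.A₂₂ y) (fun j => v (Sum.inr j)) j) := by
  simp only [inner_add_right, Finset.sum_add_distrib, sum_inner_kron]
  simp [kronForm, extendZero, A₂₂, A₂₁, Matrix.toBlocks₂₂, Matrix.toBlocks₂₁,
    Finset.sum_add_distrib]

theorem posDef_A₂₂ (hn : 0 < n) (hk : 1 ≤ k) (hb : Bornology.IsBounded Ω₀) (hc : IsConnected Ω₀)
    {y : M.Node → E n} {c : ℝ} (hc0 : 0 < c)
    (h : ∀ w : M.Node → E n, c * kronForm M.refMatrix w w ≤ kronForm (M.stiffnessMatrix y) w w) :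
    (M.A₂₂ y).PosDef := by
  refine Matrix.PosDef.of_dotProduct_mulVec_pos ?_ fun z hz => ?_
  · ext j l
    simp only [Matrix.conjTranspose_apply, star_trivial]
    exact M.stiffnessMatrix_comm y _ _
  · set i₀ : Fin n := ⟨0, hn⟩
    set e : Fin M.NΩ → E n := fun j => z j • EuclideanSpace.single i₀ 1 with he
    have h1 : star z ⬝ᵥ (M.A₂₂ y).mulVec z = kronForm (M.A₂₂ y) e e := by
      simp only [dotProduct, Matrix.mulVec, Finset.mul_sum, Pi.star_apply, star_trivial, kronForm]
      refine Finset.sum_congr rfl fun j _ => Finset.sum_congr rfl fun l _ => ?_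
      simp only [he, inner_smul_left, inner_smul_right, conj_trivial, real_inner_self_eq_norm_sq,
        PiLp.norm_single, norm_one]
      ring
    rw [h1, ← kronForm_extendZero]
    have h2 : kronForm M.refMatrix (M.extendZero e) (M.extendZero e) ≠ 0 := by
      intro h0
      have h3 := M.eq_zero_of_kronForm_refMatrix_eq_zero hn hk hb hc (w := M.extendZero e)
        (fun _ => rfl) h0
      apply hz
      funext j
      have h4 : e j = 0 := h3 (Sum.inr j)
      have h5 := congrArg (fun v : E n => v i₀) h4
      simpa [he] using h5
    have h3 : 0 < kronForm M.refMatrix (M.extendZero e) (M.extendZero e) :=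
      lt_of_le_of_ne (M.kronForm_refMatrix_nonneg _) h2.symm
    exact lt_of_lt_of_le (mul_pos hc0 h3) (h _)

/-- The energy estimate for the error of a discrete harmonic velocity. -/
theorem velocityError_estimate {y x v v' : M.Node → E n} {r : Fin M.NΩ → E n} {c₁ c₃ s ε : ℝ}
    (hA : (M.A₂₂ y).PosDef) (hc₁ : 0 < c₁) (hc₃ : 0 < c₃) (hs : 0 < s) (hε : ε ≤ c₁ / (8 * c₃))
    (hlow : ∀ w : M.Node → E n,
      c₁ * s * kronForm M.refMatrix w w ≤ kronForm (M.stiffnessMatrix y) w w)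
    (hdiff : ∀ w : M.Node → E n,
      |kronForm (M.stiffnessMatrix x) w w - kronForm (M.stiffnessMatrix y) w w| ≤
          c₃ * s * ε * kronForm M.refMatrix w w)
    (hdiff' : ∀ w : M.Node → E n, ∀ η > 0,
      |kronForm (M.stiffnessMatrix x) v' w - kronForm (M.stiffnessMatrix y) v' w| ≤
        c₃ * s * (η⁻¹ * kronForm M.refMatrix (x - y) (x - y) + η * kronForm M.refMatrix w w))
    (hv : kron (M.A₂₂ x) (fun j => v (Sum.inr j)) = -kron (M.A₂₁ x) (fun j => v (Sum.inl j)))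
    (hv' : kron (M.A₂₂ y) (fun j => v' (Sum.inr j)) =
      -kron (M.A₂₁ y) (fun j => v' (Sum.inl j)) + r)
    (hb : ∀ j, v (Sum.inl j) = v' (Sum.inl j)) :
    kronForm (M.A₂₂ y) (fun j => v (Sum.inr j) - v' (Sum.inr j))
        (fun j => v (Sum.inr j) - v' (Sum.inr j)) ≤
      32 * c₃ ^ 2 / c₁ * (s * kronForm M.refMatrix (x - y) (x - y)) +
        2 * energyNorm (M.A₂₂ y)⁻¹ r ^ 2 := by
  set e : Fin M.NΩ → E n := fun j => v (Sum.inr j) - v' (Sum.inr j) with he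
  have hw : M.extendZero e = v - v' :=
    M.extendZero_of_boundary (w := v - v') fun j => by rw [Pi.sub_apply, hb, sub_self]
  set w := M.extendZero e with hwdef
  have e1 : kronForm (M.stiffnessMatrix x) v w = 0 := by
    rw [kronForm_comm (M.stiffnessMatrix_comm x), hwdef, kronForm_extendZero_left, hv]
    simp
  have e2 : kronForm (M.stiffnessMatrix y) v' w = ∑ j, inner ℝ (e j) (r j) := by
    rw [kronForm_comm (M.stiffnessMatrix_comm y), hwdef, kronForm_extendZero_left, hv']
    simp
  have hvw : v = v' + w := by rw [hw]; abel
  have e3 : kronForm (M.stiffnessMatrix x) v w =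
      kronForm (M.stiffnessMatrix x) v' w + kronForm (M.stiffnessMatrix x) w w := by
    conv_lhs => rw [hvw]
    exact kronForm_add_left _ _ _ _
  rw [← kronForm_extendZero, ← hwdef]
  set R := kronForm M.refMatrix w w with hR
  set Q := kronForm (M.stiffnessMatrix y) w w with hQ
  set Rx := kronForm M.refMatrix (x - y) (x - y)
  have hR0 : 0 ≤ R := M.kronForm_refMatrix_nonneg w
  have b1 := (abs_le.1 (hdiff w)).1
  have b2 := (abs_le.1 (hdiff' w (c₁ / (8 * c₃)) (by positivity))).1
  have b3 := two_mul_abs_sum_inner_le hA e r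
  rw [← kronForm_extendZero, ← hwdef, ← hQ] at b3
  have b4 := neg_abs_le (∑ j, inner ℝ (e j) (r j))
  have b5 := hlow w
  rw [← hQ, ← hR] at b1 b5
  have b6 : c₃ * s * ε * R ≤ c₁ * s * R / 8 := by
    calc c₃ * s * ε * R ≤ c₃ * s * (c₁ / (8 * c₃)) * R := by gcongr
      _ = _ := by field_simp
  have b7 : c₃ * s * ((c₁ / (8 * c₃))⁻¹ * Rx + c₁ / (8 * c₃) * R) =
      8 * c₃ ^ 2 / c₁ * (s * Rx) + c₁ * s * R / 8 := by
    field_simp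
  rw [b7] at b2
  have b8 : 32 * c₃ ^ 2 / c₁ * (s * Rx) = 4 * (8 * c₃ ^ 2 / c₁ * (s * Rx)) := by ring
  rw [b8]
  linarith

end CurvedMesh

/-! ### Geometry of quasi-uniform curved meshes -/

theorem sum_bary_smul_vertex (hk : 1 ≤ k) (ξ : E n) :
    ∑ i, bary ξ i • lagrangePoint (vertexNode (n := n) (k := k) i) = ξ := by
  refine ext_of_bary fun j => ?_
  have h : ∀ j : Fin n, (∑ i, bary ξ i • lagrangePoint (vertexNode (n := n) (k := k) i)) j =
      ξ j := fun j => by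
    rw [WithLp.ofLp_sum, Finset.sum_apply]
    have e : ∀ i, (bary ξ i • lagrangePoint (vertexNode (n := n) (k := k) i)) j =
        if j.succ = i then bary ξ i else 0 := fun i => by
      rw [PiLp.smul_apply, ← bary_succ, bary_vertex hk]
      simp
    simp only [e]
    simp [bary_succ]
  refine Fin.cases ?_ (fun j => ?_) j
  · simp only [bary_zero, h]
  · simp only [bary_succ, h]

theorem vertexNode_injective (hk : 1 ≤ k) :
    Function.Injective (vertexNode : Fin (n + 1) → LocalNode n k) := by
  intro i j hij
  have h1 := bary_vertex hk i j
  rw [hij, bary_vertex hk] at h1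
  by_contra hne
  rw [if_pos rfl, if_neg (Ne.symm hne)] at h1
  exact one_ne_zero h1

namespace CurvedMesh

variable {Ω₀ : Set (E n)} (M : CurvedMesh n k Ω₀)

/-- The vertices of an element. -/
def vertex (S : Fin M.Nel) (i : Fin (n + 1)) : E n := M.x₀ (M.loc S (vertexNode i))

/-- The affine parametrization of the straight simplex. -/
def affinePoint (S : Fin M.Nel) (ξ : E n) : E n := ∑ i, bary ξ i • M.vertex S i

/-- The linear part of the affine parametrization of the straight simplex. -/
def affineLinear (S : Fin M.Nel) : E n →L[ℝ] E n :=
  ∑ i : Fin n, (EuclideanSpace.proj i : E n →L[ℝ] ℝ).smulRight (M.vertex S i.succ - M.vertex S 0)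

theorem affineLinear_apply (S : Fin M.Nel) (v : E n) :
    M.affineLinear S v = ∑ i : Fin n, v i • (M.vertex S i.succ - M.vertex S 0) := by
  simp [affineLinear]

theorem affinePoint_eq (S : Fin M.Nel) (ξ : E n) :
    M.affinePoint S ξ = M.vertex S 0 + M.affineLinear S ξ := by
  rw [affinePoint, Fin.sum_univ_succ, affineLinear_apply]
  simp only [bary_zero, bary_succ, smul_sub, Finset.sum_sub_distrib, sub_smul, one_smul,
    Finset.sum_smul]
  abel

theorem straight_subset (hk : 1 ≤ k) (S : Fin M.Nel) :
    M.straight S ⊆ M.affinePoint S '' refSimplex n := by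
  refine convexHull_min ?_ ?_
  · rintro _ ⟨i, rfl⟩
    refine ⟨lagrangePoint (vertexNode (k := k) i), lagrangePoint_mem hk _, ?_⟩
    simp [affinePoint, bary_vertex hk, vertex]
  · rintro _ ⟨ξ, hξ, rfl⟩ _ ⟨η, hη, rfl⟩ a b ha hb hab
    refine ⟨a • ξ + b • η, convex_refSimplex n hξ hη ha hb hab, ?_⟩
    simp only [affinePoint, bary_combination ξ η a b hab, add_smul, mul_smul,
      Finset.sum_add_distrib, Finset.smul_sum]

theorem isBounded_straight (S : Fin M.Nel) : Bornology.IsBounded (M.straight S) :=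
  isBounded_convexHull.2 (finite_range _).isBounded

theorem norm_vertex_sub_le (S : Fin M.Nel) (i j : Fin (n + 1)) :
    ‖M.vertex S i - M.vertex S j‖ ≤ M.width := by
  rw [← dist_eq_norm]
  refine (Metric.dist_le_diam_of_mem (M.isBounded_straight S) (subset_convexHull ℝ _ ⟨i, rfl⟩)
    (subset_convexHull ℝ _ ⟨j, rfl⟩)).trans ?_
  exact le_ciSup (f := fun S => Metric.diam (M.straight S)) (finite_range _).bddAbove S

theorem width_pos (hn : 0 < n) (hk : 1 ≤ k) (hne : Ω₀.Nonempty) : 0 < M.width := by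
  obtain ⟨S⟩ := M.nonempty_element hne
  have : Nontrivial (Fin (n + 1)) := Fin.nontrivial_iff_two_le.2 (by omega)
  obtain ⟨i, j, hij⟩ := exists_pair_ne (Fin (n + 1))
  refine lt_of_lt_of_le (norm_pos_iff.2 (sub_ne_zero.2 fun h => hij ?_))
    (M.norm_vertex_sub_le S i j)
  exact vertexNode_injective hk (M.loc_injective S (M.x₀_injective h))

theorem norm_affineLinear_le (S : Fin M.Nel) (v : E n) :
    ‖M.affineLinear S v‖ ≤ n * M.width * ‖v‖ := by
  rw [affineLinear_apply]
  refine (norm_sum_le _ _).trans ?_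
  have h : ∀ i : Fin n, ‖v i • (M.vertex S i.succ - M.vertex S 0)‖ ≤ M.width * ‖v‖ := fun i => by
    rw [norm_smul, mul_comm]
    exact mul_le_mul (M.norm_vertex_sub_le S _ _) (PiLp.norm_apply_le v i) (norm_nonneg _)
      ((norm_nonneg _).trans (M.norm_vertex_sub_le S 0 0))
  refine (Finset.sum_le_sum fun i _ => h i).trans (le_of_eq ?_)
  simp [mul_assoc]

theorem le_norm_affineLinear (hk : 1 ≤ k) {ρ Λ : ℝ} (hρ : 0 < ρ) (hM : M.QuasiUniform ρ Λ)
    (hw : 0 < M.width) (S : Fin M.Nel) (v : E n) :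
    ρ / 2 * M.width * ‖v‖ ≤ ‖M.affineLinear S v‖ := by
  obtain ⟨z, hz⟩ := hM.1 S
  set r := ρ * M.width with hr
  have hr0 : 0 < r := mul_pos hρ hw
  have hsurj : ∀ u : E n, ‖u‖ ≤ r → ∃ ζ : E n, ‖ζ‖ ≤ 2 ∧ M.affineLinear S ζ = u := by
    intro u hu
    obtain ⟨ξ, hξ, h1⟩ := M.straight_subset hk S (hz (Metric.mem_closedBall_self hr0.le))
    obtain ⟨η, hη, h2⟩ := M.straight_subset hk S
      (hz (show z + u ∈ Metric.closedBall z r by simpa using hu))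
    refine ⟨η - ξ, ?_, ?_⟩
    · refine (norm_sub_le _ _).trans ?_
      have := norm_le_one_of_mem_refSimplex hξ
      have := norm_le_one_of_mem_refSimplex hη
      linarith
    · rw [affinePoint_eq] at h1 h2
      rw [map_sub]
      have : u = (z + u) - z := by abel
      rw [this, ← h2, ← h1]
      abel
  have hinj : Function.Injective (M.affineLinear S) := by
    have hs : Function.Surjective (M.affineLinear S : E n →ₗ[ℝ] E n) := by
      intro u
      rcases eq_or_ne u 0 with rfl | hu
      · exact ⟨0, map_zero _⟩
      · have hu0 : 0 < ‖u‖ := norm_pos_iff.2 hu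
        obtain ⟨ζ, -, hζ⟩ := hsurj ((r / ‖u‖) • u) (by
          rw [norm_smul, Real.norm_of_nonneg (by positivity), div_mul_cancel₀ _ hu0.ne'])
        refine ⟨(‖u‖ / r) • ζ, ?_⟩
        rw [map_smul, ContinuousLinearMap.coe_coe, hζ, smul_smul]
        rw [show ‖u‖ / r * (r / ‖u‖) = 1 by field_simp, one_smul]
    exact LinearMap.injective_iff_surjective.2 hs
  rcases eq_or_ne v 0 with rfl | hv
  · simp
  set u := M.affineLinear S v with hu
  have hu0 : 0 < ‖u‖ := by
    rw [norm_pos_iff]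
    intro h0
    exact hv (hinj (by rw [← hu, h0, map_zero]))
  obtain ⟨ζ, hζ2, hζ⟩ := hsurj ((r / ‖u‖) • u) (by
    rw [norm_smul, Real.norm_of_nonneg (by positivity), div_mul_cancel₀ _ hu0.ne'])
  have hζv : ζ = (r / ‖u‖) • v := hinj (by rw [hζ, map_smul])
  rw [hζv, norm_smul, Real.norm_of_nonneg (by positivity), div_mul_eq_mul_div,
    div_le_iff₀ hu0] at hζ2
  rw [hr] at hζ2
  linarith

/-- The curved simplex is close to the straight simplex. -/
theorem norm_Φc_sub_affinePoint_le (hk : 1 ≤ k) {ρ Λ : ℝ} (hM : M.QuasiUniform ρ Λ)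
    (S : Fin M.Nel) {ξ : E n} (hξ : ξ ∈ refSimplex n) :
    ‖M.Φc S ξ - M.affinePoint S ξ‖ ≤ 4 * |Λ| * M.width ^ 2 := by
  set R := refSimplex n with hR
  have hu := uniqueDiffOn_refSimplex n
  have hcv := convex_refSimplex n
  have hK0 : 0 ≤ |Λ| * M.width ^ 2 := by positivity
  have hsub : ∀ ξ ∈ R, ∀ η ∈ R, ‖η - ξ‖ ≤ 2 := fun ξ hξ η hη => by
    refine (norm_sub_le _ _).trans ?_
    have := norm_le_one_of_mem_refSimplex hξ
    have := norm_le_one_of_mem_refSimplex hη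
    linarith
  have hd : DifferentiableOn ℝ (fderivWithin ℝ (M.Φc S) R) R :=
    ((M.Φc_smooth S).fderivWithin hu (m := 1) (by norm_num)).differentiableOn one_ne_zero
  have hlip : ∀ η ∈ R, ‖fderivWithin ℝ (M.Φc S) R η - fderivWithin ℝ (M.Φc S) R ξ‖ ≤
      2 * (|Λ| * M.width ^ 2) := by
    intro η hη
    have := hcv.norm_image_sub_le_of_norm_fderivWithin_le (C := |Λ| * M.width ^ 2) hd
      (fun ζ hζ => by
        rw [← norm_iteratedFDerivWithin_one _ (hu ζ hζ), norm_iteratedFDerivWithin_fderivWithin hu hζ]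
        exact (hM.2 S ζ hζ).trans (mul_le_mul_of_nonneg_right (le_abs_self _) (by positivity)))
      hξ hη
    refine this.trans ?_
    nlinarith [hsub ξ hξ η hη]
  have htay : ∀ η ∈ R, ‖M.Φc S η - M.Φc S ξ - fderivWithin ℝ (M.Φc S) R ξ (η - ξ)‖ ≤
      4 * |Λ| * M.width ^ 2 := by
    intro η hη
    have := hcv.norm_image_sub_le_of_norm_hasFDerivWithin_le'
      (fun ζ hζ => ((M.Φc_smooth S).differentiableOn two_ne_zero ζ hζ).hasFDerivWithinAt)
      hlip hξ hη
    refine this.trans ?_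
    nlinarith [hsub ξ hξ η hη]
  have e : M.affinePoint S ξ - M.Φc S ξ = ∑ i, bary ξ i •
      (M.Φc S (lagrangePoint (vertexNode (k := k) i)) - M.Φc S ξ -
        fderivWithin ℝ (M.Φc S) R ξ (lagrangePoint (vertexNode (k := k) i) - ξ)) := by
    simp only [smul_sub, Finset.sum_sub_distrib, ← map_smul, ← map_sum, sum_bary_smul_vertex hk,
      ← Finset.sum_smul, sum_bary, one_smul, sub_self, map_zero, sub_zero]
    simp only [affinePoint, vertex, M.node]
  rw [← norm_neg, neg_sub, e]
  refine (norm_sum_le _ _).trans ?_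
  calc _ ≤ ∑ i, bary ξ i * (4 * |Λ| * M.width ^ 2) := by
        refine Finset.sum_le_sum fun i _ => ?_
        rw [norm_smul, Real.norm_of_nonneg (hξ i)]
        exact mul_le_mul_of_nonneg_left (htay _ (lagrangePoint_mem hk _)) (hξ i)
    _ = _ := by rw [← Finset.sum_mul, sum_bary, one_mul]

theorem norm_node_sub_affinePoint_le (hk : 1 ≤ k) {ρ Λ : ℝ} (hM : M.QuasiUniform ρ Λ)
    (S : Fin M.Nel) (a : LocalNode n k) :
    ‖M.x₀ (M.loc S a) - M.affinePoint S (lagrangePoint a)‖ ≤ 4 * |Λ| * M.width ^ 2 := by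
  rw [M.node]
  exact M.norm_Φc_sub_affinePoint_le hk hM S (lagrangePoint_mem hk a)

theorem norm_node_sub_vertex_le (hk : 1 ≤ k) {ρ Λ : ℝ} (hM : M.QuasiUniform ρ Λ)
    (hw : 0 < M.width) (hw1 : M.width ≤ 1) (S : Fin M.Nel) (a : LocalNode n k) :
    ‖M.x₀ (M.loc S a) - M.vertex S 0‖ ≤ (n + 4 * |Λ|) * M.width := by
  have h1 := M.norm_node_sub_affinePoint_le hk hM S a
  have h2 := M.norm_affineLinear_le S (lagrangePoint a)
  have h3 : ‖lagrangePoint a‖ ≤ 1 := norm_le_one_of_mem_refSimplex (lagrangePoint_mem hk a)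
  have e : M.x₀ (M.loc S a) - M.vertex S 0 = (M.x₀ (M.loc S a) -
      M.affinePoint S (lagrangePoint a)) + M.affineLinear S (lagrangePoint a) := by
    rw [affinePoint_eq]; abel
  rw [e]
  refine (norm_add_le _ _).trans ?_
  have h4 : (n : ℝ) * M.width * ‖lagrangePoint a‖ ≤ n * M.width :=
    mul_le_of_le_one_right (by positivity) h3
  have h5 : 4 * |Λ| * M.width ^ 2 ≤ 4 * |Λ| * M.width :=
    mul_le_mul_of_nonneg_left (by nlinarith) (by positivity)
  linarith

theorem node_mem_closure (hk : 1 ≤ k) (j : M.Node) : M.x₀ j ∈ closure Ω₀ := by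
  obtain ⟨S, a, rfl⟩ := M.loc_surj j
  rw [← M.cover, M.node]
  exact mem_iUnion.2 ⟨S, mem_image_of_mem _ (lagrangePoint_mem hk a)⟩

end CurvedMesh

/-! ### Bounds for the exact flow -/

namespace HarmonicFlow

variable {T : ℝ} (F : HarmonicFlow n T)

/-- The space-time derivative of the flow map. -/
def derivX (q : ℝ × E n) : ℝ × E n →L[ℝ] E n := fderiv ℝ (fun q : ℝ × E n => F.X q.1 q.2) q

theorem hasFDerivAt_uncurry (q : ℝ × E n) :
    HasFDerivAt (fun q : ℝ × E n => F.X q.1 q.2) (F.derivX q) q :=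
  (F.smooth.differentiable two_ne_zero q).hasFDerivAt

theorem contDiff_derivX : ContDiff ℝ 1 F.derivX := F.smooth.fderiv_right (by norm_num)

theorem hasFDerivAt_X (t : ℝ) (p : E n) :
    HasFDerivAt (F.X t) ((F.derivX (t, p)).comp (ContinuousLinearMap.inr ℝ ℝ (E n))) p :=
  HasFDerivAt.comp (g := fun q : ℝ × E n => F.X q.1 q.2) (f := fun p => (t, p)) p
    (F.hasFDerivAt_uncurry (t, p)) (hasFDerivAt_prodMk_right t p)

theorem hasDerivAt_X (t : ℝ) (p : E n) : HasDerivAt (fun s => F.X s p) (F.derivX (t, p) (1, 0)) t := by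
  have h := HasFDerivAt.comp (g := fun q : ℝ × E n => F.X q.1 q.2) (f := fun s : ℝ => (s, p)) t
    (F.hasFDerivAt_uncurry (t, p)) (hasFDerivAt_prodMk_left t p)
  exact h.hasDerivAt.congr_deriv (by simp)

theorem v_eq {t : ℝ} (ht : t ∈ Icc 0 T) {p : E n} (hp : p ∈ closure F.Ω₀) :
    F.v t (F.X t p) = F.derivX (t, p) (1, 0) :=
  (F.velocity t ht p hp).unique (F.hasDerivAt_X t p)

theorem continuous_X (p : E n) : Continuous fun t => F.X t p :=
  F.smooth.continuous.comp (continuous_id.prodMk continuous_const)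

theorem isCompact_closure : IsCompact (closure F.Ω₀) :=
  F.bounded.isCompact_closure

theorem exists_lower_bound : ∃ m > 0, ∀ t ∈ Icc (0 : ℝ) T, ∀ p ∈ closure F.Ω₀, ∀ v : E n,
    m * ‖v‖ ≤ ‖F.derivX (t, p) (0, v)‖ := by
  set K : Set ((ℝ × E n) × E n) := (Icc (0 : ℝ) T ×ˢ closure F.Ω₀) ×ˢ Metric.sphere (0 : E n) 1
  have hK : IsCompact K := (isCompact_Icc.prod F.isCompact_closure).prod (isCompact_sphere _ _)
  have hc : Continuous fun z : (ℝ × E n) × E n => ‖F.derivX z.1 (0, z.2)‖ := by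
    refine Continuous.norm (Continuous.clm_apply ?_ ?_)
    · exact F.contDiff_derivX.continuous.comp continuous_fst
    · fun_prop
  have hpos : ∀ z ∈ K, 0 < ‖F.derivX z.1 (0, z.2)‖ := by
    rintro ⟨⟨t, p⟩, v⟩ ⟨⟨ht, hp⟩, hv⟩
    rw [norm_pos_iff]
    intro h0
    have hdet := F.nondegenerate t ht p hp
    rw [(F.hasFDerivAt_X t p).fderiv] at hdet
    set A := (F.derivX (t, p)).comp (ContinuousLinearMap.inr ℝ ℝ (E n)) with hA
    have hv0 : v = 0 := by
      refine (A.toContinuousLinearEquivOfDetNeZero hdet).injective ?_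
      rw [map_zero, ContinuousLinearMap.toContinuousLinearEquivOfDetNeZero_apply]
      simpa [hA] using h0
    rw [hv0] at hv
    simp at hv
  rcases K.eq_empty_or_nonempty with he | hne
  · refine ⟨1, one_pos, fun t ht p hp v => ?_⟩
    rcases eq_or_ne v 0 with rfl | hv
    · simp
    · have : ((t, p), ‖v‖⁻¹ • v) ∈ K := ⟨⟨ht, hp⟩, by
        simp [norm_smul, norm_ne_zero_iff.2 hv]⟩
      rw [he] at this
      exact absurd this (notMem_empty _)
  · obtain ⟨z₀, hz₀, hmin⟩ := hK.exists_isMinOn hne hc.continuousOn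
    refine ⟨_, hpos z₀ hz₀, fun t ht p hp v => ?_⟩
    rcases eq_or_ne v 0 with rfl | hv
    · simp
    · have hv0 : 0 < ‖v‖ := norm_pos_iff.2 hv
      have hm : ((t, p), ‖v‖⁻¹ • v) ∈ K := ⟨⟨ht, hp⟩, by simp [norm_smul, hv0.ne']⟩
      have h1 := isMinOn_iff.1 hmin _ hm
      simp only at h1
      have e : ((0, ‖v‖⁻¹ • v) : ℝ × E n) = ‖v‖⁻¹ • (0, v) := by simp
      rw [e, map_smul, norm_smul, norm_inv, norm_norm, inv_mul_eq_div, le_div_iff₀ hv0] at h1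
      exact h1

theorem exists_lipschitz_derivX : ∃ L > 0, ∀ t ∈ Icc (0 : ℝ) T,
    ∀ p ∈ closure (convexHull ℝ F.Ω₀), ∀ q ∈ closure (convexHull ℝ F.Ω₀),
      ‖F.derivX (t, q) - F.derivX (t, p)‖ ≤ L * ‖q - p‖ := by
  have hK : IsCompact (Icc (0 : ℝ) T ×ˢ closure (convexHull ℝ F.Ω₀)) :=
    isCompact_Icc.prod (isBounded_convexHull.2 F.bounded).isCompact_closure
  have hKc : Convex ℝ (Icc (0 : ℝ) T ×ˢ closure (convexHull ℝ F.Ω₀)) :=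
    (convex_Icc _ _).prod (convex_convexHull _ _).closure
  obtain ⟨L, hL⟩ := ContDiffOn.exists_lipschitzOnWith (n := 1)
    (F.contDiff_derivX.contDiffOn (s := Icc (0 : ℝ) T ×ˢ closure (convexHull ℝ F.Ω₀)))
    one_ne_zero hKc hK
  refine ⟨L + 1, by positivity, fun t ht p hp q hq => ?_⟩
  have := hL.norm_sub_le (mk_mem_prod ht hq) (mk_mem_prod ht hp)
  refine this.trans ?_
  rw [Prod.mk_sub_mk, sub_self, Prod.norm_mk, norm_zero, max_eq_right (norm_nonneg _)]
  exact mul_le_mul_of_nonneg_right (by linarith) (norm_nonneg _)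

theorem exists_bound_derivX : ∃ B > 0, ∀ t ∈ Icc (0 : ℝ) T, ∀ p ∈ closure F.Ω₀,
    ‖F.derivX (t, p)‖ ≤ B := by
  obtain ⟨B, hB⟩ := (isCompact_Icc (a := (0 : ℝ)) (b := T)).prod F.isCompact_closure
    |>.exists_bound_of_continuousOn (f := F.derivX) F.contDiff_derivX.continuous.continuousOn
  exact ⟨max B 1, by positivity, fun t ht p hp =>
    (hB _ (mk_mem_prod ht hp)).trans (le_max_left _ _)⟩

theorem norm_taylor_le {L t : ℝ} (hL0 : 0 < L)
    (hL : ∀ p ∈ closure (convexHull ℝ F.Ω₀), ∀ q ∈ closure (convexHull ℝ F.Ω₀),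
      ‖F.derivX (t, q) - F.derivX (t, p)‖ ≤ L * ‖q - p‖) {p q : E n}
    (hp : p ∈ closure F.Ω₀) (hq : q ∈ closure F.Ω₀) :
    ‖F.X t q - F.X t p - F.derivX (t, p) (0, q - p)‖ ≤ L * ‖q - p‖ ^ 2 := by
  have hp' := closure_mono (subset_convexHull ℝ _) hp
  have hq' := closure_mono (subset_convexHull ℝ _) hq
  have h1 := (convex_segment p q).norm_image_sub_le_of_norm_hasFDerivWithin_le'
    (f := F.X t) (φ := (F.derivX (t, p)).comp (ContinuousLinearMap.inr ℝ ℝ (E n)))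
    (C := L * ‖q - p‖)
    (fun z _ => (F.hasFDerivAt_X t z).hasFDerivWithinAt)
    (fun z hz => by
      rw [← ContinuousLinearMap.sub_comp]
      refine (ContinuousLinearMap.opNorm_comp_le _ _).trans ?_
      have h2 := hL p hp' z ((convex_convexHull ℝ _).closure.segment_subset hp' hq' hz)
      have h3 : ‖z - p‖ ≤ ‖q - p‖ := norm_sub_le_of_mem_segment hz
      have h4 : ‖ContinuousLinearMap.inr ℝ ℝ (E n)‖ ≤ 1 :=
        ContinuousLinearMap.norm_inr_le_one ℝ ℝ (E n)
      calc _ ≤ (L * ‖q - p‖) * 1 := by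
            refine mul_le_mul (h2.trans ?_) h4 (norm_nonneg _) (by positivity)
            exact mul_le_mul_of_nonneg_left h3 (by positivity)
        _ = _ := mul_one _)
    (left_mem_segment ℝ p q) (right_mem_segment ℝ p q)
  rw [sq, ← mul_assoc]
  exact h1

theorem norm_velocity_sub_le {L t : ℝ}
    (hL : ∀ p ∈ closure (convexHull ℝ F.Ω₀), ∀ q ∈ closure (convexHull ℝ F.Ω₀),
      ‖F.derivX (t, q) - F.derivX (t, p)‖ ≤ L * ‖q - p‖) {p q : E n}
    (hp : p ∈ closure F.Ω₀) (hq : q ∈ closure F.Ω₀) :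
    ‖F.derivX (t, q) (1, 0) - F.derivX (t, p) (1, 0)‖ ≤ L * ‖q - p‖ := by
  have h1 := (F.derivX (t, q) - F.derivX (t, p)).le_of_opNorm_le
    (hL p (closure_mono (subset_convexHull ℝ _) hp) q (closure_mono (subset_convexHull ℝ _) hq)) ((1, 0) : ℝ × E n)
  have h2 : ‖((1, 0) : ℝ × E n)‖ = 1 := by simp [Prod.norm_mk]
  rw [h2, mul_one] at h1
  exact h1

end HarmonicFlow

/-! ### Regularity of the interpolated flow -/

theorem exists_bound_sum_fderiv_shape (n k : ℕ) : ∃ C > 0, ∀ (z : LocalNode n k → E n) (μ : ℝ),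
    (∀ a, ‖z a‖ ≤ μ) → ∀ ξ ∈ refSimplex n, ∀ v : E n,
      ‖∑ a, fderiv ℝ (shape a) ξ v • z a‖ ≤ C * μ * ‖v‖ := by
  have h : ∀ a : LocalNode n k, ∃ C, ∀ ξ ∈ refSimplex n, ‖fderiv ℝ (shape a) ξ‖ ≤ C := fun a =>
    (isCompact_refSimplex n).exists_bound_of_continuousOn (continuous_fderiv_shape a).continuousOn
  choose C hC using h
  refine ⟨∑ a, |C a| + 1, by positivity, fun z μ hz ξ hξ v => ?_⟩
  have hμ : 0 ≤ μ := (norm_nonneg _).trans (hz (vertexNode 0))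
  calc _ ≤ ∑ a, ‖fderiv ℝ (shape a) ξ v • z a‖ := norm_sum_le _ _
    _ ≤ ∑ a, |C a| * μ * ‖v‖ := by
        refine Finset.sum_le_sum fun a _ => ?_
        rw [norm_smul]
        calc _ ≤ (|C a| * ‖v‖) * μ := by
              refine mul_le_mul ?_ (hz a) (norm_nonneg _) (by positivity)
              exact (fderiv ℝ (shape a) ξ).le_of_opNorm_le ((hC a ξ hξ).trans (le_abs_self _)) v
          _ = _ := by ring
    _ ≤ _ := by
        rw [← Finset.sum_mul, ← Finset.sum_mul]
        gcongr
        linarith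

/-- On fine quasi-uniform meshes the Jacobians of the interpolated flow are uniformly of the size of
the mesh width, and the interpolated velocity is uniformly Lipschitz. -/
theorem exists_regular_interpolation (hn : 0 < n) (hk : 1 ≤ k) {T : ℝ} (F : HarmonicFlow n T)
    {ρ : ℝ} (Λ : ℝ) (hρ : 0 < ρ) :
    ∃ h₀ > 0, ∃ m > 0, ∃ C > 0, ∃ G > 0, ∀ M : CurvedMesh n k F.Ω₀, M.QuasiUniform ρ Λ →
      M.width ≤ h₀ → ∀ t ∈ Icc (0 : ℝ) T, ∀ S, ∀ ξ ∈ refSimplex n,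
      (∀ v, m * M.width * ‖v‖ ≤ ‖M.jacobian (xStar F M t) S ξ v‖) ∧
      ‖M.jacobian (xStar F M t) S ξ‖ ≤ C * M.width ∧
      ∀ c, ‖M.nodalGrad (component c (vStar F M t)) S ξ‖ ≤ G * M.width := by
  obtain ⟨m, hm, hlow⟩ := F.exists_lower_bound
  obtain ⟨B, hB, hbd⟩ := F.exists_bound_derivX
  obtain ⟨L, hL, hlip⟩ := F.exists_lipschitz_derivX
  obtain ⟨Cs, hCs, hshape⟩ := exists_bound_sum_fderiv_shape n k
  obtain ⟨Cg, hCg, hgrad⟩ := exists_bound_localGrad_of_osc n k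
  set K₁ : ℝ := n + 4 * |Λ| with hK₁
  have hn0 : (0 : ℝ) < n := Nat.cast_pos.2 hn
  have hK₁0 : 0 < K₁ := by positivity
  set K₂ : ℝ := Cs * (B * (4 * |Λ|) + L * K₁ ^ 2) with hK₂
  have hK₂0 : 0 < K₂ := by positivity
  refine ⟨min 1 (m * ρ / (4 * K₂)), by positivity, m * ρ / 4, by positivity, B * n + K₂,
    by positivity, Cg * (L * (2 * K₁)), by positivity, ?_⟩
  intro M hM hw t ht S ξ hξ
  set h := M.width with hh
  have hw0 : 0 < h := M.width_pos hn hk F.connected.nonempty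
  have hw1 : h ≤ 1 := hw.trans (min_le_left _ _)
  have hw2 : K₂ * h ≤ m * ρ / 4 := by
    have := hw.trans (min_le_right _ _)
    rw [le_div_iff₀ (by positivity)] at this
    linarith
  set p := M.vertex S 0 with hp
  have hpc : p ∈ closure F.Ω₀ := M.node_mem_closure hk _
  have hnode : ∀ a, M.x₀ (M.loc S a) ∈ closure F.Ω₀ := fun a => M.node_mem_closure hk _
  have hdist : ∀ a, ‖M.x₀ (M.loc S a) - p‖ ≤ K₁ * h := M.norm_node_sub_vertex_le hk hM hw0 hw1 S
  set A : E n →L[ℝ] E n := (F.derivX (t, p)).comp (ContinuousLinearMap.inr ℝ ℝ (E n)) with hA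
  have hAv : ∀ v, A v = F.derivX (t, p) (0, v) := fun v => by simp [hA]
  have hAB : ∀ v, ‖A v‖ ≤ B * ‖v‖ := fun v => by
    rw [hAv]
    refine ((F.derivX (t, p)).le_of_opNorm_le (hbd t ht p hpc) _).trans (le_of_eq ?_)
    simp [Prod.norm_mk]
  set z : LocalNode n k → E n := fun a =>
    xStar F M t (M.loc S a) - F.X t p - A (M.affineLinear S (lagrangePoint a)) with hz
  have hzb : ∀ a, ‖z a‖ ≤ (B * (4 * |Λ|) + L * K₁ ^ 2) * h ^ 2 := by
    intro a
    set q := M.x₀ (M.loc S a) with hq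
    have e : z a = (F.X t q - F.X t p - F.derivX (t, p) (0, q - p)) +
        A (q - M.affinePoint S (lagrangePoint a)) := by
      rw [CurvedMesh.affinePoint_eq, ← hAv, map_sub, map_sub, map_add]
      simp only [hz, xStar]
      abel
    have h1 := F.norm_taylor_le hL (hlip t ht) hpc (hnode a)
    have h2 := hAB (q - M.affinePoint S (lagrangePoint a))
    have h3 := M.norm_node_sub_affinePoint_le hk hM S a
    have h4 : ‖q - p‖ ^ 2 ≤ (K₁ * h) ^ 2 := pow_le_pow_left₀ (norm_nonneg _) (hdist a) 2
    rw [e]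
    refine (norm_add_le _ _).trans ?_
    calc _ ≤ L * (K₁ * h) ^ 2 + B * (4 * |Λ| * h ^ 2) :=
          add_le_add (h1.trans (mul_le_mul_of_nonneg_left h4 hL.le))
            (h2.trans (mul_le_mul_of_nonneg_left h3 hB.le))
      _ = _ := by ring
  have hJ : ∀ v, M.jacobian (xStar F M t) S ξ v - A (M.affineLinear S v) =
      ∑ a, fderiv ℝ (shape a) ξ v • z a := by
    intro v
    have h1 : ∑ a : LocalNode n k, fderiv ℝ (shape a) ξ v • F.X t p = 0 := by
      rw [← Finset.sum_smul]
      have := congrArg (fun L : E n →L[ℝ] ℝ => L v) (sum_fderiv_shape (k := k) ξ)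
      simp only [sum_apply, zero_apply] at this
      rw [this, zero_smul]
    have h2 : ∑ a : LocalNode n k, fderiv ℝ (shape a) ξ v •
        A (M.affineLinear S (lagrangePoint a)) = A (M.affineLinear S v) := by
      conv_rhs => rw [← sum_fderiv_shape_smul_lagrangePoint hk ξ v]
      simp only [map_sum, map_smul]
    simp only [hz, smul_sub, Finset.sum_sub_distrib, h1, h2, CurvedMesh.jacobian_apply, sub_zero]
  have hJd : ∀ v, ‖M.jacobian (xStar F M t) S ξ v - A (M.affineLinear S v)‖ ≤
      K₂ * h ^ 2 * ‖v‖ := fun v => by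
    rw [hJ]
    refine (hshape z _ hzb ξ hξ v).trans (le_of_eq ?_)
    rw [hK₂]; ring
  refine ⟨fun v => ?_, ?_, fun c => ?_⟩
  · have h1 := M.le_norm_affineLinear hk hρ hM hw0 S v
    have h2 := hlow t ht p hpc (M.affineLinear S v)
    rw [← hAv] at h2
    have h3 := hJd v
    have h4 := norm_sub_norm_le (A (M.affineLinear S v)) (M.jacobian (xStar F M t) S ξ v)
    rw [norm_sub_rev] at h4
    have h5 : m * (ρ / 2 * h * ‖v‖) ≤ m * ‖M.affineLinear S v‖ :=
      mul_le_mul_of_nonneg_left h1 hm.le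
    have h6 : K₂ * h ^ 2 * ‖v‖ ≤ m * ρ / 4 * (h * ‖v‖) := by
      calc K₂ * h ^ 2 * ‖v‖ = K₂ * h * (h * ‖v‖) := by ring
        _ ≤ _ := mul_le_mul_of_nonneg_right hw2 (by positivity)
    nlinarith
  · refine ContinuousLinearMap.opNorm_le_bound _ (by positivity) fun v => ?_
    have h3 := hJd v
    have h4 := norm_sub_norm_le (M.jacobian (xStar F M t) S ξ v) (A (M.affineLinear S v))
    have h5 : ‖A (M.affineLinear S v)‖ ≤ B * (n * h * ‖v‖) :=
      (hAB _).trans (mul_le_mul_of_nonneg_left (M.norm_affineLinear_le S v) hB.le)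
    have h6 : K₂ * h ^ 2 * ‖v‖ ≤ K₂ * h * ‖v‖ := by
      gcongr
      nlinarith
    nlinarith
  · have e : Cg * (L * (2 * K₁)) * h = Cg * (L * (2 * K₁) * h) := by ring
    rw [e]
    refine hgrad _ _ (fun a b => ?_) ξ hξ
    have h1 := F.norm_velocity_sub_le (hlip t ht) (hnode b) (hnode a)
    have h2 : ‖M.x₀ (M.loc S a) - M.x₀ (M.loc S b)‖ ≤ 2 * K₁ * h := by
      have e2 : M.x₀ (M.loc S a) - M.x₀ (M.loc S b) =
          (M.x₀ (M.loc S a) - p) - (M.x₀ (M.loc S b) - p) := by abel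
      rw [e2]
      refine (norm_sub_le _ _).trans ?_
      linarith [hdist a, hdist b]
    have h3 : |component c (vStar F M t) (M.loc S a) - component c (vStar F M t) (M.loc S b)| ≤
        ‖F.derivX (t, M.x₀ (M.loc S a)) (1, 0) - F.derivX (t, M.x₀ (M.loc S b)) (1, 0)‖ := by
      simp only [component, vStar]
      rw [F.v_eq ht (hnode a), F.v_eq ht (hnode b), ← PiLp.sub_apply, ← Real.norm_eq_abs]
      exact PiLp.norm_apply_le _ c
    calc _ ≤ L * ‖M.x₀ (M.loc S a) - M.x₀ (M.loc S b)‖ := h3.trans h1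
      _ ≤ L * (2 * K₁ * h) := mul_le_mul_of_nonneg_left h2 hL.le
      _ = _ := by ring

/-! ### Ordinary differential equations -/

theorem hasDerivWithinAt_Ici {V : Type*} [NormedAddCommGroup V] [NormedSpace ℝ V] {f : ℝ → V}
    {f' : V} {T t : ℝ} (ht : t ∈ Ico 0 T) (h : HasDerivWithinAt f f' (Icc 0 T) t) :
    HasDerivWithinAt f f' (Ici t) t :=
  h.mono_of_mem_nhdsWithin (Icc_mem_nhdsGE_of_mem ht)

/-- Uniqueness for an ordinary differential equation whose right-hand side is `C¹` near the graph of
one of the two solutions. -/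
theorem eqOn_of_hasDerivWithinAt {V : Type*} [NormedAddCommGroup V] [NormedSpace ℝ V] {T : ℝ}
    {b : ℝ → V → V} {U : Set (ℝ × V)} (hU : IsOpen U)
    (hb : ContDiffOn ℝ 1 (fun q : ℝ × V => b q.1 q.2) U) {f g : ℝ → V} (h0 : f 0 = g 0)
    (hf : ∀ t ∈ Icc (0 : ℝ) T, HasDerivWithinAt f (b t (f t)) (Icc 0 T) t)
    (hg : ∀ t ∈ Icc (0 : ℝ) T, HasDerivWithinAt g (b t (g t)) (Icc 0 T) t)
    (hgU : ∀ t ∈ Icc (0 : ℝ) T, (t, g t) ∈ U) : EqOn f g (Icc 0 T) := by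
  have hfc : ContinuousOn f (Icc 0 T) := fun t ht => (hf t ht).continuousWithinAt
  have hgc : ContinuousOn g (Icc 0 T) := fun t ht => (hg t ht).continuousWithinAt
  have hcl : IsClosed ({t | f t = g t} ∩ Icc 0 T) := by
    have := (hfc.sub hgc).preimage_isClosed_of_isClosed isClosed_Icc (isClosed_singleton (x := 0))
    convert! this using 1
    ext t
    simp [sub_eq_zero, and_comm]
  refine hcl.Icc_subset_of_forall_exists_gt h0 fun t ⟨hfg, ht⟩ y hy => ?_
  have htI : t ∈ Icc 0 T := Ico_subset_Icc_self ht
  obtain ⟨K, N, hN, hK⟩ :=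
    (hb.contDiffAt (hU.mem_nhds (hgU t htI))).exists_lipschitzOnWith
  have hev : ∀ φ : ℝ → V, ContinuousOn φ (Icc 0 T) → φ t = g t →
      ∀ᶠ s in nhdsWithin t (Ici t), (s, φ s) ∈ N := by
    intro φ hφ hφt
    have h1 : ContinuousWithinAt φ (Ici t) t :=
      (hφ t htI).mono_of_mem_nhdsWithin (Icc_mem_nhdsGE_of_mem ht)
    have h2 : ContinuousWithinAt (fun s => (s, φ s)) (Ici t) t :=
      continuousWithinAt_id.prodMk h1
    refine h2.eventually ?_
    change N ∈ nhds (t, φ t)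
    rw [hφt]
    exact hN
  obtain ⟨u, hu, hsub⟩ := mem_nhdsGE_iff_exists_Icc_subset.1
    (((hev f hfc hfg).and (hev g hgc rfl)).and (Icc_mem_nhdsGE_of_mem ht))
  have hut : t < u := hu
  have hmem : ∀ s ∈ Icc t u, ((s, f s) ∈ N ∧ (s, g s) ∈ N) ∧ s ∈ Icc 0 T := fun s hs => hsub hs
  have huT : u ≤ T := (hmem u (right_mem_Icc.2 hut.le)).2.2
  have hI : Icc t u ⊆ Icc 0 T := fun s hs => (hmem s hs).2
  have hIco : ∀ s ∈ Ico t u, s ∈ Ico 0 T := fun s hs => ⟨ht.1.trans hs.1, hs.2.trans_le huT⟩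
  have heq : EqOn f g (Icc t u) := by
    refine ODE_solution_unique_of_mem_Icc_right (v := b) (s := fun s => {p | (s, p) ∈ N}) (K := K)
      (fun s _ => ?_) (hfc.mono hI)
      (fun s hs => hasDerivWithinAt_Ici (hIco s hs) (hf s (Ico_subset_Icc_self (hIco s hs))))
      (fun s hs => (hmem s (Ico_subset_Icc_self hs)).1.1) (hgc.mono hI)
      (fun s hs => hasDerivWithinAt_Ici (hIco s hs) (hg s (Ico_subset_Icc_self (hIco s hs))))
      (fun s hs => (hmem s (Ico_subset_Icc_self hs)).1.2) hfg
    intro p hp q hq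
    have := hK hp hq
    simpa [Prod.edist_eq] using this
  have hm : min u y ∈ Icc t u := ⟨le_min hut.le (le_of_lt hy), min_le_left _ _⟩
  exact ⟨min u y, heq hm, lt_min hut hy, min_le_right _ _⟩

/-- A Gronwall inequality with variable inhomogeneity. -/
theorem le_integral_of_hasDerivWithinAt_le {T A B : ℝ} (hA : 0 ≤ A) (hB : 0 ≤ B) {g g' δ : ℝ → ℝ}
    (hg : ∀ t ∈ Icc (0 : ℝ) T, HasDerivWithinAt g (g' t) (Icc 0 T) t) (h0 : g 0 = 0)
    (hδ : ContinuousOn δ (Icc 0 T)) (hδ0 : ∀ t ∈ Icc (0 : ℝ) T, 0 ≤ δ t)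
    (hle : ∀ t ∈ Icc (0 : ℝ) T, g' t ≤ A * g t + B * δ t) {t : ℝ} (ht : t ∈ Icc (0 : ℝ) T) :
    g t ≤ Real.exp (A * T) * B * ∫ s in (0 : ℝ)..t, δ s := by
  have hint : ∀ s ∈ Icc (0 : ℝ) T, IntervalIntegrable δ volume 0 s := fun s hs =>
    (hδ.mono (by rw [uIcc_of_le hs.1]; exact Icc_subset_Icc_right hs.2)).intervalIntegrable
  have hd : ∀ s ∈ Ioo (0 : ℝ) T, HasDerivAt
      (fun s => Real.exp (-(A * s)) * g s - B * ∫ r in (0 : ℝ)..s, δ r)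
      (Real.exp (-(A * s)) * (-A) * g s + Real.exp (-(A * s)) * g' s - B * δ s) s := by
    intro s hs
    have h1 : HasDerivAt g (g' s) s :=
      (hg s (Ioo_subset_Icc_self hs)).hasDerivAt (Icc_mem_nhds hs.1 hs.2)
    have h2 : HasDerivAt (fun s => ∫ r in (0 : ℝ)..s, δ r) (δ s) s :=
      intervalIntegral.integral_hasDerivAt_right (hint s (Ioo_subset_Icc_self hs))
        ((hδ.mono Ioo_subset_Icc_self).stronglyMeasurableAtFilter isOpen_Ioo s hs)
        (hδ.continuousAt (Icc_mem_nhds hs.1 hs.2))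
    have h3 : HasDerivAt (fun s => Real.exp (-(A * s))) (Real.exp (-(A * s)) * (-A)) s := by
      have := ((hasDerivAt_id s).const_mul A).neg.exp
      simpa using this
    exact (h3.mul h1).sub (h2.const_mul B)
  have hc : ContinuousOn (fun s => Real.exp (-(A * s)) * g s - B * ∫ r in (0 : ℝ)..s, δ r)
      (Icc 0 T) := by
    have hgc : ContinuousOn g (Icc 0 T) := fun t ht => (hg t ht).continuousWithinAt
    have he : ContinuousOn (fun s => Real.exp (-(A * s))) (Icc 0 T) := by fun_prop
    have hI : ContinuousOn (fun s => ∫ r in (0 : ℝ)..s, δ r) (Icc 0 T) :=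
      intervalIntegral.continuousOn_primitive_interval (by
        rcases le_or_gt 0 T with hT | hT
        · rw [uIcc_of_le hT]; exact hδ.integrableOn_Icc
        · exact absurd (ht.1.trans ht.2) (not_le.2 hT)) |>.mono (Icc_subset_uIcc)
    exact (he.mul hgc).sub (continuousOn_const.mul hI)
  have hanti : AntitoneOn (fun s => Real.exp (-(A * s)) * g s - B * ∫ r in (0 : ℝ)..s, δ r)
      (Icc 0 T) := by
    refine antitoneOn_of_deriv_nonpos (convex_Icc 0 T) hc ?_ ?_
    · rw [interior_Icc]
      exact fun s hs => (hd s hs).differentiableAt.differentiableWithinAt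
    · rw [interior_Icc]
      intro s hs
      rw [(hd s hs).deriv]
      have h1 := hle s (Ioo_subset_Icc_self hs)
      have h2 := hδ0 s (Ioo_subset_Icc_self hs)
      have h3 : Real.exp (-(A * s)) ≤ 1 := Real.exp_le_one_iff.2 (by
        have := mul_nonneg hA hs.1.le
        linarith)
      have h4 := Real.exp_pos (-(A * s))
      have h5 : Real.exp (-(A * s)) * (g' s - A * g s) ≤ Real.exp (-(A * s)) * (B * δ s) :=
        mul_le_mul_of_nonneg_left (by linarith) h4.le
      have h6 : Real.exp (-(A * s)) * (B * δ s) ≤ 1 * (B * δ s) :=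
        mul_le_mul_of_nonneg_right h3 (mul_nonneg hB h2)
      linarith
  have h1 := hanti (left_mem_Icc.2 (ht.1.trans ht.2)) ht ht.1
  simp only [h0, mul_zero, intervalIntegral.integral_same, sub_zero] at h1
  have hI0 : 0 ≤ ∫ s in (0 : ℝ)..t, δ s :=
    intervalIntegral.integral_nonneg ht.1 fun s hs => hδ0 s ⟨hs.1, hs.2.trans ht.2⟩
  have h2 : Real.exp (-(A * t)) * g t ≤ B * ∫ s in (0 : ℝ)..t, δ s := by linarith
  have h3 : g t = Real.exp (A * t) * (Real.exp (-(A * t)) * g t) := by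
    rw [← mul_assoc, ← Real.exp_add, add_neg_cancel, Real.exp_zero, one_mul]
  rw [h3, mul_assoc]
  refine (mul_le_mul_of_nonneg_left h2 (Real.exp_pos _).le).trans ?_
  exact mul_le_mul_of_nonneg_right (Real.exp_le_exp.2 (mul_le_mul_of_nonneg_left ht.2 hA))
    (mul_nonneg hB hI0)

/-- A continuity argument: a bound that implies a strict version of itself holds throughout. -/
theorem lt_of_bootstrap {T B : ℝ} {m : ℝ → ℝ} (hm : ContinuousOn m (Icc 0 T)) (h0 : m 0 < B)
    (hstep : ∀ t ∈ Icc (0 : ℝ) T, (∀ s ∈ Icc (0 : ℝ) t, m s ≤ B) → m t < B) :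
    ∀ t ∈ Icc (0 : ℝ) T, m t < B := by
  by_contra! hcon
  obtain ⟨t₁, ht₁, hB₁⟩ := hcon
  have hcl : IsClosed (Icc 0 T ∩ m ⁻¹' Ici B) := hm.preimage_isClosed_of_isClosed isClosed_Icc
    isClosed_Ici
  have hcp : IsCompact (Icc 0 T ∩ m ⁻¹' Ici B) := isCompact_Icc.of_isClosed_subset hcl
    inter_subset_left
  obtain ⟨t₀, ⟨ht₀, hB₀⟩, hmin⟩ := hcp.exists_isLeast ⟨t₁, ht₁, hB₁⟩
  have hlt : ∀ s ∈ Icc (0 : ℝ) t₀, s ≠ t₀ → m s < B := fun s hs hne => by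
    by_contra! hge
    exact hne (le_antisymm hs.2 (hmin ⟨⟨hs.1, hs.2.trans ht₀.2⟩, hge⟩))
  obtain ⟨s, hs, hsB⟩ := intermediate_value_Icc ht₀.1 (hm.mono (Icc_subset_Icc_right ht₀.2))
    (⟨h0.le, hB₀⟩ : B ∈ Icc (m 0) (m t₀))
  have hst : s = t₀ := by
    by_contra hne
    exact (hlt s hs hne).ne hsB
  refine absurd (hstep t₀ ht₀ fun r hr => ?_) (not_lt.2 hB₀)
  by_cases hr' : r = t₀
  · rw [hr', ← hst, hsB]
  · exact (hlt r hr hr').le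

/-! ### Continuity in time of the exact nodal vectors and matrices -/

namespace CurvedMesh

variable {Ω₀ : Set (E n)} (M : CurvedMesh n k Ω₀)

theorem continuous_jacobian_left (S : Fin M.Nel) (ξ : E n) :
    Continuous fun y : M.Node → E n => M.jacobian y S ξ :=
  (continuous_pi_iff.1 M.continuous_jacobian S).comp (continuous_id.prodMk continuous_const)

theorem continuousOn_stiffnessMatrix {I : Set ℝ} {y : ℝ → M.Node → E n} (hy : ContinuousOn y I)
    {m c : ℝ} (hm : 0 < m)
    (hlow : ∀ t ∈ I, ∀ S, ∀ ξ ∈ refSimplex n, ∀ v, m * ‖v‖ ≤ ‖M.jacobian (y t) S ξ v‖)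
    (hbd : ∀ t ∈ I, ∀ S, ∀ ξ ∈ refSimplex n, ∀ p q,
      |dirichletDensity (M.jacobian (y t) S ξ) p q| ≤ c * (‖p‖ * ‖q‖)) (j l : M.Node) :
    ContinuousOn (fun t => M.stiffnessMatrix (y t) j l) I := by
  simp only [stiffnessMatrix_apply]
  refine continuousOn_finsetSum _ fun S _ => ?_
  have hms := (isCompact_refSimplex n).measurableSet
  refine continuousOn_of_dominated (bound := fun ξ =>
    c * (‖M.nodalGrad (Pi.single j 1) S ξ‖ * ‖M.nodalGrad (Pi.single l 1) S ξ‖)) ?_ ?_ ?_ ?_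
  · intro t ht
    exact (M.continuousOn_dirichletDensity hm (hlow t ht S) _ _).aestronglyMeasurable hms
  · intro t ht
    exact (ae_restrict_mem hms).mono fun ξ hξ => hbd t ht S ξ hξ _ _
  · exact (continuous_const.mul ((M.continuous_nodalGrad _ S).norm.mul
      (M.continuous_nodalGrad _ S).norm)).continuousOn.integrableOn_compact
        (isCompact_refSimplex n)
  · refine (ae_restrict_mem hms).mono fun ξ hξ t ht => ?_
    have h1 : ContinuousWithinAt (fun t => (M.jacobian (y t) S ξ, M.nodalGrad (Pi.single j 1) S ξ,
        M.nodalGrad (Pi.single l 1) S ξ)) I t := by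
      refine ContinuousWithinAt.prodMk ?_ continuousWithinAt_const
      have h2 := (M.continuous_jacobian_left S ξ).comp_continuousOn hy
      exact h2 t ht
    exact ContinuousAt.comp_continuousWithinAt
      (f := fun t => (M.jacobian (y t) S ξ, M.nodalGrad (Pi.single j 1) S ξ,
        M.nodalGrad (Pi.single l 1) S ξ))
      (continuousAt_dirichletDensity hm (hlow t ht S ξ hξ) _ _) h1

/-- The inverse inequality for nodal vectors, in terms of the reference form. -/
theorem exists_gradSq_le (n : ℕ) {k : ℕ} (hk : 1 ≤ k) : ∃ C > 0, ∀ {Ω₀ : Set (E n)}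
    (M : CurvedMesh n k Ω₀) (w : M.Node → E n) (S : Fin M.Nel), ∀ ξ ∈ refSimplex n,
      M.gradSq w S ξ ≤ C * kronForm M.refMatrix w w := by
  obtain ⟨C, hC, H⟩ := exists_inverse_inequality n hk
  refine ⟨C, hC, fun M w S ξ hξ => ?_⟩
  have hi : ∀ c : Fin n, IntegrableOn (fun ξ => ‖M.nodalGrad (component c w) S ξ‖ ^ 2)
      (refSimplex n) := fun c =>
    ((M.continuous_nodalGrad _ S).norm.pow 2).continuousOn.integrableOn_compact
      (isCompact_refSimplex n)
  calc M.gradSq w S ξ ≤ C * ∫ η in refSimplex n, M.gradSq w S η := by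
        unfold gradSq
        rw [integral_finsetSum _ fun c _ => hi c, Finset.mul_sum]
        exact Finset.sum_le_sum fun c _ => H _ ξ hξ
    _ ≤ _ := by
        rw [kronForm_refMatrix_self]
        refine mul_le_mul_of_nonneg_left ?_ hC.le
        exact Finset.single_le_sum (f := fun S => ∫ ξ in refSimplex n, M.gradSq w S ξ)
          (fun S _ => integral_nonneg fun ξ => M.gradSq_nonneg w S ξ) (Finset.mem_univ S)

end CurvedMesh

theorem continuousOn_kronForm_inv {ι : Type*} [Fintype ι] [DecidableEq ι] {I : Set ℝ}
    {B : ℝ → Matrix ι ι ℝ} {r : ℝ → ι → E n} (hB : ∀ j l, ContinuousOn (fun t => B t j l) I)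
    (hdet : ∀ t ∈ I, (B t).det ≠ 0) (hr : ∀ j, ContinuousOn (fun t => r t j) I) :
    ContinuousOn (fun t => kronForm (B t)⁻¹ (r t) (r t)) I := by
  have hB' : ContinuousOn B I := continuousOn_pi.2 fun j => continuousOn_pi.2 fun l => hB j l
  have hinv : ∀ j l, ContinuousOn (fun t => (B t)⁻¹ j l) I := by
    intro j l
    simp only [Matrix.inv_def, Ring.inverse_eq_inv', Matrix.smul_apply, smul_eq_mul]
    have h1 : ContinuousOn (fun t => (B t).det) I :=
      (continuous_id.matrix_det (n := ι) (R := ℝ)).comp_continuousOn hB'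
    have h2 : ContinuousOn (fun t => (B t).adjugate j l) I :=
      ((continuous_id.matrix_adjugate (n := ι) (R := ℝ)).matrix_elem j l).comp_continuousOn hB'
    exact (h1.inv₀ hdet).mul h2
  unfold kronForm
  exact continuousOn_finsetSum _ fun j _ => continuousOn_finsetSum _ fun l _ =>
    (hinv j l).mul ((hr j).inner (hr l))

theorem continuousOn_kron {p q : ℕ} {I : Set ℝ} {B : ℝ → Matrix (Fin p) (Fin q) ℝ}
    {w : ℝ → Fin q → E n} (hB : ∀ j l, ContinuousOn (fun t => B t j l) I)
    (hw : ∀ l, ContinuousOn (fun t => w t l) I) (j : Fin p) :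
    ContinuousOn (fun t => kron (B t) (w t) j) I := by
  unfold kron
  exact continuousOn_finsetSum _ fun l _ => (hB j l).smul (hw l)

section
variable {T : ℝ} (F : HarmonicFlow n T) (M : CurvedMesh n k F.Ω₀)

theorem continuous_xStar : Continuous (xStar F M) := continuous_pi fun j => F.continuous_X (M.x₀ j)

theorem continuousOn_vStar (hk : 1 ≤ k) (j : M.Node) :
    ContinuousOn (fun t => vStar F M t j) (Icc 0 T) := by
  have h : Continuous fun t => F.derivX (t, M.x₀ j) (1, 0) :=
    (F.contDiff_derivX.continuous.comp (continuous_id.prodMk continuous_const)).clm_apply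
      continuous_const
  exact h.continuousOn.congr fun t ht => F.v_eq ht (M.node_mem_closure hk j)

theorem hasDerivWithinAt_xStar (hk : 1 ≤ k) (j : M.Node) {t : ℝ} (ht : t ∈ Icc (0 : ℝ) T) :
    HasDerivWithinAt (fun s => xStar F M s j) (vStar F M t j) (Icc 0 T) t :=
  (F.velocity t ht _ (M.node_mem_closure hk j)).hasDerivWithinAt

variable {F M}

/-- The boundary nodes of the semi-discrete solution are exact. -/
theorem IsSemidiscreteSolution.boundaryNode_eq (hk : 1 ≤ k) {x v : ℝ → M.Node → E n}
    (h : IsSemidiscreteSolution F M x v) {t : ℝ} (ht : t ∈ Icc (0 : ℝ) T) (j : Fin M.NΓ) :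
    x t (Sum.inl j) = xStar F M t (Sum.inl j) := by
  obtain ⟨U, hU, hmem, hc⟩ := F.vΓ_smooth
  refine eqOn_of_hasDerivWithinAt (b := F.vΓ) hU hc (f := fun s => x s (Sum.inl j))
    (g := fun s => xStar F M s (Sum.inl j)) ?_ ?_ ?_ ?_ ht
  · simp only [h.initial, xStar]
    exact (F.initial _ (M.node_mem_closure hk _)).symm
  · intro s hs
    have := h.ode s hs (Sum.inl j)
    rwa [h.boundary s hs] at this
  · intro s hs
    have := hasDerivWithinAt_xStar F M hk (Sum.inl j) hs
    rwa [vStar, F.boundary s hs _ (M.boundaryNode j)] at this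
  · intro s hs
    exact hmem s hs _ (M.boundaryNode j)

theorem IsSemidiscreteSolution.boundaryVelocity_eq (hk : 1 ≤ k) {x v : ℝ → M.Node → E n}
    (h : IsSemidiscreteSolution F M x v) {t : ℝ} (ht : t ∈ Icc (0 : ℝ) T) (j : Fin M.NΓ) :
    v t (Sum.inl j) = vStar F M t (Sum.inl j) := by
  rw [h.boundary t ht, h.boundaryNode_eq hk ht, vStar, F.boundary t ht _ (M.boundaryNode j)]
  rfl

end

/-! ### The stability estimate -/

theorem exists_width_rpow_lt {γ K β : ℝ} (hγ : 0 < γ) (hK : 0 ≤ K) (hβ : 0 < β) :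
    ∃ h₀ > 0, ∀ h, 0 < h → h ≤ h₀ → K * h ^ γ < β := by
  have hq : 0 < β / (K + 1) := by positivity
  refine ⟨(β / (K + 1) / 2) ^ γ⁻¹, by positivity, fun h hh hle => ?_⟩
  have h1 : h ^ γ ≤ β / (K + 1) / 2 := by
    have := Real.rpow_le_rpow hh.le hle hγ.le
    rwa [Real.rpow_inv_rpow (by positivity) hγ.ne'] at this
  have h2 : 0 < h ^ γ := Real.rpow_pos_of_pos hh γ
  have h3 : (K + 1) * h ^ γ ≤ β / 2 := by
    calc (K + 1) * h ^ γ ≤ (K + 1) * (β / (K + 1) / 2) :=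
          mul_le_mul_of_nonneg_left h1 (by positivity)
      _ = _ := by field_simp
  linarith

theorem hasDerivWithinAt_kronForm {ι : Type*} [Fintype ι] {B : Matrix ι ι ℝ}
    (hB : ∀ j l, B j l = B l j) {f : ℝ → ι → E n} {f' : ι → E n} {I : Set ℝ} {t : ℝ}
    (hf : ∀ j, HasDerivWithinAt (fun s => f s j) (f' j) I t) :
    HasDerivWithinAt (fun s => kronForm B (f s) (f s)) (2 * kronForm B (f t) f') I t := by
  have h : HasDerivWithinAt (fun s => kronForm B (f s) (f s))
      (∑ j, ∑ l, B j l * (inner ℝ (f t j) (f' l) + inner ℝ (f' j) (f t l))) I t := by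
    unfold kronForm
    exact HasDerivWithinAt.fun_sum fun j _ => HasDerivWithinAt.fun_sum fun l _ =>
      ((hf j).inner ℝ (hf l)).const_mul _
  refine h.congr_deriv ?_
  have e : ∑ j, ∑ l, B j l * (inner ℝ (f t j) (f' l) + inner ℝ (f' j) (f t l)) =
      kronForm B (f t) f' + kronForm B f' (f t) := by
    simp only [kronForm, mul_add, Finset.sum_add_distrib]
  rw [e, kronForm_comm hB f' (f t)]
  ring

section
variable {T : ℝ} {F : HarmonicFlow n T} {M : CurvedMesh n k F.Ω₀}

/-- The position error in all nodes. -/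
theorem extendZero_positionError (hk : 1 ≤ k) {x v : ℝ → M.Node → E n}
    (h : IsSemidiscreteSolution F M x v) {t : ℝ} (ht : t ∈ Icc (0 : ℝ) T) :
    M.extendZero (positionError F M x t) = x t - xStar F M t :=
  M.extendZero_of_boundary (w := x t - xStar F M t) fun j => by
    rw [Pi.sub_apply, h.boundaryNode_eq hk ht, sub_self]

theorem extendZero_velocityError (hk : 1 ≤ k) {x v : ℝ → M.Node → E n}
    (h : IsSemidiscreteSolution F M x v) {t : ℝ} (ht : t ∈ Icc (0 : ℝ) T) :
    M.extendZero (velocityError F M v t) = v t - vStar F M t :=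
  M.extendZero_of_boundary (w := v t - vStar F M t) fun j => by
    rw [Pi.sub_apply, h.boundaryVelocity_eq hk ht, sub_self]

theorem hasDerivWithinAt_refEnergy (hk : 1 ≤ k) {x v : ℝ → M.Node → E n}
    (h : IsSemidiscreteSolution F M x v) {t : ℝ} (ht : t ∈ Icc (0 : ℝ) T) :
    HasDerivWithinAt (fun s => kronForm M.refMatrix (x s - xStar F M s) (x s - xStar F M s))
      (2 * kronForm M.refMatrix (x t - xStar F M t) (v t - vStar F M t)) (Icc 0 T) t :=
  hasDerivWithinAt_kronForm M.refMatrix_comm (f := fun s => x s - xStar F M s) fun j =>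
    (h.ode t ht j).sub (hasDerivWithinAt_xStar F M hk j ht)

/-- The dual norm of the defect depends continuously on time. -/
theorem continuousOn_starNorm_sq (hk : 1 ≤ k) {d : ℝ → Fin M.NΩ → E n}
    (hd : IsVelocityDefect F M d)
    (hA : ∀ t ∈ Icc (0 : ℝ) T, (M.A₂₂ (xStar F M t)).PosDef)
    (hc : ∀ j l, ContinuousOn (fun t => M.stiffnessMatrix (xStar F M t) j l) (Icc 0 T)) :
    ContinuousOn (fun t => starNorm M (xStar F M t) (d t) ^ 2) (Icc 0 T) := by
  set r : ℝ → Fin M.NΩ → E n := fun t =>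
    kron (M.A₂₂ (xStar F M t)) (fun j => vStar F M t (Sum.inr j)) +
      kron (M.A₂₁ (xStar F M t)) (fun j => vStar F M t (Sum.inl j)) with hr
  have hrd : ∀ t ∈ Icc (0 : ℝ) T, kron (M.M₂₂ (xStar F M t)) (d t) = r t := by
    intro t ht
    simp only [hr]
    rw [hd t ht]
    abel
  have hrc : ∀ j, ContinuousOn (fun t => r t j) (Icc 0 T) := fun j =>
    (continuousOn_kron (fun j l => hc (Sum.inr j) (Sum.inr l))
      (fun l => continuousOn_vStar F M hk (Sum.inr l)) j).add
    (continuousOn_kron (fun j l => hc (Sum.inr j) (Sum.inl l))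
      (fun l => continuousOn_vStar F M hk (Sum.inl l)) j)
  refine (continuousOn_kronForm_inv (B := fun t => M.A₂₂ (xStar F M t)) (r := r)
    (fun j l => hc (Sum.inr j) (Sum.inr l)) (fun t ht => (hA t ht).det_pos.ne') hrc).congr ?_
  intro t ht
  simp only [starNorm]
  rw [hrd t ht, energyNorm_sq (kronForm_nonneg_of_posDef (hA t ht).inv _)]

end

/-- The energy argument on a single mesh: as long as the error is so small that the discrete
domain stays regular, it is bounded by the defect, and this bound closes the argument. -/
theorem error_le_integral_of_bounds {T : ℝ} {F : HarmonicFlow n T}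
    {M : CurvedMesh n k F.Ω₀} (hk : 1 ≤ k) {x v : ℝ → M.Node → E n}
    (hsol : IsSemidiscreteSolution F M x v) {s K b η D : ℝ} (hs : 0 < s) (hK : 0 ≤ K) (hb : 0 ≤ b)
    (hη : 0 < η) {δ : ℝ → ℝ} (hδc : ContinuousOn δ (Icc 0 T)) (hδ0 : ∀ t ∈ Icc (0 : ℝ) T, 0 ≤ δ t)
    (hδD : ∀ t ∈ Icc (0 : ℝ) T, δ t ≤ D)
    (hsmall : Real.exp ((1 + K) * T) * b * (T * D) < η)
    (hvel : ∀ t ∈ Icc (0 : ℝ) T,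
      s * kronForm M.refMatrix (x t - xStar F M t) (x t - xStar F M t) ≤ η →
      s * kronForm M.refMatrix (v t - vStar F M t) (v t - vStar F M t) ≤
        K * (s * kronForm M.refMatrix (x t - xStar F M t) (x t - xStar F M t)) + b * δ t) :
    ∀ t ∈ Icc (0 : ℝ) T,
      s * kronForm M.refMatrix (x t - xStar F M t) (x t - xStar F M t) ≤ η ∧
      s * kronForm M.refMatrix (x t - xStar F M t) (x t - xStar F M t) ≤
        Real.exp ((1 + K) * T) * b * ∫ r in (0 : ℝ)..t, δ r := by
  set g : ℝ → ℝ := fun t => s * kronForm M.refMatrix (x t - xStar F M t) (x t - xStar F M t)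
    with hg
  have hder : ∀ t ∈ Icc (0 : ℝ) T, HasDerivWithinAt g
      (s * (2 * kronForm M.refMatrix (x t - xStar F M t) (v t - vStar F M t))) (Icc 0 T) t :=
    fun t ht => (hasDerivWithinAt_refEnergy hk hsol ht).const_mul s
  have hg0 : g 0 = 0 := by
    have : x 0 - xStar F M 0 = 0 := by
      funext j
      rw [Pi.sub_apply, hsol.initial, xStar, F.initial _ (M.node_mem_closure hk j), sub_self]
      rfl
    simp only [hg, this]
    simp only [kronForm, Pi.zero_apply, inner_zero_left, mul_zero, Finset.sum_const_zero]
  have hδI : ∀ t ∈ Icc (0 : ℝ) T, 0 ≤ ∫ r in (0 : ℝ)..t, δ r := fun t ht =>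
    intervalIntegral.integral_nonneg ht.1 fun r hr => hδ0 r ⟨hr.1, hr.2.trans ht.2⟩
  have hstep : ∀ t ∈ Icc (0 : ℝ) T, (∀ r ∈ Icc (0 : ℝ) t, g r ≤ η) →
      g t ≤ Real.exp ((1 + K) * T) * b * ∫ r in (0 : ℝ)..t, δ r := by
    intro t ht hr
    have hsub : Icc (0 : ℝ) t ⊆ Icc 0 T := Icc_subset_Icc_right ht.2
    have h1 := le_integral_of_hasDerivWithinAt_le (A := 1 + K) (B := b) (by linarith) hb
      (fun r hr => (hder r (hsub hr)).mono hsub) hg0 (hδc.mono hsub)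
      (fun r hr => hδ0 r (hsub hr)) (fun r hrt => ?_) (right_mem_Icc.2 ht.1)
    · refine h1.trans (mul_le_mul_of_nonneg_right (mul_le_mul_of_nonneg_right
        (Real.exp_le_exp.2 (mul_le_mul_of_nonneg_left ht.2 (by linarith))) hb) (hδI t ht))
    · have h2 := hvel r (hsub hrt) (hr r hrt)
      have h3 := two_mul_abs_kronForm_le M.refMatrix_comm M.kronForm_refMatrix_nonneg one_pos
        (x r - xStar F M r) (v r - vStar F M r)
      have h4 := le_abs_self (kronForm M.refMatrix (x r - xStar F M r) (v r - vStar F M r))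
      rw [inv_one, one_mul, one_mul] at h3
      have h5 : s * (2 * kronForm M.refMatrix (x r - xStar F M r) (v r - vStar F M r)) ≤
          s * (kronForm M.refMatrix (x r - xStar F M r) (x r - xStar F M r) +
            kronForm M.refMatrix (v r - vStar F M r) (v r - vStar F M r)) :=
        mul_le_mul_of_nonneg_left (by linarith) hs.le
      simp only [hg]
      linarith
  have hint : ∀ t ∈ Icc (0 : ℝ) T, ∫ r in (0 : ℝ)..t, δ r ≤ T * D := by
    intro t ht
    have hD0 : 0 ≤ D := (hδ0 t ht).trans (hδD t ht)
    have h1 : ∫ r in (0 : ℝ)..t, δ r ≤ ∫ _ in (0 : ℝ)..t, D := by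
      refine intervalIntegral.integral_mono_on ht.1 ?_ (by simp)
        fun r hr => hδD r ⟨hr.1, hr.2.trans ht.2⟩
      exact (hδc.mono (by rw [uIcc_of_le ht.1]; exact Icc_subset_Icc_right ht.2)).intervalIntegrable
    refine h1.trans ?_
    rw [intervalIntegral.integral_const, sub_zero, smul_eq_mul]
    exact mul_le_mul_of_nonneg_right ht.2 hD0
  have hlt := lt_of_bootstrap (B := η) (fun t ht => (hder t ht).continuousWithinAt)
    (by rw [hg0]; exact hη) fun t ht hr => (hstep t ht hr).trans_lt
      ((mul_le_mul_of_nonneg_left (hint t ht) (by positivity)).trans_lt hsmall)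
  exact fun t ht => ⟨(hlt t ht).le, hstep t ht fun r hr =>
    (hlt r ⟨hr.1, hr.2.trans ht.2⟩).le⟩

end EvolvingFEM

end

theorem mainTheorem2 (n : ℕ) (hn : n = 2 ∨ n = 3) (k : ℕ) (hk : 2 ≤ k) (T : ℝ) (hT : 0 < T)
    (F : EvolvingFEM.HarmonicFlow n T) (ρ Λ : ℝ) (hρ : 0 < ρ)
    (κ C : ℝ) (hκ : (n : ℝ) / 2 < κ) :
    ∃ h₀ > 0, ∃ c > 0, ∀ M : EvolvingFEM.CurvedMesh n k F.Ω₀,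
      M.QuasiUniform ρ Λ → M.width ≤ h₀ →
      ∀ x v : ℝ → M.Node → EvolvingFEM.E n, EvolvingFEM.IsSemidiscreteSolution F M x v →
      ∀ d : ℝ → Fin M.NΩ → EvolvingFEM.E n, EvolvingFEM.IsVelocityDefect F M d →
      (∀ t ∈ Set.Icc (0 : ℝ) T,
        EvolvingFEM.starNorm M (EvolvingFEM.xStar F M t) (d t) ≤ C * M.width ^ κ) →
      ∀ t ∈ Set.Icc (0 : ℝ) T,
        EvolvingFEM.energyNorm (M.A₂₂ (EvolvingFEM.xStar F M t))
            (EvolvingFEM.positionError F M x t) ^ 2 ≤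
          c * ∫ s in (0 : ℝ)..t, EvolvingFEM.starNorm M (EvolvingFEM.xStar F M s) (d s) ^ 2 ∧
        EvolvingFEM.energyNorm (M.A₂₂ (EvolvingFEM.xStar F M t))
            (EvolvingFEM.velocityError F M v t) ^ 2 ≤
          c * EvolvingFEM.starNorm M (EvolvingFEM.xStar F M t) (d t) ^ 2 +
          c * ∫ s in (0 : ℝ)..t, EvolvingFEM.starNorm M (EvolvingFEM.xStar F M s) (d s) ^ 2 := by
  have hn0 : 0 < n := by omega
  have hk1 : 1 ≤ k := by omega
  obtain ⟨h₁, hh₁, m, hm, C', hC', G, hG, hreg⟩ :=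
    EvolvingFEM.exists_regular_interpolation hn0 hk1 F Λ hρ
  obtain ⟨c₁, hc₁, c₂, hc₂, c₃, hc₃, H⟩ :=
    EvolvingFEM.CurvedMesh.exists_stiffness_bounds n k hm hC' hG
  obtain ⟨Ci, hCi, hinv⟩ := EvolvingFEM.CurvedMesh.exists_gradSq_le n hk1
  set ε : ℝ := min (m / 2) (c₁ / (8 * c₃)) with hε
  have hε0 : 0 < ε := by positivity
  set K₁ : ℝ := 32 * c₃ ^ 2 / c₁ with hK₁
  have hK₁0 : 0 < K₁ := by positivity
  set K₃ : ℝ := Real.exp ((1 + K₁ / c₁) * T) * (2 / c₁) with hK₃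
  have hK₃0 : 0 < K₃ := by positivity
  have hβ0 : 0 < ε ^ 2 / Ci := by positivity
  obtain ⟨h₂, hh₂, hrpow⟩ := EvolvingFEM.exists_width_rpow_lt (γ := 2 * κ - n)
    (K := K₃ * (T * C ^ 2)) (by linarith) (by positivity) hβ0
  refine ⟨min h₁ h₂, by positivity, c₂ * K₃ + K₁ * K₃ + 2, by positivity, ?_⟩
  intro M hM hw x v hsol d hd hdb
  have hw0 : 0 < M.width := M.width_pos hn0 hk1 F.connected.nonempty
  set h := M.width with hh
  set s : ℝ := h ^ n / h ^ 2 with hs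
  have hs0 : 0 < s := by positivity
  set y := EvolvingFEM.xStar F M with hy
  have hr := hreg M hM (hw.trans (min_le_left _ _))
  have hlow : ∀ t ∈ Icc (0 : ℝ) T, ∀ S, ∀ ξ ∈ EvolvingFEM.refSimplex n, ∀ u,
      m * h * ‖u‖ ≤ ‖M.jacobian (y t) S ξ u‖ := fun t ht S ξ hξ => (hr t ht S ξ hξ).1
  have hup : ∀ t ∈ Icc (0 : ℝ) T, ∀ S, ∀ ξ ∈ EvolvingFEM.refSimplex n,
      ‖M.jacobian (y t) S ξ‖ ≤ C' * h := fun t ht S ξ hξ => (hr t ht S ξ hξ).2.1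
  have Hs := fun t ht => H M h hw0 (y t) (hlow t ht) (hup t ht)
  have hA : ∀ t ∈ Icc (0 : ℝ) T, (M.A₂₂ (y t)).PosDef := fun t ht =>
    M.posDef_A₂₂ hn0 hk1 F.bounded F.connected (mul_pos hc₁ hs0) (Hs t ht).2.1
  have hδc : ContinuousOn (fun t => EvolvingFEM.starNorm M (y t) (d t) ^ 2) (Icc 0 T) :=
    EvolvingFEM.continuousOn_starNorm_sq hk1 hd hA
      (M.continuousOn_stiffnessMatrix (EvolvingFEM.continuous_xStar F M).continuousOn
        (mul_pos hm hw0) hlow fun t ht => (Hs t ht).1)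
  have hvel : ∀ t ∈ Icc (0 : ℝ) T,
      s * EvolvingFEM.kronForm M.refMatrix (x t - y t) (x t - y t) ≤ ε ^ 2 / Ci * h ^ n →
      EvolvingFEM.kronForm (M.A₂₂ (y t)) (EvolvingFEM.velocityError F M v t)
        (EvolvingFEM.velocityError F M v t) ≤
      K₁ * (s * EvolvingFEM.kronForm M.refMatrix (x t - y t) (x t - y t)) +
        2 * EvolvingFEM.starNorm M (y t) (d t) ^ 2 := by
    intro t ht hsm
    have hJ : ∀ S, ∀ ξ ∈ EvolvingFEM.refSimplex n,
        ‖M.jacobian (x t) S ξ - M.jacobian (y t) S ξ‖ ≤ ε * h := by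
      intro S ξ hξ
      rw [EvolvingFEM.CurvedMesh.jacobian_sub]
      refine abs_le_of_sq_le_sq' ?_ (by positivity) |>.2
      refine (M.norm_jacobian_sq_le _ S ξ).trans ((hinv M _ S ξ hξ).trans ?_)
      have e : Ci * EvolvingFEM.kronForm M.refMatrix (x t - y t) (x t - y t) =
          Ci * (h ^ 2 / h ^ n) *
            (s * EvolvingFEM.kronForm M.refMatrix (x t - y t) (x t - y t)) := by
        rw [hs]; field_simp
      rw [e]
      calc _ ≤ Ci * (h ^ 2 / h ^ n) * (ε ^ 2 / Ci * h ^ n) :=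
            mul_le_mul_of_nonneg_left hsm (by positivity)
        _ = (ε * h) ^ 2 := by field_simp
    have hd2 := (Hs t ht).2.2.2 ε (min_le_left _ _) (x t) hJ
    refine M.velocityError_estimate (hA t ht) hc₁ hc₃ hs0 (min_le_right _ _) (Hs t ht).2.1
      (fun w => (hd2 w).1)
      (fun w => (hd2 w).2 (EvolvingFEM.vStar F M t) fun S ξ hξ => (hr t ht S ξ hξ).2.2)
      (hsol.interior t ht) (hd t ht) (hsol.boundaryVelocity_eq hk1 ht)
  have hmain := EvolvingFEM.error_le_integral_of_bounds hk1 hsol (s := s) (K := K₁ / c₁)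
    (b := 2 / c₁) (η := ε ^ 2 / Ci * h ^ n) (D := C ^ 2 * h ^ (2 * κ)) hs0 (by positivity)
    (by positivity) (by positivity) hδc (fun t _ => by positivity) ?_ ?_ ?_
  · intro t ht
    obtain ⟨hsm, hint⟩ := hmain t ht
    have hI0 : 0 ≤ ∫ r in (0 : ℝ)..t, EvolvingFEM.starNorm M (y r) (d r) ^ 2 :=
      intervalIntegral.integral_nonneg ht.1 fun _ _ => by positivity
    rw [EvolvingFEM.energyNorm_sq (EvolvingFEM.kronForm_nonneg_of_posDef (hA t ht) _),
      EvolvingFEM.energyNorm_sq (EvolvingFEM.kronForm_nonneg_of_posDef (hA t ht) _)]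
    set I := ∫ r in (0 : ℝ)..t, EvolvingFEM.starNorm M (y r) (d r) ^ 2 with hI
    have p1 : 0 ≤ c₂ * K₃ * I := by positivity
    have p2 : 0 ≤ K₁ * K₃ * I := by positivity
    have p3 : 0 ≤ (c₂ * K₃ + K₁ * K₃) * EvolvingFEM.starNorm M (y t) (d t) ^ 2 := by positivity
    constructor
    · rw [← M.kronForm_extendZero, EvolvingFEM.extendZero_positionError hk1 hsol ht]
      have h1 := (Hs t ht).2.2.1 (x t - y t)
      have h2 := mul_le_mul_of_nonneg_left hint hc₂.le
      linarith
    · have h1 := hvel t ht hsm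
      have h2 := mul_le_mul_of_nonneg_left hint hK₁0.le
      linarith
  · intro t ht
    have h0 : 0 ≤ EvolvingFEM.starNorm M (y t) (d t) := Real.sqrt_nonneg _
    refine (pow_le_pow_left₀ h0 (hdb t ht) 2).trans (le_of_eq ?_)
    rw [mul_pow, ← Real.rpow_natCast (h ^ κ) 2, ← Real.rpow_mul hw0.le]
    congr 2
    push_cast
    ring
  · have h1 := hrpow h hw0 (hw.trans (min_le_right _ _))
    have h2 : h ^ (2 * κ) = h ^ (2 * κ - n) * h ^ n := by
      rw [← Real.rpow_natCast h n, ← Real.rpow_add hw0]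
      congr 1
      ring
    rw [h2]
    calc _ = K₃ * (T * C ^ 2) * h ^ (2 * κ - n) * h ^ n := by ring
      _ < _ := mul_lt_mul_of_pos_right h1 (by positivity)
  · intro t ht hsm
    have h1 := hvel t ht hsm
    have h2 := (Hs t ht).2.1 (v t - EvolvingFEM.vStar F M t)
    rw [← EvolvingFEM.extendZero_velocityError hk1 hsol ht, M.kronForm_extendZero,
      EvolvingFEM.extendZero_velocityError hk1 hsol ht] at h2
    have h3 := h2.trans h1
    have e : K₁ / c₁ * (s * EvolvingFEM.kronForm M.refMatrix (x t - y t) (x t - y t)) +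
        2 / c₁ * EvolvingFEM.starNorm M (y t) (d t) ^ 2 =
        (K₁ * (s * EvolvingFEM.kronForm M.refMatrix (x t - y t) (x t - y t)) +
          2 * EvolvingFEM.starNorm M (y t) (d t) ^ 2) / c₁ := by ring
    rw [e, le_div_iff₀ hc₁]
    linarith
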